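/- All manifolds are smooth, connected and without boundary. $B_r(p)$ denotes the open geodesic ball, integrals are taken with respect to the Riemannian measure, and $|{\rm Rm}|$ is the norm of the full curvature tensor, $|{\rm Rm}|^2=\sum_{i,j,k,l} R_{ijkl}^2$ in an orthonormal frame. For an integer $n$ and a class $\mathcal C$ of complete $n$-dimensional Riemannian manifolds, say that *$\epsilon$-regularity holds on $\mathcal C$* if there are constants $\epsilon>0$ and $C$ such that for every $(M,g)\in\mathcal C$, $p\in M$ and $0<r\le 1$, $$\int_{B_r(p)}|{\rm Rm}|^{n/2}\le\epsilon\quad\Longrightarrow\quad \sup_{B_{r/2}(p)}|{\rm Rm}|\le C r^{-2}.$$ A metric is called critical if $\Delta {\rm Ric}={\rm Rm}*{\rm Ric}$, where ${\rm Rm}*{\rm Ric}$ is a linear combination with constant coefficients of the symmetric 2-tensors obtained from ${\rm Rm}\otimes{\rm Ric}$ by contractions and multiplication by $g$. Write ${\rm Ric}^2_{ij}={\rm Ric}_{ik}{\rm Ric}_{kj}$, and let ${\rm Rm}({\rm Ric})_{ij}$ be the contraction of ${\rm Rm}$ with ${\rm Ric}$, with the sign for which ${\rm Rm}(g)={\rm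 Ric}$. **Theorem.** 1. $\epsilon$-regularity does not hold on the class of complete 4-dimensional critical metrics. It does not even hold on the class of complete scalar-flat Kähler metrics of real dimension 4 satisfying $\Delta{\rm Ric}=2\,{\rm Ric}^2-2\,{\rm Rm}({\rm Ric})$. 2. For every $n\ge5$, $\epsilon$-regularity does not hold on the class of complete $n$-dimensional Einstein metrics, ${\rm Ric}=\lambda g$ with $|\lambda|\le n-1$. 3. There is a complete noncompact surface $(N,h)$ of constant curvature $-1$ and finite area such that for every $a>0$ the Riemannian product $M_a=(N,a^2h)\times S^2_a$, where $S^2_a$ is the round sphere of curvature $a^{-2}$, is a complete scalar-flat Kähler manifold of real dimension 4, satisfies $\Delta{\rm Ric}=2\,{\rm Ric}^2-2\,{\rm Rm}({\rm Ric})$, has $|{\rm Rm}|\equiv 2\sqrt2\,a^{-2}$, and for every $\epsilon>0$ contains a point $x$ with $\int_{B_1(x)}|{\rm Rm}|^2\le\epsilon$. 4. For every $n\ge5$ and $a>0$ there are a complete Ricci-flat manifold $N_a$ of dimension $n-1$ and a point $p_a\in N_a$ with $|{\rm Rm}|(p_a)=\max_{N_a}|{\rm Rm}|=a$ such that the following holds.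 For every $\epsilon>0$ there is $\theta_0>0$ such that for all $0<\theta\le\theta_0$ the product $N_a\times S^1_\theta$ with the circle of radius $\theta$ is a complete Ricci-flat manifold of dimension $n$ and, for every $q\in S^1_\theta$, $|{\rm Rm}|(p_a,q)=a$ and $\int_{B_1((p_a,q))}|{\rm Rm}|^{n/2}\le\epsilon$. -/

import Mathlib

open Bundle ContinuousLinearMap Manifold MeasureTheory Filter
open scoped ContDiff Manifold Topology ENNReal

noncomputable section

/-! ### Smooth pullback of bilinear forms -/

/-- The pullback `(v, w) ↦ B (A v) (A w)` of a bilinear form `B` under a linear map `A`. -/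
def pullbackForm {V W : Type} [AddCommGroup V] [Module ℝ V] [TopologicalSpace V]
    [AddCommGroup W] [Module ℝ W] [TopologicalSpace W]
    (B : W →L[ℝ] W →L[ℝ] ℝ) (A : V →L[ℝ] W) : V →L[ℝ] V →L[ℝ] ℝ :=
  (ContinuousLinearMap.precomp ℝ A).comp (B.comp A)

@[simp] theorem pullbackForm_apply {V W : Type} [AddCommGroup V] [Module ℝ V] [TopologicalSpace V]
    [AddCommGroup W] [Module ℝ W] [TopologicalSpace W]
    (B : W →L[ℝ] W →L[ℝ] ℝ) (A : V →L[ℝ] W) (v w : V) :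
    pullbackForm B A v w = B (A v) (A w) := rfl

theorem contMDiff_pullbackForm
    {E H M E' H' M' : Type} [NormedAddCommGroup E] [NormedSpace ℝ E]
    [TopologicalSpace H] {I : ModelWithCorners ℝ E H} [TopologicalSpace M] [ChartedSpace H M]
    [IsManifold I ∞ M]
    [NormedAddCommGroup E'] [NormedSpace ℝ E']
    [TopologicalSpace H'] {I' : ModelWithCorners ℝ E' H'} [TopologicalSpace M'] [ChartedSpace H' M']
    [IsManifold I' ∞ M']
    {f : M → M'} (hf : ContMDiff I I' ∞ f)
    {h : ∀ y : M', TangentSpace I' y →L[ℝ] TangentSpace I' y →L[ℝ] ℝ}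
    (hh : ContMDiff I' (I'.prod 𝓘(ℝ, E' →L[ℝ] E' →L[ℝ] ℝ)) ∞
      (fun y ↦ TotalSpace.mk' (E' →L[ℝ] E' →L[ℝ] ℝ) y (h y))) :
    ContMDiff I (I.prod 𝓘(ℝ, E →L[ℝ] E →L[ℝ] ℝ)) ∞
      (fun x ↦ TotalSpace.mk' (E →L[ℝ] E →L[ℝ] ℝ)
        (E := fun x : M ↦ TangentSpace I x →L[ℝ] TangentSpace I x →L[ℝ] ℝ) x
        (pullbackForm (h (f x)) (mfderiv I I' f x))) := by
  intro x₀
  have hh₀ := (hh (f x₀))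
  rw [contMDiffAt_hom_bundle] at hh₀
  have hA := (hf x₀).mfderiv_const (m := ∞) (by simp)
  have hB := hh₀.2.comp x₀ (hf x₀)
  rw [contMDiffAt_hom_bundle]
  refine ⟨contMDiffAt_id, ?_⟩
  refine ContMDiffAt.congr_of_eventuallyEq
    ((ContMDiffAt.clm_precomp (F₃ := ℝ) hA).clm_comp (hB.clm_comp hA)) ?_
  have h1 : ∀ᶠ x in 𝓝 x₀, x ∈ (trivializationAt E (TangentSpace I) x₀).baseSet :=
    (trivializationAt E (TangentSpace I) x₀).open_baseSet.mem_nhds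
      (FiberBundle.mem_baseSet_trivializationAt' x₀)
  have h2 : ∀ᶠ x in 𝓝 x₀, f x ∈ (trivializationAt E' (TangentSpace I') (f x₀)).baseSet :=
    (hf x₀).continuousAt ((trivializationAt E' (TangentSpace I') (f x₀)).open_baseSet.mem_nhds
      (FiberBundle.mem_baseSet_trivializationAt' (f x₀)))
  filter_upwards [h1, h2] with x hx hx'
  ext v w
  rw [inCoordinates_apply_eq₂ hx hx (Set.mem_univ _)]
  change _ = inCoordinates E' (TangentSpace I') (E' →L[ℝ] ℝ)
    (fun b : M' => TangentSpace I' b →L[ℝ] ℝ) (f x₀) (f x) (f x₀) (f x) (h (f x))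
    (inCoordinates E (TangentSpace I) E' (TangentSpace I') x₀ x (f x₀) (f x) (mfderiv I I' f x) v)
    (inCoordinates E (TangentSpace I) E' (TangentSpace I') x₀ x (f x₀) (f x) (mfderiv I I' f x) w)
  rw [inCoordinates_apply_eq₂ hx' hx' (Set.mem_univ _), inCoordinates_eq hx hx']
  have key : ∀ u : TangentSpace I' (f x),
      (trivializationAt E' (TangentSpace I') (f x₀)).symm (f x)
        ((trivializationAt E' (TangentSpace I') (f x₀)) ⟨f x, u⟩).2 = u :=
    fun u => Trivialization.symm_apply_apply_mk _ hx' u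
  simp [pullbackForm, Trivialization.continuousLinearEquivAt_apply]
  rw [key, key]

/-- On a finite-dimensional space the open unit ball of a positive definite form is bounded. -/
theorem isVonNBounded_of_posDef {E : Type} [NormedAddCommGroup E] [NormedSpace ℝ E]
    [FiniteDimensional ℝ E] (B : E →L[ℝ] E →L[ℝ] ℝ) (hB : ∀ v, v ≠ 0 → 0 < B v v) :
    Bornology.IsVonNBounded ℝ {v : E | B v v < 1} := by
  rw [NormedSpace.isVonNBounded_iff]
  have hc : Continuous fun v : E => B v v := by fun_prop
  rcases (Metric.sphere (0 : E) 1).eq_empty_or_nonempty with h0 | hne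
  · have hE : ∀ v : E, v = 0 := by
      intro v
      by_contra hv
      have : (‖v‖⁻¹ • v) ∈ Metric.sphere (0 : E) 1 := by
        simp [norm_smul, hv]
      rw [h0] at this
      exact this
    exact Bornology.IsBounded.subset (t := {0}) Bornology.isBounded_singleton
      (fun v _ => hE v)
  · obtain ⟨m, hm, hmin⟩ := (isCompact_sphere (0 : E) 1).exists_isMinOn hne hc.continuousOn
    have hm0 : m ≠ 0 := by
      rintro rfl
      simp at hm
    have hpos := hB m hm0
    refine (Metric.isBounded_closedBall (x := (0 : E)) (r := Real.sqrt (B m m)⁻¹)).subset ?_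
    intro v hv
    rw [mem_closedBall_zero_iff]
    apply Real.le_sqrt_of_sq_le
    by_cases hv0 : v = 0
    · subst hv0
      simpa using hpos.le
    have hvn : 0 < ‖v‖ := norm_pos_iff.2 hv0
    have hs : (‖v‖⁻¹ • v) ∈ Metric.sphere (0 : E) 1 := by
      simp [norm_smul, hv0]
    have h1 : B m m ≤ B (‖v‖⁻¹ • v) (‖v‖⁻¹ • v) := hmin hs
    simp only [map_smul, smul_apply, smul_eq_mul] at h1
    have hv' : B v v < 1 := hv
    have h2 : B m m * ‖v‖ ^ 2 ≤ B v v := by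
      calc B m m * ‖v‖ ^ 2 ≤ (‖v‖⁻¹ * (‖v‖⁻¹ * B v v)) * ‖v‖ ^ 2 := by gcongr
        _ = B v v := by field_simp
    rw [le_inv_comm₀ (by positivity) hpos]
    rw [le_inv_comm₀ hpos (by positivity)]
    rw [← one_div, le_div_iff₀ hpos]
    nlinarith

/-! ### Riemannian manifolds -/

/-- A smooth finite-dimensional Riemannian manifold without boundary, Hausdorff and second
countable. -/
structure RiemMfd : Type 1 where
  /-- the model vector space -/
  E : Type
  /-- the model space of the charts -/
  H : Type
  /-- the underlying set -/
  M : Type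
  [normedE : NormedAddCommGroup E]
  [spaceE : NormedSpace ℝ E]
  [finE : FiniteDimensional ℝ E]
  [topH : TopologicalSpace H]
  I : ModelWithCorners ℝ E H
  [boundaryless : I.Boundaryless]
  [topM : TopologicalSpace M]
  [charted : ChartedSpace H M]
  [manifold : IsManifold I ∞ M]
  [t2 : T2Space M]
  [secondCountable : SecondCountableTopology M]
  /-- the Riemannian metric -/
  g : ContMDiffRiemannianMetric I ∞ E (fun x : M => TangentSpace I x)

namespace RiemMfd

attribute [instance] normedE spaceE finE topH boundaryless topM charted manifold t2
  secondCountable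

instance (X : RiemMfd) : MeasurableSpace X.E := borel X.E
instance (X : RiemMfd) : BorelSpace X.E := ⟨rfl⟩
instance (X : RiemMfd) : MeasurableSpace X.M := borel X.M
instance (X : RiemMfd) : BorelSpace X.M := ⟨rfl⟩

/-- The dimension of the manifold. -/
def dim (X : RiemMfd) : ℕ := Module.finrank ℝ X.E

set_option synthInstance.maxHeartbeats 400000 in
/-- The manifold `(M, a² g)`. -/
def rescale (X : RiemMfd) (a : ℝ) (ha : 0 < a) : RiemMfd where
  E := X.E
  H := X.H
  M := X.M
  I := X.I
  g :=
    { inner := fun x => a ^ 2 • X.g.inner x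
      symm := fun x v w => by simp [X.g.symm x v w]
      pos := fun x v hv => by
        have := X.g.pos x v hv
        simp only [smul_apply, smul_eq_mul]
        positivity
      isVonNBounded := fun x => by
        refine isVonNBounded_of_posDef (E := X.E) (a ^ 2 • X.g.inner x) fun v hv => ?_
        have : 0 < X.g.inner x v v := X.g.pos x v hv
        change 0 < a ^ 2 * X.g.inner x v v
        positivity
      contMDiff := X.g.contMDiff.const_smul_section (a := a ^ 2) }

/-- The product metric `g_M + g_N` on the tangent spaces of `M × N`. -/
def prodInner (X Y : RiemMfd) (x : X.M × Y.M) :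
    TangentSpace (X.I.prod Y.I) x →L[ℝ] TangentSpace (X.I.prod Y.I) x →L[ℝ] ℝ :=
  pullbackForm (X.g.inner x.1) (mfderiv (X.I.prod Y.I) X.I Prod.fst x) +
    pullbackForm (Y.g.inner x.2) (mfderiv (X.I.prod Y.I) Y.I Prod.snd x)

theorem prodInner_apply (X Y : RiemMfd) (x : X.M × Y.M) (v w : TangentSpace (X.I.prod Y.I) x) :
    prodInner X Y x v w = X.g.inner x.1 (v : X.E × Y.E).1 (w : X.E × Y.E).1 +
      Y.g.inner x.2 (v : X.E × Y.E).2 (w : X.E × Y.E).2 := by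
  change X.g.inner x.1 (mfderiv (X.I.prod Y.I) X.I Prod.fst x v)
      (mfderiv (X.I.prod Y.I) X.I Prod.fst x w) +
    Y.g.inner x.2 (mfderiv (X.I.prod Y.I) Y.I Prod.snd x v)
      (mfderiv (X.I.prod Y.I) Y.I Prod.snd x w) = _
  rw [mfderiv_fst, mfderiv_snd]
  rfl

theorem prod_pos (X Y : RiemMfd) (x : X.M × Y.M) (v : TangentSpace (X.I.prod Y.I) x)
    (hv : v ≠ 0) : 0 < prodInner X Y x v v := by
  rw [prodInner_apply]
  have nX : ∀ u : TangentSpace X.I x.1, 0 ≤ X.g.inner x.1 u u := fun u => by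
    by_cases hu : u = 0
    · simp [hu]
    · exact (X.g.pos _ _ hu).le
  have nY : ∀ u : TangentSpace Y.I x.2, 0 ≤ Y.g.inner x.2 u u := fun u => by
    by_cases hu : u = 0
    · simp [hu]
    · exact (Y.g.pos _ _ hu).le
  by_cases h1 : (v : X.E × Y.E).1 = 0
  · have h2 : (v : X.E × Y.E).2 ≠ 0 := fun h2 => hv (Prod.ext h1 h2)
    exact add_pos_of_nonneg_of_pos (nX _) (Y.g.pos _ _ h2)
  · exact add_pos_of_pos_of_nonneg (X.g.pos _ _ h1) (nY _)

set_option synthInstance.maxHeartbeats 400000 in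
set_option maxHeartbeats 1000000 in
/-- The Riemannian product `(M × N, g_M + g_N)`. -/
def prod (X Y : RiemMfd) : RiemMfd where
  E := X.E × Y.E
  H := ModelProd X.H Y.H
  M := X.M × Y.M
  I := X.I.prod Y.I
  g :=
    { inner := prodInner X Y
      symm := fun x v w => by
        rw [prodInner_apply, prodInner_apply]
        exact congrArg₂ (· + ·) (X.g.symm _ _ _) (Y.g.symm _ _ _)
      pos := fun x v hv => prod_pos X Y x v hv
      isVonNBounded := fun x =>
        isVonNBounded_of_posDef (E := X.E × Y.E) (prodInner X Y x) (prod_pos X Y x)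
      contMDiff :=
        (contMDiff_pullbackForm contMDiff_fst X.g.contMDiff).add_section
          (contMDiff_pullbackForm contMDiff_snd Y.g.contMDiff) }

/-- The form induced on the unit sphere `Sⁿ` by the Euclidean inner product of `ℝⁿ⁺¹`, the pullback
under the inclusion. -/
def sphereInner (n : ℕ) (x : Metric.sphere (0 : EuclideanSpace ℝ (Fin (n + 1))) 1) :
    TangentSpace (𝓡 n) x →L[ℝ] TangentSpace (𝓡 n) x →L[ℝ] ℝ :=
  pullbackForm ((riemannianMetricVectorSpace (EuclideanSpace ℝ (Fin (n + 1)))).inner x)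
    (mfderiv (𝓡 n) 𝓘(ℝ, EuclideanSpace ℝ (Fin (n + 1))) Subtype.val x)

theorem sphere_pos (n : ℕ) (x : Metric.sphere (0 : EuclideanSpace ℝ (Fin (n + 1))) 1)
    (v : TangentSpace (𝓡 n) x) (hv : v ≠ 0) : 0 < sphereInner n x v v := by
  have := Fact.mk (@finrank_euclideanSpace_fin ℝ _ (n + 1))
  refine (riemannianMetricVectorSpace (EuclideanSpace ℝ (Fin (n + 1)))).pos _ _ fun h => hv ?_
  have inj : Function.Injective
      (mfderiv (𝓡 n) 𝓘(ℝ, EuclideanSpace ℝ (Fin (n + 1))) Subtype.val x) := by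
    convert! injective_mvfderiv_subtypeVal_sphere x
  exact inj (h.trans (map_zero _).symm)

/-- The unit sphere `Sⁿ ⊆ ℝⁿ⁺¹` with the metric induced by the Euclidean inner product. -/
def roundSphere (n : ℕ) : RiemMfd where
  E := EuclideanSpace ℝ (Fin n)
  H := EuclideanSpace ℝ (Fin n)
  M := Metric.sphere (0 : EuclideanSpace ℝ (Fin (n + 1))) 1
  I := 𝓡 n
  g :=
    { inner := sphereInner n
      symm := fun x v w =>
        (riemannianMetricVectorSpace (EuclideanSpace ℝ (Fin (n + 1)))).symm _ _ _
      pos := sphere_pos n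
      isVonNBounded := fun x =>
        isVonNBounded_of_posDef (E := EuclideanSpace ℝ (Fin n)) (sphereInner n x) (sphere_pos n x)
      contMDiff := by
        have := Fact.mk (@finrank_euclideanSpace_fin ℝ _ (n + 1))
        exact contMDiff_pullbackForm contMDiff_coe_sphere
          ((riemannianMetricVectorSpace (EuclideanSpace ℝ (Fin (n + 1)))).contMDiff.of_le le_top) }

end RiemMfd

/-! ### Curvature of a metric on a vector space

Here `G : E → E →L[ℝ] E →L[ℝ] ℝ` is a field of symmetric positive definite bilinear forms on (an open
subset of) a finite-dimensional vector space `E`. Tensor fields are described by their values on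
constant vector fields. -/

namespace LocalMetric

variable {E : Type} [NormedAddCommGroup E] [NormedSpace ℝ E] [FiniteDimensional ℝ E]

/-- The trace `g^{ij} B(e_i, e_j)` of a bilinear form `B` with respect to the metric; here
`g^{ij} e_j` is obtained by raising the index of the dual basis covector `e^i`. -/
def mtrace (G : E → E →L[ℝ] E →L[ℝ] ℝ) (z : E) (B : E → E → ℝ) : ℝ :=
  ∑ i, B (Module.finBasis ℝ E i)
    ((G z).inverse (LinearMap.toContinuousLinearMap ((Module.finBasis ℝ E).coord i)))

/-- The Christoffel symbol `Γ(u, v) = ∇_u v` of the Levi-Civita connection, determined by the Koszul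
formula `g(Γ(u, v), w) = (D_u g(v, w) + D_v g(u, w) - D_w g(u, v)) / 2`. -/
def christoffel (G : E → E →L[ℝ] E →L[ℝ] ℝ) (z u v : E) : E :=
  (G z).inverse ((1 / 2 : ℝ) • (fderiv ℝ G z u v + fderiv ℝ G z v u
    - ((fderiv ℝ G z).flip u).flip v))

/-- The curvature `R(u, v) w = ∇_u ∇_v w - ∇_v ∇_u w - ∇_[u, v] w`. -/
def riemann (G : E → E →L[ℝ] E →L[ℝ] ℝ) (z u v w : E) : E :=
  fderiv ℝ (fun y => christoffel G y v w) z u - fderiv ℝ (fun y => christoffel G y u w) z v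
    + christoffel G z u (christoffel G z v w) - christoffel G z v (christoffel G z u w)

/-- The squared norm `|Rm|²` of the curvature tensor: the full contraction of `Rm ⊗ Rm`, that is the
sum of `g(R(e_i, e_j) e_k, e_l)²` over an orthonormal basis `e`. -/
def rmNormSq (G : E → E →L[ℝ] E →L[ℝ] ℝ) (z : E) : ℝ :=
  mtrace G z fun u u' => mtrace G z fun v v' => mtrace G z fun w w' => mtrace G z fun t t' =>
    G z (riemann G z u v w) t * G z (riemann G z u' v' w') t'

/-- The Ricci tensor, `Ric(v, w) = tr (u ↦ R(u, v) w)`. -/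
def ricci (G : E → E →L[ℝ] E →L[ℝ] ℝ) (z v w : E) : ℝ :=
  mtrace G z fun u u' => G z (riemann G z u v w) u'

/-- The scalar curvature. -/
def scalar (G : E → E →L[ℝ] E →L[ℝ] ℝ) (z : E) : ℝ := mtrace G z (ricci G z)

/-- The covariant derivative `(∇_a Ric)(u, v)`. -/
def nablaRic (G : E → E →L[ℝ] E →L[ℝ] ℝ) (z a u v : E) : ℝ :=
  fderiv ℝ (fun y => ricci G y u v) z a
    - ricci G z (christoffel G z a u) v - ricci G z u (christoffel G z a v)

/-- The second covariant derivative `(∇²_{a, b} Ric)(u, v)`. -/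
def nablaNablaRic (G : E → E →L[ℝ] E →L[ℝ] ℝ) (z a b u v : E) : ℝ :=
  fderiv ℝ (fun y => nablaRic G y b u v) z a - nablaRic G z (christoffel G z a b) u v
    - nablaRic G z b (christoffel G z a u) v - nablaRic G z b u (christoffel G z a v)

/-- The rough Laplacian `Δ Ric = g^{ab} ∇²_{a, b} Ric`. -/
def laplaceRic (G : E → E →L[ℝ] E →L[ℝ] ℝ) (z u v : E) : ℝ :=
  mtrace G z fun a b => nablaNablaRic G z a b u v

/-- The contraction `Rm(Ric)(u, v) = ∑ g(R(e_i, u) v, e_j) Ric(e_i, e_j)` over an orthonormal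
basis. -/
def rmRic (G : E → E →L[ℝ] E →L[ℝ] ℝ) (z u v : E) : ℝ :=
  mtrace G z fun a a' => mtrace G z fun b b' => G z (riemann G z a u v) b * ricci G z a' b'

/-- The contraction `Ric²(u, v) = ∑ Ric(u, e_i) Ric(e_i, v)` over an orthonormal basis. -/
def ricSq (G : E → E →L[ℝ] E →L[ℝ] ℝ) (z u v : E) : ℝ :=
  mtrace G z fun a a' => ricci G z u a * ricci G z a' v

/-- `|Ric|²`. -/
def ricNormSq (G : E → E →L[ℝ] E →L[ℝ] ℝ) (z : E) : ℝ :=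
  mtrace G z fun a a' => ricSq G z a a'

/-- The general expression `Rm ∗ Ric`: a linear combination, with constant coefficients `c`, of the
symmetric 2-tensors obtained from `Rm ⊗ Ric` by contractions (and multiplication by the metric). -/
def rmStarRic (c : Fin 5 → ℝ) (G : E → E →L[ℝ] E →L[ℝ] ℝ) (z u v : E) : ℝ :=
  c 0 * ricSq G z u v + c 1 * rmRic G z u v + c 2 * (scalar G z * ricci G z u v)
    + (c 3 * ricNormSq G z + c 4 * scalar G z ^ 2) * G z u v

end LocalMetric

namespace RiemMfd

/-! ### Distance, completeness and volume -/

/-- The Riemannian distance: the infimum of the lengths of `C¹` paths. -/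
def edist (X : RiemMfd) (x y : X.M) : ℝ≥0∞ :=
  letI : RiemannianBundle (fun x : X.M => TangentSpace X.I x) := ⟨X.g.toRiemannianMetric⟩
  riemannianEDist X.I x y

/-- The open geodesic ball `B_r(p)`. -/
def ball (X : RiemMfd) (p : X.M) (r : ℝ) : Set X.M := {x | X.edist p x < ENNReal.ofReal r}

/-- Completeness of the Riemannian distance: Cauchy sequences converge. -/
def IsComplete (X : RiemMfd) : Prop :=
  ∀ u : ℕ → X.M, (∀ ε : ℝ≥0∞, 0 < ε → ∃ N, ∀ m ≥ N, ∀ n ≥ N, X.edist (u m) (u n) < ε) →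
    ∃ x, Tendsto u atTop (𝓝 x)

/-- The metric in the preferred chart `φ` at `x`, i.e. its pullback under `φ⁻¹`. -/
def coordMetric (X : RiemMfd) (x : X.M) (z : X.E) : X.E →L[ℝ] X.E →L[ℝ] ℝ :=
  pullbackForm (V := X.E) (X.g.inner ((extChartAt X.I x).symm z))
    (mfderiv 𝓘(ℝ, X.E) X.I (extChartAt X.I x).symm z)

/-- The Riemannian measure of the domain of the preferred chart at `x`: in the chart it has the
density `√det g(e_i, e_j)` with respect to the Lebesgue measure normalised by the basis `e`. -/
def chartVol (X : RiemMfd) (x : X.M) : Measure X.M :=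
  (((Module.finBasis ℝ X.E).addHaar.withDensity fun z =>
    ENNReal.ofReal (Real.sqrt (Matrix.det (Matrix.of fun i j =>
      X.coordMetric x z (Module.finBasis ℝ X.E i) (Module.finBasis ℝ X.E j))))).restrict
    (extChartAt X.I x).target).map (extChartAt X.I x).symm

/-- The Riemannian measure. The measures `chartVol x` agree on the overlaps of the chart domains, and
the measure obtained by gluing them is their supremum in the lattice of measures. -/
def vol (X : RiemMfd) : Measure X.M := ⨆ x, X.chartVol x

/-! ### Curvature

All tensors at a point `x` are computed in the preferred chart at `x`, where the tangent space at
`x` is the model space `E`. -/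

/-- `|Rm|` at the point `x`. -/
def rmNorm (X : RiemMfd) (x : X.M) : ℝ :=
  Real.sqrt (LocalMetric.rmNormSq (X.coordMetric x) (extChartAt X.I x x))

/-- `Ric` at the point `x`. -/
def ricci (X : RiemMfd) (x : X.M) (u v : X.E) : ℝ :=
  LocalMetric.ricci (X.coordMetric x) (extChartAt X.I x x) u v

/-- The metric has constant (sectional) curvature `κ`. -/
def HasConstantCurvature (X : RiemMfd) (κ : ℝ) : Prop :=
  ∀ (x : X.M) (u v w : X.E),
    LocalMetric.riemann (X.coordMetric x) (extChartAt X.I x x) u v w =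
      κ • (X.coordMetric x (extChartAt X.I x x) v w • u
        - X.coordMetric x (extChartAt X.I x x) u w • v)

/-- `Ric = lam • g`. -/
def IsEinsteinWith (X : RiemMfd) (lam : ℝ) : Prop :=
  ∀ (x : X.M) (u v : X.E), X.ricci x u v = lam * X.coordMetric x (extChartAt X.I x x) u v

/-- Einstein metrics with the normalisation `Ric = lam • g`, `|lam| ≤ n - 1`. -/
def IsEinstein (X : RiemMfd) : Prop :=
  ∃ lam : ℝ, |lam| ≤ (X.dim : ℝ) - 1 ∧ X.IsEinsteinWith lam

/-- `Ric = 0`. -/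
def IsRicciFlat (X : RiemMfd) : Prop := ∀ (x : X.M) (u v : X.E), X.ricci x u v = 0

/-- The scalar curvature vanishes. -/
def IsScalarFlat (X : RiemMfd) : Prop :=
  ∀ x : X.M, LocalMetric.scalar (X.coordMetric x) (extChartAt X.I x x) = 0

/-- The metric satisfies `Δ Ric = Rm ∗ Ric`, where `Rm ∗ Ric` is given by the coefficients `c`. -/
def IsCriticalWith (c : Fin 5 → ℝ) (X : RiemMfd) : Prop :=
  ∀ (x : X.M) (u v : X.E),
    LocalMetric.laplaceRic (X.coordMetric x) (extChartAt X.I x x) u v =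
      LocalMetric.rmStarRic c (X.coordMetric x) (extChartAt X.I x x) u v

/-- A critical metric: `Δ Ric = Rm ∗ Ric`. -/
def IsCritical (X : RiemMfd) : Prop := ∃ c, X.IsCriticalWith c

/-- An endomorphism field in the preferred chart at `x`. -/
def coordEndo (X : RiemMfd) (J : ∀ x : X.M, TangentSpace X.I x →L[ℝ] TangentSpace X.I x)
    (x : X.M) (z : X.E) : X.E →L[ℝ] X.E :=
  (mfderiv 𝓘(ℝ, X.E) X.I (extChartAt X.I x).symm z).inverse.comp
    ((J ((extChartAt X.I x).symm z)).comp
      (mfderiv 𝓘(ℝ, X.E) X.I (extChartAt X.I x).symm z))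

/-- The metric is Kähler: there is a smooth almost complex structure `J` that is orthogonal and
parallel for the Levi-Civita connection. -/
def IsKaehler (X : RiemMfd) : Prop :=
  ∃ J : ∀ x : X.M, TangentSpace X.I x →L[ℝ] TangentSpace X.I x,
    ContMDiff X.I (X.I.prod 𝓘(ℝ, X.E →L[ℝ] X.E)) ∞
      (fun x ↦ TotalSpace.mk' (X.E →L[ℝ] X.E)
        (E := fun x : X.M ↦ TangentSpace X.I x →L[ℝ] TangentSpace X.I x) x (J x)) ∧
    (∀ x v, J x (J x v) = -v) ∧
    (∀ x v w, X.g.inner x (J x v) (J x w) = X.g.inner x v w) ∧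
    ∀ (x : X.M) (u v : X.E),
      fderiv ℝ (X.coordEndo J x) (extChartAt X.I x x) u v
        + LocalMetric.christoffel (X.coordMetric x) (extChartAt X.I x x) u
            (X.coordEndo J x (extChartAt X.I x x) v)
        - X.coordEndo J x (extChartAt X.I x x)
            (LocalMetric.christoffel (X.coordMetric x) (extChartAt X.I x x) u v) = 0

/-- The energy `∫_{B_r(p)} |Rm|^{n/2}`, where `n` is the dimension. -/
def energy (X : RiemMfd) (p : X.M) (r : ℝ) : ℝ≥0∞ :=
  ∫⁻ x in X.ball p r, ENNReal.ofReal (X.rmNorm x ^ ((X.dim : ℝ) / 2)) ∂X.vol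

/-- The `ε`-regularity statement without volume assumption for the complete connected `n`-dimensional
Riemannian manifolds of the class `𝒞`: there are constants `ε` and `C` such that
`∫_{B_r(p)} |Rm|^{n/2} ≤ ε` with `r ≤ 1` implies `sup_{B_{r/2}(p)} |Rm| ≤ C r⁻²`. -/
def EpsilonRegularity (n : ℕ) (𝒞 : RiemMfd → Prop) : Prop :=
  ∃ ε : ℝ, 0 < ε ∧ ∃ C : ℝ, ∀ X : RiemMfd, X.dim = n → ConnectedSpace X.M → X.IsComplete → 𝒞 X →
    ∀ (p : X.M) (r : ℝ), 0 < r → r ≤ 1 → X.energy p r ≤ ENNReal.ofReal ε →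
      ∀ x ∈ X.ball p (r / 2), X.rmNorm x ≤ C * r⁻¹ ^ 2

end RiemMfd

end

/-!
# Failure of `ε`-regularity without volume assumptions

The energy `∫ |Rm| ^ (n / 2)` over a unit ball can be small because the ball has small volume, although
the curvature is large everywhere on it. Both families of counterexamples are Riemannian products in
which one factor carries the curvature and the volume of unit balls is made small.

In dimension four the manifold is `(N, a² h) × S²_a`, where `N = Γ(3) \ ℍ` is the quotient of the upper
half plane by the principal congruence subgroup of level three. Since `Γ(3)` acts freely
(`LevelThree.eq_one_of_smul_eq`), `N` is a smooth surface of curvature `-1`. The function `height`, the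
logarithm of the largest imaginary part in an `SL(2, ℤ)`-orbit, is `1`-Lipschitz and proper on `N`, so
that `N` is complete, and its superlevel sets are covered by finitely many translates of half-strips,
whose areas tend to zero (`RiemMfd.exists_vol_superlevel_le`). Hence the area of `N` is finite and far
out in the cusps the balls of a fixed radius have arbitrarily small area
(`RiemMfd.exists_vol_ball_hyperbolic_le`). A product of surfaces of curvature `-κ` and `κ` is
scalar-flat, and its Ricci tensor is parallel, so that `Δ Ric = 0`; moreover `Ric² = Rm(Ric)`, because
both are `κ² g`. This is the equation `Δ Ric = 2 Ric² - 2 Rm(Ric)` (`RiemMfd.isCriticalWith_prod`).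
The Kähler structure is the product of the ones of the factors. On the sphere it is `v ↦ x × v`; as in
every conformal metric on a plane domain, the rotation by a right angle is parallel
(`RiemMfd.isKaehlerWith_sphere`). Finally `|Rm| = 2 √2 a⁻²` exceeds every bound as `a → 0`.

In dimension `n ≥ 5` the manifold is `N × S¹_θ`, where `N` is a rescaling of the product of a Euclidean
space and the Taub-NUT metric on `ℝ⁴`. The latter is written as `f |dz|² - (1 + 1 / f) α²` with
`f = 1 + |z|²` and `α = ⟨J z, ·⟩`; this is a smooth metric on all of `ℝ⁴` with rational coefficients. Its
curvature tensor is computed explicitly in `LocalMetric.riemann_taubNUT`: the metric is Ricci-flat and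
`|Rm|² = 384 f⁻⁶`, which is maximal at the origin. Completeness holds because `√f` is `1`-Lipschitz and
proper. Multiplication with a circle of length `2 π θ` changes neither `Ric = 0` nor `|Rm|`, whereas the
volume of unit balls is `O(θ)` (`RiemMfd.energy_prod_circle_le`).

The definitions are stated in the preferred charts of a manifold. All curvature computations therefore
take place in the coordinate space: the tensors at a point depend only on the germ of the metric
(`LocalMetric.riemann_congr` and the lemmas after it), and for products, rescalings and conformally flat
metrics they are given by formulas in the factors and conformal factors. Distances are estimated by
functions whose differentials have norm at most one (`RiemMfd.ofReal_sub_le_edist`), volumes by the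
change of variables formula in charts (`RiemMfd.vol_apply_of_subset_source`).
-/

open Bundle ContinuousLinearMap Manifold MeasureTheory Filter
open scoped ContDiff Manifold Topology ENNReal

noncomputable section

set_option linter.unusedSectionVars false
set_option maxSynthPendingDepth 3

namespace LocalMetric

variable {E : Type} [NormedAddCommGroup E] [NormedSpace ℝ E] [FiniteDimensional ℝ E]

/-! ### Metrics on a vector space and traces -/

/-- A symmetric positive definite bilinear form. -/
structure IsInner (B : E →L[ℝ] E →L[ℝ] ℝ) : Prop where
  symm : ∀ v w, B v w = B w v
  pos : ∀ v, v ≠ 0 → 0 < B v v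

/-- `G` is a smooth Riemannian metric in a neighbourhood of `z`. -/
def IsMetricAt (G : E → E →L[ℝ] E →L[ℝ] ℝ) (z : E) : Prop :=
  ∀ᶠ y in 𝓝 z, ContDiffAt ℝ ∞ G y ∧ IsInner (G y)

theorem IsMetricAt.isInner {G : E → E →L[ℝ] E →L[ℝ] ℝ} {z : E} (h : IsMetricAt G z) :
    IsInner (G z) := (h.self_of_nhds).2

theorem IsMetricAt.contDiffAt {G : E → E →L[ℝ] E →L[ℝ] ℝ} {z : E} (h : IsMetricAt G z) :
    ContDiffAt ℝ ∞ G z := (h.self_of_nhds).1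

theorem IsMetricAt.differentiableAt {G : E → E →L[ℝ] E →L[ℝ] ℝ} {z : E} (h : IsMetricAt G z) :
    DifferentiableAt ℝ G z := h.contDiffAt.differentiableAt (by simp)

theorem IsMetricAt.eventually {G : E → E →L[ℝ] E →L[ℝ] ℝ} {z : E} (h : IsMetricAt G z) :
    ∀ᶠ y in 𝓝 z, IsMetricAt G y := eventually_eventually_nhds.2 h

theorem IsInner.nondeg {B : E →L[ℝ] E →L[ℝ] ℝ} (h : IsInner B) {v : E} (hv : ∀ w, B v w = 0) :
    v = 0 := by
  by_contra h0
  exact (h.pos v h0).ne' (hv v)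

theorem IsInner.ext {B : E →L[ℝ] E →L[ℝ] ℝ} (h : IsInner B) {v v' : E}
    (hv : ∀ w, B v w = B v' w) : v = v' :=
  sub_eq_zero.1 (h.nondeg fun w => by simp [hv])

theorem IsInner.isInvertible {B : E →L[ℝ] E →L[ℝ] ℝ} (h : IsInner B) : B.IsInvertible := by
  have inj : Function.Injective (B : E →ₗ[ℝ] E →L[ℝ] ℝ) := by
    rw [← LinearMap.ker_eq_bot, LinearMap.ker_eq_bot']
    intro v hv
    exact h.nondeg fun w => by
      have := congrArg (fun φ : E →L[ℝ] ℝ => φ w) hv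
      simpa using this
  have hfin : Module.finrank ℝ E = Module.finrank ℝ (E →L[ℝ] ℝ) := by
    rw [← (LinearMap.toContinuousLinearMap (𝕜 := ℝ) (E := E) (F' := ℝ)).finrank_eq]
    exact (Subspace.dual_finrank_eq).symm
  let e := LinearEquiv.ofInjectiveOfFinrankEq (B : E →ₗ[ℝ] E →L[ℝ] ℝ) inj hfin
  exact ⟨e.toContinuousLinearEquiv, by ext v w; rfl⟩

theorem IsInner.apply_inverse {B : E →L[ℝ] E →L[ℝ] ℝ} (h : IsInner B) (φ : E →L[ℝ] ℝ) :
    B (B.inverse φ) = φ :=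
  ((h.isInvertible.inverse_apply_eq (x := B.inverse φ) (y := φ)).1 rfl).symm

theorem IsInner.inverse_eq {B : E →L[ℝ] E →L[ℝ] ℝ} (h : IsInner B) {φ : E →L[ℝ] ℝ} {x : E}
    (hx : ∀ w, B x w = φ w) : B.inverse φ = x :=
  h.isInvertible.inverse_apply_eq.2 (by ext w; exact (hx w).symm)

theorem IsInner.smul {B : E →L[ℝ] E →L[ℝ] ℝ} (h : IsInner B) {c : ℝ} (hc : 0 < c) :
    IsInner (c • B) :=
  ⟨fun v w => by simp [h.symm v w], fun v hv => by simpa using mul_pos hc (h.pos v hv)⟩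

theorem IsInner.self_nonneg {B : E →L[ℝ] E →L[ℝ] ℝ} (h : IsInner B) (v : E) : 0 ≤ B v v := by
  by_cases hv : v = 0
  · simp [hv]
  · exact (h.pos v hv).le

theorem IsInner.exists_orthogonal_basis {B : E →L[ℝ] E →L[ℝ] ℝ} (h : IsInner B) :
    ∃ b : Module.Basis (Fin (Module.finrank ℝ E)) ℝ E, ∀ i j, i ≠ j → B (b i) (b j) = 0 := by
  let B' : LinearMap.BilinForm ℝ E :=
    LinearMap.mk₂ ℝ (fun v w => B v w) (by simp) (by simp) (by simp) (by simp)
  obtain ⟨b, hb⟩ := LinearMap.BilinForm.exists_orthogonal_basis (B := B')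
    ⟨fun v w => by simpa [B'] using h.symm v w⟩
  exact ⟨b, fun i j hij => hb hij⟩

/-- A map `E × E → ℝ` that is linear in each argument. -/
structure IsBilin (f : E → E → ℝ) : Prop where
  left : ∀ v, IsLinearMap ℝ fun u => f u v
  right : ∀ u, IsLinearMap ℝ (f u)

theorem IsBilin.mul {f g : E → ℝ} (hf : IsLinearMap ℝ f) (hg : IsLinearMap ℝ g) :
    IsBilin fun u v => f u * g v :=
  ⟨fun v => ⟨fun a b => by rw [hf.map_add]; ring, fun c a => by rw [hf.map_smul]; simp; ring⟩,
    fun v => ⟨fun a b => by rw [hg.map_add]; ring, fun c a => by rw [hg.map_smul]; simp; ring⟩⟩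

theorem IsBilin.const_mul {f : E → E → ℝ} (hf : IsBilin f) (c : ℝ) :
    IsBilin fun u v => c * f u v :=
  ⟨fun v => ⟨fun a b => by rw [(hf.left v).map_add]; ring,
      fun d a => by rw [(hf.left v).map_smul]; simp; ring⟩,
    fun v => ⟨fun a b => by rw [(hf.right v).map_add]; ring,
      fun d a => by rw [(hf.right v).map_smul]; simp; ring⟩⟩

theorem IsBilin.add {f g : E → E → ℝ} (hf : IsBilin f) (hg : IsBilin g) :
    IsBilin fun u v => f u v + g u v :=
  ⟨fun v => ⟨fun a b => by rw [(hf.left v).map_add, (hg.left v).map_add]; ring,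
      fun d a => by rw [(hf.left v).map_smul, (hg.left v).map_smul]; simp; ring⟩,
    fun v => ⟨fun a b => by rw [(hf.right v).map_add, (hg.right v).map_add]; ring,
      fun d a => by rw [(hf.right v).map_smul, (hg.right v).map_smul]; simp; ring⟩⟩

theorem IsBilin.zero : IsBilin fun _ _ : E => (0 : ℝ) :=
  ⟨fun _ => ⟨by simp, by simp⟩, fun _ => ⟨by simp, by simp⟩⟩

theorem IsBilin.sum {ι : Type} (s : Finset ι) {f : ι → E → E → ℝ} (hf : ∀ i, IsBilin (f i)) :
    IsBilin fun u v => ∑ i ∈ s, f i u v := by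
  classical
  induction s using Finset.induction_on with
  | empty => simpa using IsBilin.zero
  | insert a s ha ih => simpa [Finset.sum_insert ha] using (hf a).add ih

theorem isBilin_clm (B : E →L[ℝ] E →L[ℝ] ℝ) : IsBilin fun u v => B u v :=
  ⟨fun v => ⟨by simp, by simp⟩, fun v => ⟨by simp, by simp⟩⟩

variable {G : E → E →L[ℝ] E →L[ℝ] ℝ} {z : E}

theorem mtrace_add (f g : E → E → ℝ) :
    mtrace G z (fun u v => f u v + g u v) = mtrace G z f + mtrace G z g :=
  Finset.sum_add_distrib

theorem mtrace_const_mul (c : ℝ) (f : E → E → ℝ) :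
    mtrace G z (fun u v => c * f u v) = c * mtrace G z f :=
  (Finset.mul_sum _ _ _).symm

theorem mtrace_sub (f g : E → E → ℝ) :
    mtrace G z (fun u v => f u v - g u v) = mtrace G z f - mtrace G z g :=
  Finset.sum_sub_distrib _ _

theorem mtrace_zero : mtrace G z (fun _ _ => 0) = 0 := by simp [mtrace]

theorem mtrace_congr_metric {G G' : E → E →L[ℝ] E →L[ℝ] ℝ} {z z' : E} (h : G z = G' z')
    (f : E → E → ℝ) : mtrace G z f = mtrace G' z' f := by
  simp [mtrace, h]

/-- The trace of a bilinear form computed in an orthogonal basis. -/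
theorem mtrace_eq_sum {ι : Type} [Fintype ι] (h : IsInner (G z)) (b : Module.Basis ι ℝ E)
    (hb : ∀ i j, i ≠ j → G z (b i) (b j) = 0) {f : E → E → ℝ} (hf : IsBilin f) :
    mtrace G z f = ∑ i, (G z (b i) (b i))⁻¹ * f (b i) (b i) := by
  classical
  have hpos : ∀ i, G z (b i) (b i) ≠ 0 := fun i => (h.pos _ (b.ne_zero i)).ne'
  have hinv : ∀ φ : E →ₗ[ℝ] ℝ, (G z).inverse (LinearMap.toContinuousLinearMap φ) =
      ∑ j, ((G z (b j) (b j))⁻¹ * φ (b j)) • b j := by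
    intro φ
    refine h.inverse_eq fun w => ?_
    conv_rhs => rw [← b.sum_repr w]
    conv_lhs => rw [← b.sum_repr w]
    simp only [map_sum, map_smul, smul_eq_mul, sum_apply,
      smul_apply, LinearMap.coe_toContinuousLinearMap']
    refine Finset.sum_congr rfl fun i _ => ?_
    rw [Finset.sum_eq_single i]
    · field_simp [hpos i]
    · intro j _ hj
      simp [hb j i hj]
    · simp
  let F : E →ₗ[ℝ] E →ₗ[ℝ] ℝ := LinearMap.mk₂ ℝ f
    (fun a b c => (hf.left c).map_add a b) (fun c a b => (hf.left b).map_smul c a)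
    (fun a b c => (hf.right a).map_add b c) (fun c a b => (hf.right a).map_smul c b)
  have hF : ∀ u v, f u v = F u v := fun u v => rfl
  simp only [mtrace, hF, hinv, map_sum, map_smul, smul_eq_mul]
  rw [Finset.sum_comm]
  refine Finset.sum_congr rfl fun j _ => ?_
  simp only [mul_assoc, ← Finset.mul_sum]
  congr 1
  have : F (b j) = F (∑ i, (Module.finBasis ℝ E).coord i (b j) • Module.finBasis ℝ E i) := by
    congr 1
    exact ((Module.finBasis ℝ E).sum_repr (b j)).symm
  conv_rhs => rw [this]
  simp only [map_sum, map_smul, LinearMap.sum_apply, LinearMap.smul_apply, smul_eq_mul]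

/-- The trace of the metric is the dimension. -/
theorem mtrace_self (h : IsInner (G z)) :
    mtrace G z (fun u v => G z u v) = Module.finrank ℝ E := by
  obtain ⟨b, hb⟩ := h.exists_orthogonal_basis
  rw [mtrace_eq_sum h b hb (isBilin_clm _)]
  simp [inv_mul_cancel₀ (h.pos _ (b.ne_zero _)).ne']

/-- Contraction of a covector with a vector through the metric. -/
theorem mtrace_contract (h : IsInner (G z)) {φ : E → ℝ} (hφ : IsLinearMap ℝ φ) (x : E) :
    mtrace G z (fun u v => φ u * G z v x) = φ x := by
  obtain ⟨b, hb⟩ := h.exists_orthogonal_basis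
  have hpos : ∀ i, G z (b i) (b i) ≠ 0 := fun i => (h.pos _ (b.ne_zero i)).ne'
  rw [mtrace_eq_sum h b hb (IsBilin.mul hφ ⟨by simp, by simp⟩)]
  have hx : ∀ i, G z (b i) x = G z (b i) (b i) * b.repr x i := by
    intro i
    conv_lhs => rw [← b.sum_repr x]
    simp only [map_sum, map_smul, smul_eq_mul]
    rw [Finset.sum_eq_single i]
    · ring
    · intro j _ hj
      rw [hb i j hj.symm, mul_zero]
    · simp
  have : φ x = hφ.mk' φ (∑ i, b.repr x i • b i) := by rw [b.sum_repr]; rfl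
  rw [this, map_sum]
  refine Finset.sum_congr rfl fun i _ => ?_
  rw [map_smul, hx]
  change _ = b.repr x i * φ (b i)
  field_simp [hpos i]

/-- A map `E⁴ → ℝ` that is linear in each argument. -/
structure IsQuadrilin (T : E → E → E → E → ℝ) : Prop where
  fst : ∀ v w t, IsLinearMap ℝ fun u => T u v w t
  snd : ∀ u w t, IsLinearMap ℝ fun v => T u v w t
  thd : ∀ u v t, IsLinearMap ℝ fun w => T u v w t
  fth : ∀ u v w, IsLinearMap ℝ fun t => T u v w t

/-- The squared norm of a 4-tensor in an orthogonal basis. -/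
theorem mtrace_mtrace_mtrace_mtrace_eq_sum {ι : Type} [Fintype ι] (h : IsInner (G z))
    (b : Module.Basis ι ℝ E) (hb : ∀ i j, i ≠ j → G z (b i) (b j) = 0)
    {T : E → E → E → E → ℝ} (hT : IsQuadrilin T) :
    (mtrace G z fun u u' => mtrace G z fun v v' => mtrace G z fun w w' => mtrace G z fun t t' =>
      T u v w t * T u' v' w' t') =
    ∑ i, (G z (b i) (b i))⁻¹ * ∑ j, (G z (b j) (b j))⁻¹ * ∑ k, (G z (b k) (b k))⁻¹ *
      ∑ l, (G z (b l) (b l))⁻¹ * T (b i) (b j) (b k) (b l) ^ 2 := by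
  have h4 : ∀ u u' v v' w w', (mtrace G z fun t t' => T u v w t * T u' v' w' t') =
      ∑ l, (G z (b l) (b l))⁻¹ * (T u v w (b l) * T u' v' w' (b l)) := fun u u' v v' w w' =>
    mtrace_eq_sum h b hb (IsBilin.mul (hT.fth _ _ _) (hT.fth _ _ _))
  have h3 : ∀ u u' v v', (mtrace G z fun w w' => ∑ l, (G z (b l) (b l))⁻¹ *
        (T u v w (b l) * T u' v' w' (b l))) =
      ∑ k, (G z (b k) (b k))⁻¹ * ∑ l, (G z (b l) (b l))⁻¹ *
        (T u v (b k) (b l) * T u' v' (b k) (b l)) := fun u u' v v' =>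
    mtrace_eq_sum h b hb (IsBilin.sum _ fun l =>
      (IsBilin.mul (hT.thd _ _ _) (hT.thd _ _ _)).const_mul _)
  have h2 : ∀ u u', (mtrace G z fun v v' => ∑ k, (G z (b k) (b k))⁻¹ *
        ∑ l, (G z (b l) (b l))⁻¹ * (T u v (b k) (b l) * T u' v' (b k) (b l))) =
      ∑ j, (G z (b j) (b j))⁻¹ * ∑ k, (G z (b k) (b k))⁻¹ * ∑ l, (G z (b l) (b l))⁻¹ *
        (T u (b j) (b k) (b l) * T u' (b j) (b k) (b l)) := fun u u' =>
    mtrace_eq_sum h b hb (IsBilin.sum _ fun k => (IsBilin.sum _ fun l =>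
      (IsBilin.mul (hT.snd _ _ _) (hT.snd _ _ _)).const_mul _).const_mul _)
  simp only [h4, h3, h2]
  rw [mtrace_eq_sum h b hb (IsBilin.sum _ fun j => (IsBilin.sum _ fun k => (IsBilin.sum _ fun l =>
      (IsBilin.mul (hT.fst _ _ _) (hT.fst _ _ _)).const_mul _).const_mul _).const_mul _)]
  simp only [pow_two]

/-! ### The Levi-Civita connection and the curvature tensor -/

/-- The Koszul formula, in coordinates. -/
theorem koszul (h : IsInner (G z)) (u v w : E) :
    G z (christoffel G z u v) w =
      (fderiv ℝ G z u v w + fderiv ℝ G z v u w - fderiv ℝ G z w u v) / 2 := by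
  rw [christoffel, h.apply_inverse]
  simp [div_eq_inv_mul]

/-- The Christoffel symbols are determined by the Koszul formula: a way to compute them without
inverting the metric. -/
theorem christoffel_eq (h : IsInner (G z)) {u v x : E}
    (hx : ∀ w, G z x w =
      (fderiv ℝ G z u v w + fderiv ℝ G z v u w - fderiv ℝ G z w u v) / 2) :
    christoffel G z u v = x :=
  h.ext fun w => by rw [koszul h, hx]

/-- The derivative of the metric is symmetric in the arguments of the metric. -/
theorem fderiv_symm (h : IsMetricAt G z) (u v w : E) :
    fderiv ℝ G z u v w = fderiv ℝ G z u w v := by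
  have hd := h.differentiableAt.hasFDerivAt
  have h1 : HasFDerivAt (fun y => G y v w) (((fderiv ℝ G z).flip v).flip w) z := by
    have := (hd.clm_apply (hasFDerivAt_const v z)).clm_apply (hasFDerivAt_const w z)
    convert! this using 1
    ext; simp
  have h2 : HasFDerivAt (fun y => G y w v) (((fderiv ℝ G z).flip w).flip v) z := by
    have := (hd.clm_apply (hasFDerivAt_const w z)).clm_apply (hasFDerivAt_const v z)
    convert! this using 1
    ext; simp
  have h3 : (fun y => G y v w) =ᶠ[𝓝 z] fun y => G y w v := by
    filter_upwards [h] with y hy using hy.2.symm v w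
  have := h1.unique (h2.congr_of_eventuallyEq h3)
  simpa using congrArg (fun φ : E →L[ℝ] ℝ => φ u) this

/-- The connection is metric. -/
theorem fderiv_metric (h : IsMetricAt G z) (a u v : E) :
    fderiv ℝ G z a u v = G z (christoffel G z a u) v + G z u (christoffel G z a v) := by
  rw [h.isInner.symm u, koszul h.isInner, koszul h.isInner, fderiv_symm h a v u]
  ring

theorem christoffel_add_left (u u' v : E) :
    christoffel G z (u + u') v = christoffel G z u v + christoffel G z u' v := by
  simp only [christoffel, ← map_add]
  congr 1
  ext w
  simp
  ring

theorem christoffel_smul_left (c : ℝ) (u v : E) :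
    christoffel G z (c • u) v = c • christoffel G z u v := by
  simp only [christoffel, ← map_smul]
  congr 1
  ext w
  simp
  ring

theorem christoffel_add_right (u v v' : E) :
    christoffel G z u (v + v') = christoffel G z u v + christoffel G z u v' := by
  simp only [christoffel, ← map_add]
  congr 1
  ext w
  simp
  ring

theorem christoffel_smul_right (c : ℝ) (u v : E) :
    christoffel G z u (c • v) = c • christoffel G z u v := by
  simp only [christoffel, ← map_smul]
  congr 1
  ext w
  simp
  ring

theorem IsMetricAt.contDiffAt_christoffel (h : IsMetricAt G z) (u v : E) :
    ContDiffAt ℝ ∞ (fun y => christoffel G y u v) z := by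
  obtain ⟨e, he⟩ := h.isInner.isInvertible
  have hd : ContDiffAt ℝ ∞ (fderiv ℝ G) z := h.contDiffAt.fderiv_right (by simp)
  have hi : ContDiffAt ℝ ∞ (fun y => (G y).inverse) z := by
    have := contDiffAt_map_inverse (n := ∞) e
    rw [he] at this
    exact this.comp z h.contDiffAt
  unfold christoffel
  refine hi.clm_apply (ContDiffAt.const_smul _ ?_)
  refine ContDiffAt.sub (ContDiffAt.add ?_ ?_) ?_
  · exact (hd.clm_apply contDiffAt_const).clm_apply contDiffAt_const
  · exact (hd.clm_apply contDiffAt_const).clm_apply contDiffAt_const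
  · have h1 : ContDiff ℝ ∞ fun A : E →L[ℝ] E →L[ℝ] E →L[ℝ] ℝ => A.flip :=
      (ContinuousLinearMap.flipₗᵢ ℝ E E (E →L[ℝ] ℝ)).contDiff
    have h2 : ContDiff ℝ ∞ fun A : E →L[ℝ] E →L[ℝ] ℝ => A.flip :=
      (ContinuousLinearMap.flipₗᵢ ℝ E E ℝ).contDiff
    exact ((h2.contDiffAt.comp z ((h1.contDiffAt.comp z hd).clm_apply contDiffAt_const))).clm_apply
      contDiffAt_const

theorem IsMetricAt.differentiableAt_christoffel (h : IsMetricAt G z) (u v : E) :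
    DifferentiableAt ℝ (fun y => christoffel G y u v) z :=
  (h.contDiffAt_christoffel u v).differentiableAt (by simp)

theorem riemann_add_left (h : IsMetricAt G z) (u u' v w : E) :
    riemann G z (u + u') v w = riemann G z u v w + riemann G z u' v w := by
  have hd := fun a b => h.differentiableAt_christoffel a b
  simp only [riemann, christoffel_add_left, christoffel_add_right, map_add]
  rw [fderiv_fun_add (hd _ _) (hd _ _)]
  simp only [add_apply]
  abel

theorem riemann_smul_left (h : IsMetricAt G z) (c : ℝ) (u v w : E) :
    riemann G z (c • u) v w = c • riemann G z u v w := by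
  have hd := fun a b => h.differentiableAt_christoffel a b
  simp only [riemann, christoffel_smul_left, christoffel_smul_right, map_smul]
  rw [fderiv_fun_const_smul (hd _ _)]
  simp only [smul_apply]
  module

theorem riemann_swap (u v w : E) : riemann G z v u w = -riemann G z u v w := by
  simp only [riemann]
  abel

theorem riemann_add_mid (h : IsMetricAt G z) (u v v' w : E) :
    riemann G z u (v + v') w = riemann G z u v w + riemann G z u v' w := by
  rw [riemann_swap, riemann_add_left h, riemann_swap v, riemann_swap v']
  abel

theorem riemann_smul_mid (h : IsMetricAt G z) (c : ℝ) (u v w : E) :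
    riemann G z u (c • v) w = c • riemann G z u v w := by
  rw [riemann_swap, riemann_smul_left h, riemann_swap v]
  simp

theorem riemann_add_right (h : IsMetricAt G z) (u v w w' : E) :
    riemann G z u v (w + w') = riemann G z u v w + riemann G z u v w' := by
  have hd := fun a b => h.differentiableAt_christoffel a b
  simp only [riemann, christoffel_add_right]
  rw [fderiv_fun_add (hd _ _) (hd _ _), fderiv_fun_add (hd _ _) (hd _ _)]
  simp only [add_apply]
  abel

theorem riemann_smul_right (h : IsMetricAt G z) (c : ℝ) (u v w : E) :
    riemann G z u v (c • w) = c • riemann G z u v w := by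
  have hd := fun a b => h.differentiableAt_christoffel a b
  simp only [riemann, christoffel_smul_right]
  rw [fderiv_fun_const_smul (hd _ _), fderiv_fun_const_smul (hd _ _)]
  simp only [smul_apply]
  module

theorem isQuadrilin_riemann (h : IsMetricAt G z) :
    IsQuadrilin fun u v w t => G z (riemann G z u v w) t :=
  ⟨fun _ _ _ => ⟨by simp [riemann_add_left h], by simp [riemann_smul_left h]⟩,
    fun _ _ _ => ⟨by simp [riemann_add_mid h], by simp [riemann_smul_mid h]⟩,
    fun _ _ _ => ⟨by simp [riemann_add_right h], by simp [riemann_smul_right h]⟩,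
    fun _ _ _ => ⟨by simp, by simp⟩⟩

theorem isBilin_ricci (h : IsMetricAt G z) : IsBilin (ricci G z) := by
  have hT := isQuadrilin_riemann h
  refine ⟨fun w => ⟨fun v v' => ?_, fun c v => ?_⟩, fun v => ⟨fun w w' => ?_, fun c w => ?_⟩⟩
  · simp only [ricci, fun u u' => (hT.snd u w u').map_add v v', mtrace_add]
  · simp only [ricci, fun u u' => (hT.snd u w u').map_smul c v, smul_eq_mul, mtrace_const_mul]
  · simp only [ricci, fun u u' => (hT.thd u v u').map_add w w', mtrace_add]
  · simp only [ricci, fun u u' => (hT.thd u v u').map_smul c w, smul_eq_mul, mtrace_const_mul]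

theorem ricci_eq_sum {ι : Type} [Fintype ι] (h : IsMetricAt G z) (b : Module.Basis ι ℝ E)
    (hb : ∀ i j, i ≠ j → G z (b i) (b j) = 0) (v w : E) :
    ricci G z v w = ∑ i, (G z (b i) (b i))⁻¹ * G z (riemann G z (b i) v w) (b i) :=
  mtrace_eq_sum h.isInner b hb
    ⟨fun t => (isQuadrilin_riemann h).fst v w t, fun u => (isQuadrilin_riemann h).fth u v w⟩

theorem rmNormSq_eq_sum {ι : Type} [Fintype ι] (h : IsMetricAt G z) (b : Module.Basis ι ℝ E)
    (hb : ∀ i j, i ≠ j → G z (b i) (b j) = 0) :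
    rmNormSq G z = ∑ i, (G z (b i) (b i))⁻¹ * ∑ j, (G z (b j) (b j))⁻¹ *
      ∑ k, (G z (b k) (b k))⁻¹ * ∑ l, (G z (b l) (b l))⁻¹ *
        G z (riemann G z (b i) (b j) (b k)) (b l) ^ 2 :=
  mtrace_mtrace_mtrace_mtrace_eq_sum h.isInner b hb (isQuadrilin_riemann h)

/-! ### Locality -/

section congr

variable {G' : E → E →L[ℝ] E →L[ℝ] ℝ}

theorem christoffel_congr (h : G =ᶠ[𝓝 z] G') (u v : E) :
    christoffel G z u v = christoffel G' z u v := by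
  simp only [christoffel, h.fderiv_eq, h.self_of_nhds]

theorem riemann_congr (h : G =ᶠ[𝓝 z] G') (u v w : E) :
    riemann G z u v w = riemann G' z u v w := by
  have h' : ∀ u v, (fun y => christoffel G y u v) =ᶠ[𝓝 z] fun y => christoffel G' y u v := by
    intro u v
    filter_upwards [h.eventuallyEq_nhds] with y hy using christoffel_congr hy u v
  simp only [riemann, (h' _ _).fderiv_eq, christoffel_congr h]

theorem rmNormSq_congr (h : G =ᶠ[𝓝 z] G') : rmNormSq G z = rmNormSq G' z := by
  simp only [rmNormSq, riemann_congr h, mtrace_congr_metric h.self_of_nhds, h.self_of_nhds]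

theorem ricci_congr (h : G =ᶠ[𝓝 z] G') (u v : E) : ricci G z u v = ricci G' z u v := by
  simp only [ricci, riemann_congr h, mtrace_congr_metric h.self_of_nhds, h.self_of_nhds]

theorem scalar_congr (h : G =ᶠ[𝓝 z] G') : scalar G z = scalar G' z := by
  rw [scalar, scalar, mtrace_congr_metric h.self_of_nhds]
  congr 1
  funext u v
  exact ricci_congr h u v

theorem nablaRic_congr (h : G =ᶠ[𝓝 z] G') (a u v : E) :
    nablaRic G z a u v = nablaRic G' z a u v := by
  have h' : (fun y => ricci G y u v) =ᶠ[𝓝 z] fun y => ricci G' y u v := by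
    filter_upwards [h.eventuallyEq_nhds] with y hy using ricci_congr hy u v
  simp only [nablaRic, h'.fderiv_eq, christoffel_congr h, ricci_congr h]

theorem laplaceRic_congr (h : G =ᶠ[𝓝 z] G') (u v : E) :
    laplaceRic G z u v = laplaceRic G' z u v := by
  have h' : ∀ b u v, (fun y => nablaRic G y b u v) =ᶠ[𝓝 z] fun y => nablaRic G' y b u v := by
    intro b u v
    filter_upwards [h.eventuallyEq_nhds] with y hy using nablaRic_congr hy b u v
  simp only [laplaceRic, nablaNablaRic, (h' _ _ _).fderiv_eq, christoffel_congr h,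
    nablaRic_congr h, mtrace_congr_metric h.self_of_nhds]

theorem rmStarRic_congr (h : G =ᶠ[𝓝 z] G') (c : Fin 5 → ℝ) (u v : E) :
    rmStarRic c G z u v = rmStarRic c G' z u v := by
  simp only [rmStarRic, ricSq, rmRic, ricNormSq, scalar_congr h, ricci_congr h, riemann_congr h,
    mtrace_congr_metric h.self_of_nhds, h.self_of_nhds]

end congr

end LocalMetric

namespace LocalMetric

/-! ### Rescaled metrics -/

section scale

variable {E : Type} [NormedAddCommGroup E] [NormedSpace ℝ E] [FiniteDimensional ℝ E]
  {G : E → E →L[ℝ] E →L[ℝ] ℝ} {z : E} {c : ℝ}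

theorem IsMetricAt.const_smul (h : IsMetricAt G z) (hc : 0 < c) :
    IsMetricAt (fun y => c • G y) z := by
  filter_upwards [h] with y hy
  exact ⟨hy.1.const_smul c, hy.2.smul hc⟩

theorem christoffel_const_smul (h : IsMetricAt G z) (hc : 0 < c) (u v : E) :
    christoffel (fun y => c • G y) z u v = christoffel G z u v := by
  refine christoffel_eq (h.isInner.smul hc) fun w => ?_
  rw [fderiv_fun_const_smul h.differentiableAt]
  simp only [smul_apply, smul_eq_mul, koszul h.isInner]
  ring

theorem riemann_const_smul (h : IsMetricAt G z) (hc : 0 < c) (u v w : E) :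
    riemann (fun y => c • G y) z u v w = riemann G z u v w := by
  have h' : ∀ u v, (fun y => christoffel (fun y => c • G y) y u v) =ᶠ[𝓝 z]
      fun y => christoffel G y u v := by
    intro u v
    filter_upwards [h.eventually] with y hy using christoffel_const_smul hy hc u v
  simp only [riemann, (h' _ _).fderiv_eq, christoffel_const_smul h hc]

theorem mtrace_const_smul (h : IsInner (G z)) (hc : 0 < c) (f : E → E → ℝ) (hf : IsBilin f) :
    mtrace (fun y => c • G y) z f = c⁻¹ * mtrace G z f := by
  obtain ⟨b, hb⟩ := h.exists_orthogonal_basis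
  rw [mtrace_eq_sum h b hb hf, mtrace_eq_sum (G := fun y => c • G y) (h.smul hc) b
    (fun i j hij => by simp [hb i j hij]) hf, Finset.mul_sum]
  refine Finset.sum_congr rfl fun i _ => ?_
  simp only [smul_apply, smul_eq_mul, mul_inv]
  ring

theorem ricci_const_smul (h : IsMetricAt G z) (hc : 0 < c) (u v : E) :
    ricci (fun y => c • G y) z u v = ricci G z u v := by
  have hT := isQuadrilin_riemann h
  have hB : IsBilin fun a a' => G z (riemann G z a u v) a' :=
    ⟨fun t => hT.fst u v t, fun a => hT.fth a u v⟩
  rw [ricci, ricci]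
  simp only [riemann_const_smul h hc, smul_apply, smul_eq_mul]
  rw [mtrace_const_mul, mtrace_const_smul h.isInner hc _ hB]
  field_simp

theorem rmNormSq_const_smul (h : IsMetricAt G z) (hc : 0 < c) :
    rmNormSq (fun y => c • G y) z = (c⁻¹) ^ 2 * rmNormSq G z := by
  obtain ⟨b, hb⟩ := h.isInner.exists_orthogonal_basis
  rw [rmNormSq_eq_sum h b hb, rmNormSq_eq_sum (h.const_smul hc) b
    (fun i j hij => by simp [hb i j hij])]
  simp only [Finset.mul_sum]
  refine Finset.sum_congr rfl fun i _ => Finset.sum_congr rfl fun j _ =>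
    Finset.sum_congr rfl fun k _ => Finset.sum_congr rfl fun l _ => ?_
  simp only [riemann_const_smul h hc, smul_apply, smul_eq_mul, mul_inv]
  field_simp

end scale

/-! ### Products of metrics -/

section prod

variable {E F : Type} [NormedAddCommGroup E] [NormedSpace ℝ E] [FiniteDimensional ℝ E]
  [NormedAddCommGroup F] [NormedSpace ℝ F] [FiniteDimensional ℝ F]

/-- The direct sum of two bilinear forms. -/
def sumForm (A : E →L[ℝ] E →L[ℝ] ℝ) (B : F →L[ℝ] F →L[ℝ] ℝ) :
    E × F →L[ℝ] E × F →L[ℝ] ℝ :=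
  pullbackForm A (ContinuousLinearMap.fst ℝ E F) + pullbackForm B (ContinuousLinearMap.snd ℝ E F)

@[simp] theorem sumForm_apply (A : E →L[ℝ] E →L[ℝ] ℝ) (B : F →L[ℝ] F →L[ℝ] ℝ) (v w : E × F) :
    sumForm A B v w = A v.1 w.1 + B v.2 w.2 := rfl

/-- The product of two metrics. -/
def prodMetric (G : E → E →L[ℝ] E →L[ℝ] ℝ) (K : F → F →L[ℝ] F →L[ℝ] ℝ) (p : E × F) :
    E × F →L[ℝ] E × F →L[ℝ] ℝ :=
  sumForm (G p.1) (K p.2)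

/-- `sumForm` as a linear map. -/
def sumFormL : (E →L[ℝ] E →L[ℝ] ℝ) × (F →L[ℝ] F →L[ℝ] ℝ) →L[ℝ] E × F →L[ℝ] E × F →L[ℝ] ℝ :=
  LinearMap.toContinuousLinearMap
    { toFun := fun p => sumForm p.1 p.2
      map_add' := fun p q => by ext <;> simp
      map_smul' := fun c p => by ext <;> simp }

theorem IsInner.sumForm {A : E →L[ℝ] E →L[ℝ] ℝ} {B : F →L[ℝ] F →L[ℝ] ℝ} (hA : IsInner A)
    (hB : IsInner B) : IsInner (sumForm A B) := by
  refine ⟨fun v w => by simp [hA.symm v.1, hB.symm v.2], fun v hv => ?_⟩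
  rw [sumForm_apply]
  by_cases h1 : v.1 = 0
  · have h2 : v.2 ≠ 0 := fun h2 => hv (Prod.ext h1 h2)
    exact add_pos_of_nonneg_of_pos (hA.self_nonneg _) (hB.pos _ h2)
  · exact add_pos_of_pos_of_nonneg (hA.pos _ h1) (hB.self_nonneg _)

variable {G : E → E →L[ℝ] E →L[ℝ] ℝ} {K : F → F →L[ℝ] F →L[ℝ] ℝ} {p : E × F}

theorem IsMetricAt.prod (hG : IsMetricAt G p.1) (hK : IsMetricAt K p.2) :
    IsMetricAt (prodMetric G K) p := by
  filter_upwards [continuousAt_fst.eventually hG, continuousAt_snd.eventually hK] with y h1 h2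
  have h3 : ContDiffAt ℝ ∞ (fun q : E × F => (G q.1, K q.2)) y :=
    (h1.1.comp y contDiffAt_fst).prodMk (h2.1.comp y contDiffAt_snd)
  have h4 : ContDiffAt ℝ ∞ (sumFormL (E := E) (F := F) ∘ fun q : E × F => (G q.1, K q.2)) y :=
    ContDiffAt.continuousLinearMap_comp (sumFormL (E := E) (F := F)) h3
  exact ⟨h4, h1.2.sumForm h2.2⟩

theorem fderiv_prodMetric (hG : DifferentiableAt ℝ G p.1) (hK : DifferentiableAt ℝ K p.2)
    (u : E × F) :
    fderiv ℝ (prodMetric G K) p u = sumForm (fderiv ℝ G p.1 u.1) (fderiv ℝ K p.2 u.2) := by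
  have h1 : HasFDerivAt (fun q : E × F => (G q.1, K q.2)) _ p :=
    (hG.hasFDerivAt.comp p hasFDerivAt_fst).prodMk (hK.hasFDerivAt.comp p hasFDerivAt_snd)
  have h2 := (sumFormL (E := E) (F := F)).hasFDerivAt.comp p h1
  have h3 : HasFDerivAt (prodMetric G K) _ p := h2
  rw [h3.fderiv]
  rfl

theorem christoffel_prod (hG : IsMetricAt G p.1) (hK : IsMetricAt K p.2) (u v : E × F) :
    christoffel (prodMetric G K) p u v =
      (christoffel G p.1 u.1 v.1, christoffel K p.2 u.2 v.2) := by
  refine christoffel_eq (hG.prod hK).isInner fun w => ?_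
  simp only [fderiv_prodMetric hG.differentiableAt hK.differentiableAt]
  simp only [prodMetric, sumForm_apply, koszul hG.isInner, koszul hK.isInner]
  ring

theorem riemann_prod (hG : IsMetricAt G p.1) (hK : IsMetricAt K p.2) (u v w : E × F) :
    riemann (prodMetric G K) p u v w =
      (riemann G p.1 u.1 v.1 w.1, riemann K p.2 u.2 v.2 w.2) := by
  have h' : ∀ u v : E × F, (fun y => christoffel (prodMetric G K) y u v) =ᶠ[𝓝 p]
      fun y => (christoffel G y.1 u.1 v.1, christoffel K y.2 u.2 v.2) := by
    intro u v
    filter_upwards [continuousAt_fst.eventually hG.eventually,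
      continuousAt_snd.eventually hK.eventually] with y h1 h2 using christoffel_prod h1 h2 u v
  have h'' : ∀ u v w : E × F, fderiv ℝ (fun y => christoffel (prodMetric G K) y u v) p w =
      (fderiv ℝ (fun y => christoffel G y u.1 v.1) p.1 w.1,
        fderiv ℝ (fun y => christoffel K y u.2 v.2) p.2 w.2) := by
    intro u v w
    rw [(h' u v).fderiv_eq]
    have h1 : HasFDerivAt (fun q : E × F => (christoffel G q.1 u.1 v.1,
        christoffel K q.2 u.2 v.2)) _ p :=
      ((hG.differentiableAt_christoffel u.1 v.1).hasFDerivAt.comp p hasFDerivAt_fst).prodMk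
        ((hK.differentiableAt_christoffel u.2 v.2).hasFDerivAt.comp p hasFDerivAt_snd)
    rw [h1.fderiv]
    rfl
  simp only [riemann, h'', christoffel_prod hG hK, Prod.mk_add_mk, Prod.mk_sub_mk]

theorem mtrace_prod (hG : IsInner (G p.1)) (hK : IsInner (K p.2)) {f : E × F → E × F → ℝ}
    (hf : IsBilin f) :
    mtrace (prodMetric G K) p f = mtrace G p.1 (fun u v => f (u, 0) (v, 0)) +
      mtrace K p.2 (fun u v => f (0, u) (0, v)) := by
  obtain ⟨b, hb⟩ := hG.exists_orthogonal_basis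
  obtain ⟨c, hc⟩ := hK.exists_orthogonal_basis
  have h1 : IsBilin fun u v => f ((u, 0) : E × F) (v, 0) := by
    refine ⟨fun w => ⟨fun u v => ?_, fun d u => ?_⟩, fun w => ⟨fun u v => ?_, fun d u => ?_⟩⟩
    · rw [← (hf.left _).map_add]; simp
    · rw [← (hf.left _).map_smul]; simp
    · rw [← (hf.right _).map_add]; simp
    · rw [← (hf.right _).map_smul]; simp
  have h2 : IsBilin fun u v => f ((0, u) : E × F) (0, v) := by
    refine ⟨fun w => ⟨fun u v => ?_, fun d u => ?_⟩, fun w => ⟨fun u v => ?_, fun d u => ?_⟩⟩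
    · rw [← (hf.left _).map_add]; simp
    · rw [← (hf.left _).map_smul]; simp
    · rw [← (hf.right _).map_add]; simp
    · rw [← (hf.right _).map_smul]; simp
  rw [mtrace_eq_sum hG b hb h1, mtrace_eq_sum hK c hc h2,
    mtrace_eq_sum (G := prodMetric G K) (hG.sumForm hK) (b.prod c) ?_ hf, Fintype.sum_sum_type]
  · simp [prodMetric, Module.Basis.prod_apply]
  · rintro (i | i) (j | j) hij
    · simpa [prodMetric, Module.Basis.prod_apply] using hb i j (by simpa using hij)
    · simp [prodMetric, Module.Basis.prod_apply]
    · simp [prodMetric, Module.Basis.prod_apply]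
    · simpa [prodMetric, Module.Basis.prod_apply] using hc i j (by simpa using hij)

theorem riemann_zero_left {z : E} (hG : IsMetricAt G z) (v w : E) : riemann G z 0 v w = 0 := by
  simpa using riemann_smul_left hG 0 0 v w

theorem riemann_zero_mid {z : E} (hG : IsMetricAt G z) (u w : E) : riemann G z u 0 w = 0 := by
  simpa using riemann_smul_mid hG 0 u 0 w

theorem riemann_zero_right {z : E} (hG : IsMetricAt G z) (u v : E) : riemann G z u v 0 = 0 := by
  simpa using riemann_smul_right hG 0 u v 0

theorem ricci_prod (hG : IsMetricAt G p.1) (hK : IsMetricAt K p.2) (u v : E × F) :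
    ricci (prodMetric G K) p u v = ricci G p.1 u.1 v.1 + ricci K p.2 u.2 v.2 := by
  have hT := isQuadrilin_riemann (hG.prod hK)
  rw [ricci, mtrace_prod hG.isInner hK.isInner
    ⟨fun t => hT.fst u v t, fun a => hT.fth a u v⟩]
  simp [riemann_prod hG hK, prodMetric, ricci]

theorem scalar_prod (hG : IsMetricAt G p.1) (hK : IsMetricAt K p.2) :
    scalar (prodMetric G K) p = scalar G p.1 + scalar K p.2 := by
  rw [scalar, mtrace_prod hG.isInner hK.isInner (isBilin_ricci (hG.prod hK))]
  simp [ricci_prod hG hK, (isBilin_ricci hG).left 0 |>.map_zero,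
    (isBilin_ricci hK).left 0 |>.map_zero, scalar]

theorem rmNormSq_prod (hG : IsMetricAt G p.1) (hK : IsMetricAt K p.2) :
    rmNormSq (prodMetric G K) p = rmNormSq G p.1 + rmNormSq K p.2 := by
  obtain ⟨b, hb⟩ := hG.isInner.exists_orthogonal_basis
  obtain ⟨c, hc⟩ := hK.isInner.exists_orthogonal_basis
  rw [rmNormSq_eq_sum hG b hb, rmNormSq_eq_sum hK c hc, rmNormSq_eq_sum (hG.prod hK) (b.prod c)]
  · simp [Fintype.sum_sum_type, riemann_prod hG hK, prodMetric, Module.Basis.prod_apply,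
      riemann_zero_left hG, riemann_zero_mid hG, riemann_zero_right hG, riemann_zero_left hK,
      riemann_zero_mid hK, riemann_zero_right hK]
  · rintro (i | i) (j | j) hij
    · simpa [prodMetric, Module.Basis.prod_apply] using hb i j (by simpa using hij)
    · simp [prodMetric, Module.Basis.prod_apply]
    · simp [prodMetric, Module.Basis.prod_apply]
    · simpa [prodMetric, Module.Basis.prod_apply] using hc i j (by simpa using hij)

theorem ricSq_prod (hG : IsMetricAt G p.1) (hK : IsMetricAt K p.2) (u v : E × F) :
    ricSq (prodMetric G K) p u v = ricSq G p.1 u.1 v.1 + ricSq K p.2 u.2 v.2 := by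
  have hR := isBilin_ricci (hG.prod hK)
  rw [ricSq, mtrace_prod hG.isInner hK.isInner (IsBilin.mul (hR.right u) (hR.left v))]
  simp [ricci_prod hG hK, ((isBilin_ricci hG).left _).map_zero,
    ((isBilin_ricci hK).left _).map_zero, ((isBilin_ricci hG).right _).map_zero,
    ((isBilin_ricci hK).right _).map_zero, ricSq]

theorem isBilin_mtrace_mul {G : E → E →L[ℝ] E →L[ℝ] ℝ} {z : E} {f g : E → E → ℝ}
    (hf : IsBilin f) (hg : IsBilin g) :
    IsBilin fun a a' => mtrace G z fun b b' => f a b * g a' b' := by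
  refine ⟨fun a' => ⟨fun x y => ?_, fun c x => ?_⟩, fun a => ⟨fun x y => ?_, fun c x => ?_⟩⟩
  · simp only [(hf.left _).map_add, add_mul, mtrace_add]
  · simp only [(hf.left _).map_smul, smul_eq_mul, mul_assoc, mtrace_const_mul]
  · simp only [(hg.left _).map_add, mul_add, mtrace_add]
  · simp only [(hg.left _).map_smul, smul_eq_mul, mul_left_comm, mtrace_const_mul]

theorem rmRic_prod (hG : IsMetricAt G p.1) (hK : IsMetricAt K p.2) (u v : E × F) :
    rmRic (prodMetric G K) p u v = rmRic G p.1 u.1 v.1 + rmRic K p.2 u.2 v.2 := by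
  have hR := isBilin_ricci (hG.prod hK)
  have hT := isQuadrilin_riemann (hG.prod hK)
  have hB : IsBilin fun a b => prodMetric G K p (riemann (prodMetric G K) p a u v) b :=
    ⟨fun t => hT.fst u v t, fun a => hT.fth a u v⟩
  rw [rmRic, mtrace_prod hG.isInner hK.isInner (isBilin_mtrace_mul hB hR)]
  simp only [mtrace_prod hG.isInner hK.isInner (IsBilin.mul (hB.right _) (hR.right _))]
  simp [ricci_prod hG hK, riemann_prod hG hK, prodMetric, ((isBilin_ricci hG).left _).map_zero,
    ((isBilin_ricci hK).left _).map_zero, ((isBilin_ricci hG).right _).map_zero,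
    ((isBilin_ricci hK).right _).map_zero, riemann_zero_left hG, riemann_zero_left hK, rmRic,
    mtrace_zero]

end prod

/-! ### Constant curvature -/

section constant

variable {E F : Type} [NormedAddCommGroup E] [NormedSpace ℝ E] [FiniteDimensional ℝ E]
  [NormedAddCommGroup F] [NormedSpace ℝ F] [FiniteDimensional ℝ F]
  {G : E → E →L[ℝ] E →L[ℝ] ℝ} {z : E} {κ : ℝ}

/-- The curvature tensor at `z` is that of a metric of constant curvature `κ`. -/
def HasCurvatureAt (G : E → E →L[ℝ] E →L[ℝ] ℝ) (z : E) (κ : ℝ) : Prop :=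
  ∀ u v w, riemann G z u v w = κ • (G z v w • u - G z u w • v)

theorem HasCurvatureAt.const_smul (h : HasCurvatureAt G z κ) (hG : IsMetricAt G z) {c : ℝ}
    (hc : 0 < c) : HasCurvatureAt (fun y => c • G y) z (κ / c) := by
  intro u v w
  rw [riemann_const_smul hG hc, h u v w]
  simp only [smul_apply, smul_eq_mul, smul_sub, smul_smul]
  congr 2 <;> field_simp

theorem HasCurvatureAt.ricci_eq (h : HasCurvatureAt G z κ) (hG : IsMetricAt G z) (u v : E) :
    ricci G z u v = κ * (Module.finrank ℝ E - 1) * G z u v := by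
  have : ricci G z u v = κ * (G z u v * mtrace G z (fun a a' => G z a a')
      - mtrace G z (fun a a' => G z a v * G z a' u)) := by
    rw [← mtrace_const_mul, ← mtrace_sub, ← mtrace_const_mul]
    refine congrArg (mtrace G z) ?_
    funext a a'
    rw [h a u v]
    simp only [map_smul, map_sub, smul_apply, sub_apply, smul_eq_mul]
    rw [hG.isInner.symm u a']
  rw [this, mtrace_self hG.isInner,
    mtrace_contract (φ := fun a => G z a v) hG.isInner ⟨by simp, by simp⟩]
  ring

theorem HasCurvatureAt.scalar_eq (h : HasCurvatureAt G z κ) (hG : IsMetricAt G z) :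
    scalar G z = κ * (Module.finrank ℝ E - 1) * Module.finrank ℝ E := by
  have : ricci G z = fun u v => κ * (Module.finrank ℝ E - 1) * G z u v := by
    funext u v
    exact h.ricci_eq hG u v
  rw [scalar, this, mtrace_const_mul, mtrace_self hG.isInner]

theorem HasCurvatureAt.ricSq_eq (h : HasCurvatureAt G z κ) (hG : IsMetricAt G z) (u v : E) :
    ricSq G z u v = (κ * (Module.finrank ℝ E - 1)) ^ 2 * G z u v := by
  have : ricSq G z u v = (κ * (Module.finrank ℝ E - 1)) ^ 2 *
      mtrace G z (fun a a' => G z u a * G z a' v) := by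
    rw [← mtrace_const_mul]
    refine congrArg (mtrace G z) ?_
    funext a a'
    rw [h.ricci_eq hG, h.ricci_eq hG]
    ring
  rw [this, mtrace_contract (φ := fun a => G z u a) hG.isInner ⟨by simp, by simp⟩]

theorem HasCurvatureAt.rmRic_eq (h : HasCurvatureAt G z κ) (hG : IsMetricAt G z) (u v : E) :
    rmRic G z u v = (κ * (Module.finrank ℝ E - 1)) ^ 2 * G z u v := by
  have hi := hG.isInner
  have h1 : ∀ a a', (mtrace G z fun b b' => G z (riemann G z a u v) b * ricci G z a' b') =
      κ ^ 2 * (Module.finrank ℝ E - 1) * (G z u v * G z a a' - G z a v * G z a' u) := by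
    intro a a'
    have : (fun b b' => G z (riemann G z a u v) b * ricci G z a' b') = fun b b' =>
        κ * (Module.finrank ℝ E - 1) * (G z (riemann G z a u v) b * G z b' a') := by
      funext b b'
      rw [h.ricci_eq hG, hi.symm a' b']
      ring
    rw [this, mtrace_const_mul,
      mtrace_contract (φ := fun b => G z (riemann G z a u v) b) hi ⟨by simp, by simp⟩, h a u v]
    simp only [map_smul, map_sub, smul_apply, sub_apply, smul_eq_mul]
    rw [hi.symm u a']
    ring
  simp only [rmRic, h1]
  rw [mtrace_const_mul, mtrace_sub, mtrace_const_mul, mtrace_self hi,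
    mtrace_contract (φ := fun a => G z a v) hi ⟨by simp, by simp⟩]
  ring

theorem HasCurvatureAt.rmNormSq_eq (h : HasCurvatureAt G z κ) (hG : IsMetricAt G z) :
    rmNormSq G z = κ ^ 2 * (2 * (Module.finrank ℝ E * (Module.finrank ℝ E - 1))) := by
  have hi := hG.isInner
  have lin : ∀ x, IsLinearMap ℝ fun a => G z x a := fun x => ⟨by simp, by simp⟩
  have lin' : ∀ x, IsLinearMap ℝ fun a => G z a x := fun x => ⟨by simp, by simp⟩
  have h4 : ∀ u u' v v' w w', (mtrace G z fun t t' => G z (riemann G z u v w) t *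
      G z (riemann G z u' v' w') t') = κ ^ 2 * (G z v w * G z v' w' * G z u u'
        - G z v w * G z u' w' * G z u v' - G z u w * G z v' w' * G z v u'
        + G z u w * G z u' w' * G z v v') := by
    intro u u' v v' w w'
    have e : (fun t t' => G z (riemann G z u v w) t * G z (riemann G z u' v' w') t') =
        fun t t' => G z (riemann G z u v w) t * G z t' (riemann G z u' v' w') := by
      funext t t'
      rw [hi.symm t']
    rw [e, mtrace_contract hi (lin _), h, h]
    simp only [map_smul, map_sub, smul_apply, sub_apply, smul_eq_mul]
    ring
  have h3 : ∀ u u' v v', (mtrace G z fun w w' => κ ^ 2 * (G z v w * G z v' w' * G z u u'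
        - G z v w * G z u' w' * G z u v' - G z u w * G z v' w' * G z v u'
        + G z u w * G z u' w' * G z v v')) = κ ^ 2 * (2 * (G z v v' * G z u u')
        - 2 * (G z u v' * G z v u')) := by
    intro u u' v v'
    have c : ∀ x y r, (mtrace G z fun w w' => G z x w * G z y w' * r) = r * G z x y := by
      intro x y r
      have e : (fun w w' => G z x w * G z y w' * r) = fun w w' => r * (G z x w * G z w' y) := by
        funext t t'
        rw [hi.symm t']
        ring
      rw [e, mtrace_const_mul, mtrace_contract hi (lin _)]
    rw [mtrace_const_mul, mtrace_add, mtrace_sub, mtrace_sub, c, c, c, c, hi.symm v u']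
    ring
  have h2 : ∀ u u', (mtrace G z fun v v' => κ ^ 2 * (2 * (G z v v' * G z u u')
        - 2 * (G z u v' * G z v u'))) = κ ^ 2 * (2 * (Module.finrank ℝ E - 1)) * G z u u' := by
    intro u u'
    have e : (fun v v' => G z u v' * G z v u') = fun v v' => G z v u' * G z v' u := by
      funext t t'
      rw [hi.symm u t']
      ring
    have e' : (fun v v' => G z v v' * G z u u') = fun v v' => G z u u' * G z v v' := by
      funext t t'
      ring
    rw [mtrace_const_mul, mtrace_sub, mtrace_const_mul, mtrace_const_mul, e, e',
      mtrace_contract (φ := fun v => G z v u') hi (lin' _), mtrace_const_mul, mtrace_self hi]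
    ring
  simp only [rmNormSq, h4, h3, h2, mtrace_const_mul, mtrace_self hi]
  ring

/-- On a product of two manifolds of constant curvature the Ricci tensor is parallel: it is a constant
multiple of the metric on each factor. -/
theorem nablaRic_prod_eq_zero {K : F → F →L[ℝ] F →L[ℝ] ℝ} {p : E × F} {κ' : ℝ}
    (hG : IsMetricAt G p.1) (hK : IsMetricAt K p.2)
    (cG : ∀ᶠ y in 𝓝 p.1, HasCurvatureAt G y κ) (cK : ∀ᶠ y in 𝓝 p.2, HasCurvatureAt K y κ')
    (a u v : E × F) : nablaRic (prodMetric G K) p a u v = 0 := by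
  set m : ℝ := κ * (Module.finrank ℝ E - 1)
  set m' : ℝ := κ' * (Module.finrank ℝ F - 1)
  have h : ∀ u v : E × F, (fun y => ricci (prodMetric G K) y u v) =ᶠ[𝓝 p]
      fun y => m * G y.1 u.1 v.1 + m' * K y.2 u.2 v.2 := by
    intro u v
    filter_upwards [continuousAt_fst.eventually hG.eventually,
      continuousAt_snd.eventually hK.eventually, continuousAt_fst.eventually cG,
      continuousAt_snd.eventually cK] with y h1 h2 h3 h4
    rw [ricci_prod h1 h2, h3.ricci_eq h1, h4.ricci_eq h2]
  have hd : HasFDerivAt (fun y : E × F => m * G y.1 u.1 v.1 + m' * K y.2 u.2 v.2)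
      (m • (((fderiv ℝ G p.1).flip u.1).flip v.1).comp (ContinuousLinearMap.fst ℝ E F) +
        m' • (((fderiv ℝ K p.2).flip u.2).flip v.2).comp (ContinuousLinearMap.snd ℝ E F)) p := by
    have e1 : HasFDerivAt (fun y => G y u.1 v.1) (((fderiv ℝ G p.1).flip u.1).flip v.1) p.1 := by
      have := (hG.differentiableAt.hasFDerivAt.clm_apply (hasFDerivAt_const u.1 _)).clm_apply
        (hasFDerivAt_const v.1 _)
      convert! this using 1
      ext; simp
    have e2 : HasFDerivAt (fun y => K y u.2 v.2) (((fderiv ℝ K p.2).flip u.2).flip v.2) p.2 := by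
      have := (hK.differentiableAt.hasFDerivAt.clm_apply (hasFDerivAt_const u.2 _)).clm_apply
        (hasFDerivAt_const v.2 _)
      convert! this using 1
      ext; simp
    exact ((e1.comp p hasFDerivAt_fst).const_mul m).add ((e2.comp p hasFDerivAt_snd).const_mul m')
  have hv : ∀ u v : E × F, ricci (prodMetric G K) p u v =
      m * G p.1 u.1 v.1 + m' * K p.2 u.2 v.2 := fun u v => (h u v).self_of_nhds
  rw [nablaRic, (h u v).fderiv_eq, hd.fderiv, hv, hv, christoffel_prod hG hK,
    christoffel_prod hG hK]
  simp only [add_apply, smul_apply, smul_eq_mul, coe_comp, Function.comp_apply, coe_fst',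
    coe_snd', flip_apply, fderiv_metric hG, fderiv_metric hK]
  ring

theorem laplaceRic_prod_eq_zero {K : F → F →L[ℝ] F →L[ℝ] ℝ} {p : E × F} {κ' : ℝ}
    (hG : IsMetricAt G p.1) (hK : IsMetricAt K p.2)
    (cG : ∀ᶠ y in 𝓝 p.1, HasCurvatureAt G y κ) (cK : ∀ᶠ y in 𝓝 p.2, HasCurvatureAt K y κ')
    (u v : E × F) : laplaceRic (prodMetric G K) p u v = 0 := by
  have h : ∀ b u v : E × F, (fun y => nablaRic (prodMetric G K) y b u v) =ᶠ[𝓝 p]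
      fun _ => 0 := by
    intro b u v
    filter_upwards [continuousAt_fst.eventually hG.eventually,
      continuousAt_snd.eventually hK.eventually,
      continuousAt_fst.eventually (eventually_eventually_nhds.2 cG),
      continuousAt_snd.eventually (eventually_eventually_nhds.2 cK)] with y h1 h2 h3 h4
    exact nablaRic_prod_eq_zero h1 h2 h3 h4 b u v
  simp [laplaceRic, nablaNablaRic, (h _ _ _).fderiv_eq, (h _ _ _).self_of_nhds, mtrace_zero]

end constant

end LocalMetric

/-! ### Tensor fields in coordinates -/

section coordinates

variable {E H M : Type} [NormedAddCommGroup E] [NormedSpace ℝ E]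
  [TopologicalSpace H] {I : ModelWithCorners ℝ E H} [I.Boundaryless] [TopologicalSpace M]
  [ChartedSpace H M] [IsManifold I ∞ M]

/-- The trivialisation of the tangent bundle at `x` is the differential of the preferred chart at `x`. -/
theorem symm_trivializationAt_tangent {x : M} {z : E} (hz : z ∈ (extChartAt I x).target) (v : E) :
    (trivializationAt E (TangentSpace I) x).symm ((extChartAt I x).symm z) v =
      mfderiv 𝓘(ℝ, E) I (extChartAt I x).symm z v := by
  have : IsManifold I 1 M := IsManifold.of_le (n := ∞) (by simp)
  have hx : (extChartAt I x).symm z ∈ (chartAt H x).source := by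
    have := (extChartAt I x).map_target hz
    rwa [extChartAt_source] at this
  have h := TangentBundle.symmL_trivializationAt (I := I) hx
  rw [I.range_eq_univ, mfderivWithin_univ, (extChartAt I x).right_inv hz] at h
  have hb : (extChartAt I x).symm z ∈ (trivializationAt E (TangentSpace I) x).baseSet := by
    simpa using hx
  exact (Trivialization.symmL_apply (R := ℝ) _ hb v).symm.trans (DFunLike.congr_fun h v)

theorem isInvertible_mfderiv_extChartAt_symm {x : M} {z : E} (hz : z ∈ (extChartAt I x).target) :
    (mfderiv 𝓘(ℝ, E) I (extChartAt I x).symm z).IsInvertible := by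
  have : IsManifold I 1 M := IsManifold.of_le (n := ∞) (by simp)
  have h := isInvertible_mfderivWithin_extChartAt_symm (I := I) hz
  rwa [I.range_eq_univ, mfderivWithin_univ] at h

theorem contMDiffAt_extChartAt_symm {x : M} {z : E} (hz : z ∈ (extChartAt I x).target) :
    ContMDiffAt 𝓘(ℝ, E) I ∞ (extChartAt I x).symm z :=
  (contMDiffOn_extChartAt_symm x).contMDiffAt (extChartAt_target_mem_nhds' hz)

/-- A function on the manifold is smooth at a point of a chart domain iff its coordinate expression
is. -/
theorem contMDiffAt_iff_contDiffAt_comp_symm {F : Type} [NormedAddCommGroup F] [NormedSpace ℝ F]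
    {f : M → F} {x : M} {z : E} (hz : z ∈ (extChartAt I x).target) :
    ContMDiffAt I 𝓘(ℝ, F) ∞ f ((extChartAt I x).symm z) ↔
      ContDiffAt ℝ ∞ (f ∘ (extChartAt I x).symm) z := by
  rw [← contMDiffAt_iff_contDiffAt]
  refine ⟨fun h => ContMDiffAt.comp z h (contMDiffAt_extChartAt_symm hz), fun h => ?_⟩
  have hs : (extChartAt I x).symm z ∈ (extChartAt I x).source := (extChartAt I x).map_target hz
  have hs' : (extChartAt I x).symm z ∈ (chartAt H x).source := by
    rwa [extChartAt_source] at hs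
  have hc : ContMDiffAt I 𝓘(ℝ, E) ∞ (extChartAt I x) ((extChartAt I x).symm z) :=
    contMDiffAt_extChartAt' hs'
  rw [← (extChartAt I x).right_inv hz] at h
  refine (ContMDiffAt.comp _ h hc).congr_of_eventuallyEq ?_
  filter_upwards [(isOpen_extChartAt_source x).mem_nhds hs] with y hy
  rw [Function.comp_apply, Function.comp_apply, (extChartAt I x).left_inv hy]

theorem contDiffAt_congr_iff {E F : Type} [NormedAddCommGroup E] [NormedSpace ℝ E]
    [NormedAddCommGroup F] [NormedSpace ℝ F] {f g : E → F} {z : E} (h : f =ᶠ[𝓝 z] g) :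
    ContDiffAt ℝ ∞ f z ↔ ContDiffAt ℝ ∞ g z :=
  ⟨fun h' => h'.congr_of_eventuallyEq h.symm, fun h' => h'.congr_of_eventuallyEq h⟩

/-- A field of bilinear forms is smooth iff its coordinate expression is. -/
theorem contMDiffAt_bilinear_iff {h : ∀ y : M, TangentSpace I y →L[ℝ] TangentSpace I y →L[ℝ] ℝ}
    {x : M} {z : E} (hz : z ∈ (extChartAt I x).target) :
    ContMDiffAt I (I.prod 𝓘(ℝ, E →L[ℝ] E →L[ℝ] ℝ)) ∞
      (fun y ↦ TotalSpace.mk' (E →L[ℝ] E →L[ℝ] ℝ)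
        (E := fun y : M ↦ TangentSpace I y →L[ℝ] TangentSpace I y →L[ℝ] ℝ) y (h y))
      ((extChartAt I x).symm z) ↔
    ContDiffAt ℝ ∞ (fun w : E => pullbackForm (V := E) (h ((extChartAt I x).symm w))
      (mfderiv 𝓘(ℝ, E) I (extChartAt I x).symm w)) z := by
  have hs' : (extChartAt I x).symm z ∈ (chartAt H x).source := by
    have := (extChartAt I x).map_target hz
    rwa [extChartAt_source] at this
  rw [Trivialization.contMDiffAt_section_iff
    (trivializationAt (E →L[ℝ] E →L[ℝ] ℝ)
      (fun y : M ↦ TangentSpace I y →L[ℝ] TangentSpace I y →L[ℝ] ℝ) x) (x₀ := (extChartAt I x).symm z)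
      (by simpa using hs'), contMDiffAt_iff_contDiffAt_comp_symm hz]
  have hid : ∀ (y : M) (r : ℝ),
      (trivializationAt ℝ (fun _ : M => ℝ) x).linearMapAt ℝ y r = r := by
    intro y r
    simp
  refine contDiffAt_congr_iff ?_
  filter_upwards [extChartAt_target_mem_nhds' hz] with w hw
  have hw' : (extChartAt I x).symm w ∈ (chartAt H x).source := by
    have := (extChartAt I x).map_target hw
    rwa [extChartAt_source] at this
  simp only [Function.comp_apply, hom_trivializationAt_apply]
  ext u v
  rw [inCoordinates_apply_eq₂ (by simpa using hw') (by simpa using hw') (Set.mem_univ _)]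
  rw [symm_trivializationAt_tangent hw, symm_trivializationAt_tangent hw]
  exact hid _ _

variable (I) in
/-- The coordinate expression of a field of endomorphisms in the preferred chart at `x`. -/
def endoCoord (J : ∀ y : M, TangentSpace I y →L[ℝ] TangentSpace I y) (x : M) (z : E) :
    E →L[ℝ] E :=
  (mfderiv 𝓘(ℝ, E) I (extChartAt I x).symm z).inverse.comp
    ((J ((extChartAt I x).symm z)).comp (mfderiv 𝓘(ℝ, E) I (extChartAt I x).symm z))

/-- A field of endomorphisms is smooth iff its coordinate expression is. -/
theorem contMDiffAt_endo_iff {J : ∀ y : M, TangentSpace I y →L[ℝ] TangentSpace I y}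
    {x : M} {z : E} (hz : z ∈ (extChartAt I x).target) :
    ContMDiffAt I (I.prod 𝓘(ℝ, E →L[ℝ] E)) ∞
      (fun y ↦ TotalSpace.mk' (E →L[ℝ] E)
        (E := fun y : M ↦ TangentSpace I y →L[ℝ] TangentSpace I y) y (J y))
      ((extChartAt I x).symm z) ↔
    ContDiffAt ℝ ∞ (endoCoord I J x) z := by
  have hs' : (extChartAt I x).symm z ∈ (chartAt H x).source := by
    have := (extChartAt I x).map_target hz
    rwa [extChartAt_source] at this
  rw [Trivialization.contMDiffAt_section_iff
    (trivializationAt (E →L[ℝ] E)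
      (fun y : M ↦ TangentSpace I y →L[ℝ] TangentSpace I y) x) (x₀ := (extChartAt I x).symm z)
      (by simpa using hs'), contMDiffAt_iff_contDiffAt_comp_symm hz]
  refine contDiffAt_congr_iff ?_
  filter_upwards [extChartAt_target_mem_nhds' hz] with w hw
  have hw' : (extChartAt I x).symm w ∈ (chartAt H x).source := by
    have := (extChartAt I x).map_target hw
    rwa [extChartAt_source] at this
  have hb : (extChartAt I x).symm w ∈ (trivializationAt E (TangentSpace I) x).baseSet := by
    simpa using hw'
  simp only [Function.comp_apply, hom_trivializationAt_apply]
  rw [inCoordinates_eq hb hb]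
  ext u
  have key : ∀ u, (Trivialization.continuousLinearEquivAt ℝ
      (trivializationAt E (TangentSpace I) x) _ hb).symm u =
      mfderiv 𝓘(ℝ, E) I (extChartAt I x).symm w u := by
    exact fun u => symm_trivializationAt_tangent (I := I) hw u
  simp only [comp_apply, ContinuousLinearEquiv.coe_coe, key]
  rw [← ContinuousLinearEquiv.eq_symm_apply, key]
  exact ((isInvertible_mfderiv_extChartAt_symm hw).inverse_apply_eq.1 rfl)

end coordinates

namespace RiemMfd

variable (X Y : RiemMfd)

theorem isInner_inner (x : X.M) : LocalMetric.IsInner (E := X.E) (X.g.inner x) :=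
  ⟨X.g.symm x, X.g.pos x⟩

theorem isInner_coordMetric {x : X.M} {z : X.E} (hz : z ∈ (extChartAt X.I x).target) :
    LocalMetric.IsInner (X.coordMetric x z) := by
  refine ⟨fun v w => X.g.symm _ _ _, fun v hv => X.g.pos _ _ fun h => hv ?_⟩
  obtain ⟨e, he⟩ := isInvertible_mfderiv_extChartAt_symm hz
  rw [← he] at h
  exact e.map_eq_zero_iff.1 h

theorem contDiffAt_coordMetric {x : X.M} {z : X.E} (hz : z ∈ (extChartAt X.I x).target) :
    ContDiffAt ℝ ∞ (X.coordMetric x) z :=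
  (contMDiffAt_bilinear_iff hz).1 (X.g.contMDiff _)

theorem isMetricAt_coordMetric {x : X.M} {z : X.E} (hz : z ∈ (extChartAt X.I x).target) :
    LocalMetric.IsMetricAt (X.coordMetric x) z := by
  filter_upwards [extChartAt_target_mem_nhds' hz] with w hw
  exact ⟨X.contDiffAt_coordMetric hw, X.isInner_coordMetric hw⟩

theorem isMetricAt_coordMetric_self (x : X.M) :
    LocalMetric.IsMetricAt (X.coordMetric x) (extChartAt X.I x x) :=
  X.isMetricAt_coordMetric (mem_extChartAt_target x)

theorem coordMetric_prod (p : X.M × Y.M) {z : X.E × Y.E}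
    (h1 : z.1 ∈ (extChartAt X.I p.1).target) (h2 : z.2 ∈ (extChartAt Y.I p.2).target) :
    (X.prod Y).coordMetric p z =
      LocalMetric.prodMetric (X.coordMetric p.1) (Y.coordMetric p.2) z := by
  have e : (extChartAt (X.I.prod Y.I) p).symm =
      (fun z : X.E × Y.E => ((extChartAt X.I p.1).symm z.1, (extChartAt Y.I p.2).symm z.2)) := by
    rw [extChartAt_prod]
    rfl
  have h3 : MDifferentiableAt 𝓘(ℝ, X.E) X.I (extChartAt X.I p.1).symm z.1 :=
    (contMDiffAt_extChartAt_symm h1).mdifferentiableAt (by simp)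
  have h4 : MDifferentiableAt 𝓘(ℝ, Y.E) Y.I (extChartAt Y.I p.2).symm z.2 :=
    (contMDiffAt_extChartAt_symm h2).mdifferentiableAt (by simp)
  have hd : mfderiv 𝓘(ℝ, X.E × Y.E) (X.I.prod Y.I) (extChartAt (X.I.prod Y.I) p).symm z =
      (mfderiv 𝓘(ℝ, X.E) X.I (extChartAt X.I p.1).symm z.1).prodMap
        (mfderiv 𝓘(ℝ, Y.E) Y.I (extChartAt Y.I p.2).symm z.2) := by
    rw [e, modelWithCornersSelf_prod, ← chartedSpaceSelf_prod]
    exact mfderiv_prodMap (p := z) h3 h4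
  ext v w
  change prodInner X Y ((extChartAt (X.I.prod Y.I) p).symm z)
    (mfderiv 𝓘(ℝ, X.E × Y.E) (X.I.prod Y.I) (extChartAt (X.I.prod Y.I) p).symm z v)
    (mfderiv 𝓘(ℝ, X.E × Y.E) (X.I.prod Y.I) (extChartAt (X.I.prod Y.I) p).symm z w) = _
  rw [prodInner_apply, hd]
  rfl

end RiemMfd

/-! ### Riemannian distance and completeness -/

namespace RiemMfd

variable (X Y : RiemMfd)

/-- The speed of a path on `[0, 1]`. -/
def speed (γ : ℝ → X.M) (t : ℝ) : ℝ :=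
  Real.sqrt (X.g.inner (γ t) (mfderivWithin 𝓘(ℝ, ℝ) X.I γ (Set.Icc 0 1) t 1)
    (mfderivWithin 𝓘(ℝ, ℝ) X.I γ (Set.Icc 0 1) t 1))

theorem enorm_eq (x : X.M) (v : TangentSpace X.I x) :
    letI : RiemannianBundle (fun x : X.M => TangentSpace X.I x) := ⟨X.g.toRiemannianMetric⟩
    ‖v‖ₑ = ENNReal.ofReal (Real.sqrt (X.g.inner x v v)) := by
  let : RiemannianBundle (fun x : X.M => TangentSpace X.I x) := ⟨X.g.toRiemannianMetric⟩
  rw [← ofReal_norm, norm_eq_sqrt_real_inner]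
  rfl

theorem exists_path_of_edist_lt {x y : X.M} {r : ℝ≥0∞} (h : X.edist x y < r) :
    ∃ γ : ℝ → X.M, γ 0 = x ∧ γ 1 = y ∧ ContMDiffOn 𝓘(ℝ, ℝ) X.I 1 γ (Set.Icc 0 1) ∧
      ∫⁻ t in Set.Icc 0 1, ENNReal.ofReal (X.speed γ t) < r := by
  let : RiemannianBundle (fun x : X.M => TangentSpace X.I x) := ⟨X.g.toRiemannianMetric⟩
  obtain ⟨γ, h0, h1, hγ, hr⟩ := exists_lt_of_riemannianEDist_lt (I := X.I) h
  refine ⟨γ, h0, h1, hγ, ?_⟩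
  rw [pathELength_eq_lintegral_mfderivWithin_Icc] at hr
  convert hr using 3 with t
  exact (X.enorm_eq _ _).symm

theorem edist_le_lintegral_speed {γ : ℝ → X.M}
    (hγ : ContMDiffOn 𝓘(ℝ, ℝ) X.I 1 γ (Set.Icc 0 1)) :
    X.edist (γ 0) (γ 1) ≤ ∫⁻ t in Set.Icc 0 1, ENNReal.ofReal (X.speed γ t) := by
  let : RiemannianBundle (fun x : X.M => TangentSpace X.I x) := ⟨X.g.toRiemannianMetric⟩
  have h := riemannianEDist_le_pathELength (I := X.I) hγ rfl rfl zero_le_one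
  rw [pathELength_eq_lintegral_mfderivWithin_Icc] at h
  refine h.trans_eq ?_
  congr 1
  ext t
  exact X.enorm_eq _ _

theorem continuousOn_speed {γ : ℝ → X.M}
    (hγ : ContMDiffOn 𝓘(ℝ, ℝ) X.I 1 γ (Set.Icc 0 1)) :
    ContinuousOn (X.speed γ) (Set.Icc 0 1) := by
  let : RiemannianBundle (fun x : X.M => TangentSpace X.I x) := ⟨X.g.toRiemannianMetric⟩
  have : IsManifold X.I 1 X.M := IsManifold.of_le (n := ∞) (by simp)
  have hc0 : IsContinuousRiemannianBundle X.E (fun x : X.M => TangentSpace X.I x) :=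
    ⟨X.g.inner, X.g.contMDiff.continuous, fun _ _ _ ↦ rfl⟩
  have hT := hγ.continuousOn_tangentMapWithin le_rfl
    (uniqueMDiffOn_iff_uniqueDiffOn.2 (uniqueDiffOn_Icc zero_lt_one))
  have hu : Continuous fun t : ℝ => (TotalSpace.mk' ℝ (E := TangentSpace 𝓘(ℝ, ℝ)) t (1 : ℝ)) := by
    have : Continuous fun t : ℝ => (tangentBundleModelSpaceHomeomorph 𝓘(ℝ, ℝ)).symm (t, (1 : ℝ)) := by
      exact (Homeomorph.continuous _).comp (Continuous.prodMk continuous_id continuous_const)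
    rw [tangentBundleModelSpaceHomeomorph_coe_symm] at this
    exact this
  have hv := hT.comp hu.continuousOn (fun t ht => ht : Set.MapsTo _ (Set.Icc (0:ℝ) 1) _)
  exact (ContinuousOn.inner_bundle (F := X.E) hv hv).sqrt

theorem edist_self (x : X.M) : X.edist x x = 0 := by
  let : RiemannianBundle (fun x : X.M => TangentSpace X.I x) := ⟨X.g.toRiemannianMetric⟩
  exact riemannianEDist_self

theorem edist_comm (x y : X.M) : X.edist x y = X.edist y x := by
  let : RiemannianBundle (fun x : X.M => TangentSpace X.I x) := ⟨X.g.toRiemannianMetric⟩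
  exact riemannianEDist_comm

theorem edist_triangle (x y z : X.M) : X.edist x z ≤ X.edist x y + X.edist y z := by
  let : RiemannianBundle (fun x : X.M => TangentSpace X.I x) := ⟨X.g.toRiemannianMetric⟩
  exact riemannianEDist_triangle

theorem eventually_edist_lt (x : X.M) {c : ℝ≥0∞} (hc : 0 < c) : ∀ᶠ y in 𝓝 x, X.edist x y < c := by
  let : RiemannianBundle (fun x : X.M => TangentSpace X.I x) := ⟨X.g.toRiemannianMetric⟩
  have : IsManifold X.I 1 X.M := IsManifold.of_le (n := ∞) (by simp)
  have hc0 : IsContinuousRiemannianBundle X.E (fun x : X.M => TangentSpace X.I x) :=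
    ⟨X.g.inner, X.g.contMDiff.continuous, fun _ _ _ ↦ rfl⟩
  exact eventually_riemannianEDist_lt X.I x hc

/-- The balls of the Riemannian distance form a neighbourhood basis. -/
theorem exists_edist_lt_subset {x : X.M} {s : Set X.M} (hs : s ∈ 𝓝 x) :
    ∃ c > 0, {y | X.edist x y < c} ⊆ s := by
  let : RiemannianBundle (fun x : X.M => TangentSpace X.I x) := ⟨X.g.toRiemannianMetric⟩
  have : IsManifold X.I 1 X.M := IsManifold.of_le (n := ∞) (by simp)
  have hc0 : IsContinuousRiemannianBundle X.E (fun x : X.M => TangentSpace X.I x) :=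
    ⟨X.g.inner, X.g.contMDiff.continuous, fun _ _ _ ↦ rfl⟩
  have : LocallyCompactSpace X.M := Manifold.locallyCompact_of_finiteDimensional X.I
  exact setOfPred_riemannianEDist_lt_subset_nhds' X.I hs

/-- A map whose differential stretches lengths by at most `c` does so with distances. -/
theorem edist_map_le {X Y : RiemMfd} {f : X.M → Y.M} (hf : ContMDiff X.I Y.I 1 f) {c : ℝ}
    (hc : 0 < c)
    (h : ∀ x v, Y.g.inner (f x) (mfderiv X.I Y.I f x v) (mfderiv X.I Y.I f x v) ≤
      c ^ 2 * X.g.inner x v v) (x y : X.M) :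
    Y.edist (f x) (f y) ≤ ENNReal.ofReal c * X.edist x y := by
  have hc0 : ENNReal.ofReal c ≠ 0 := by simpa using hc
  have hct : ENNReal.ofReal c ≠ ⊤ := ENNReal.ofReal_ne_top
  rw [mul_comm, ← ENNReal.div_le_iff_le_mul (Or.inl hc0) (Or.inl hct)]
  refine le_of_forall_gt fun r hr => ?_
  obtain ⟨γ, rfl, rfl, hγ, hlt⟩ := X.exists_path_of_edist_lt hr
  refine lt_of_le_of_lt ?_ hlt
  rw [ENNReal.div_le_iff_le_mul (Or.inl hc0) (Or.inl hct), mul_comm]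
  refine (Y.edist_le_lintegral_speed (γ := f ∘ γ) (hf.comp_contMDiffOn hγ)).trans ?_
  rw [← lintegral_const_mul' _ _ hct]
  refine setLIntegral_mono' measurableSet_Icc fun t ht => ?_
  rw [← ENNReal.ofReal_mul hc.le]
  refine ENNReal.ofReal_le_ofReal ?_
  have hcomp : mfderivWithin 𝓘(ℝ, ℝ) Y.I (f ∘ γ) (Set.Icc 0 1) t =
      (mfderiv X.I Y.I f (γ t)).comp (mfderivWithin 𝓘(ℝ, ℝ) X.I γ (Set.Icc 0 1) t) :=
    mfderiv_comp_mfderivWithin t ((hf (γ t)).mdifferentiableAt (by simp))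
      ((hγ t ht).mdifferentiableWithinAt (by simp))
      (uniqueMDiffWithinAt_iff_uniqueDiffWithinAt.2 (uniqueDiffOn_Icc zero_lt_one t ht))
  unfold speed
  rw [hcomp]
  have h1 := Real.sqrt_le_sqrt (h (γ t) (mfderivWithin 𝓘(ℝ, ℝ) X.I γ (Set.Icc 0 1) t 1))
  rw [Real.sqrt_mul (sq_nonneg c), Real.sqrt_sq hc.le] at h1
  exact h1

/-- A function that is pointwise `1`-Lipschitz to first order is `1`-Lipschitz for the Riemannian
distance. -/
theorem ofReal_sub_le_edist {h : X.M → ℝ} (hcont : Continuous h)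
    (hlip : ∀ x, ∀ ε > 0, ∀ᶠ y in 𝓝 x, h y - h x ≤
      Real.sqrt (X.g.inner x (extChartAt X.I x y - extChartAt X.I x x : X.E)
        (extChartAt X.I x y - extChartAt X.I x x : X.E)) +
        ε * ‖extChartAt X.I x y - extChartAt X.I x x‖) (x y : X.M) :
    ENNReal.ofReal (h y - h x) ≤ X.edist x y := by
  refine le_of_forall_gt fun r hr => ?_
  obtain ⟨γ, rfl, rfl, hγ, hlt⟩ := X.exists_path_of_edist_lt hr
  refine lt_of_le_of_lt ?_ hlt
  have hs := X.continuousOn_speed hγ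
  have hsI : IntervalIntegrable (X.speed γ) volume 0 1 :=
    ContinuousOn.intervalIntegrable (by rwa [Set.uIcc_of_le zero_le_one])
  have hs0 : ∀ t, 0 ≤ X.speed γ t := fun t => Real.sqrt_nonneg _
  rw [← ofReal_integral_eq_lintegral_ofReal, integral_Icc_eq_integral_Ioc,
    ← intervalIntegral.integral_of_le zero_le_one]
  rotate_left
  · exact hs.integrableOn_Icc
  · exact Eventually.of_forall hs0
  refine ENNReal.ofReal_le_ofReal ?_
  -- along a path, `h` grows at most as fast as the arc length: compare the right slopes
  have key := image_le_of_liminf_slope_right_le_deriv_boundary (f := fun t => h (γ t)) (a := 0)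
    (b := 1) (B := fun t => h (γ 0) + ∫ u in (0:ℝ)..t, X.speed γ u) (B' := X.speed γ)
    (hcont.comp_continuousOn hγ.continuousOn) (by simp) ?_ ?_ ?_
    (Set.right_mem_Icc.2 zero_le_one)
  · simpa [add_comm] using key
  · refine continuousOn_const.add ?_
    have := intervalIntegral.continuousOn_primitive_interval' hsI Set.left_mem_uIcc
    rwa [Set.uIcc_of_le zero_le_one] at this
  · intro t ht
    have hIci : Set.Icc (0 : ℝ) 1 ∈ 𝓝[≥] t :=
      mem_of_superset (Icc_mem_nhdsGE ht.2) (Set.Icc_subset_Icc_left ht.1)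
    have hIoi : Set.Icc (0 : ℝ) 1 ∈ 𝓝[>] t := nhdsWithin_mono _ Set.Ioi_subset_Ici_self hIci
    have hct : ContinuousWithinAt (X.speed γ) (Set.Icc 0 1) t := hs t ⟨ht.1, ht.2.le⟩
    refine (intervalIntegral.integral_hasDerivWithinAt_right
      (hsI.mono_set ?_) (t := Set.Ioi t) ?_ ?_).const_add _
    · rw [Set.uIcc_of_le ht.1, Set.uIcc_of_le zero_le_one]
      exact Set.Icc_subset_Icc_right ht.2.le
    · exact ⟨Set.Icc 0 1, hIoi, hs.aestronglyMeasurable measurableSet_Icc⟩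
    · exact hct.mono_of_mem_nhdsWithin hIoi
  · intro t ht r hr
    have hIoi : Set.Icc (0 : ℝ) 1 ∈ 𝓝[>] t :=
      mem_of_superset (mem_of_superset (Ioc_mem_nhdsGT ht.2) Set.Ioc_subset_Icc_self)
        (Set.Icc_subset_Icc_left ht.1)
    have htI : t ∈ Set.Icc (0:ℝ) 1 := ⟨ht.1, ht.2.le⟩
    have hγt : Tendsto γ (𝓝[>] t) (𝓝 (γ t)) :=
      (hγ.continuousOn t htI).mono_of_mem_nhdsWithin hIoi
    have hmd : MDifferentiableWithinAt 𝓘(ℝ, ℝ) X.I γ (Set.Icc 0 1) t :=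
      (hγ t htI).mdifferentiableWithinAt (by simp)
    set φ := extChartAt X.I (γ t) with hφ
    let D : X.E := mfderivWithin 𝓘(ℝ, ℝ) X.I γ (Set.Icc 0 1) t 1
    have hder : HasDerivWithinAt (fun τ => φ (γ τ)) D (Set.Icc 0 1) t := by
      let D' : ℝ →L[ℝ] X.E := mfderivWithin 𝓘(ℝ, ℝ) X.I γ (Set.Icc 0 1) t
      have hF : HasFDerivWithinAt (fun τ => φ (γ τ)) D' (Set.Icc 0 1) t :=
        HasFDerivWithinAt.mono (F := X.E) (f' := D') hmd.hasMFDerivWithinAt.2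
          fun τ hτ => ⟨hτ, ⟨τ, rfl⟩⟩
      exact hF.hasDerivWithinAt
    have hζ : Tendsto (fun τ => (τ - t)⁻¹ • (φ (γ τ) - φ (γ t))) (𝓝[>] t) (𝓝 D) := by
      have := hder.mono_of_mem_nhdsWithin hIoi
      exact (hasDerivWithinAt_iff_tendsto_slope' Set.self_notMem_Ioi).1 this
    -- the bound divided by `τ - t` converges to the speed plus a multiple of `ε`
    obtain ⟨ε, hε, hεr⟩ : ∃ ε > 0, X.speed γ t + ε * ‖D‖ < r := by
      refine ⟨(r - X.speed γ t) / (2 * (‖D‖ + 1)), div_pos (by linarith) (by positivity), ?_⟩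
      have hD := norm_nonneg D
      have : (r - X.speed γ t) / (2 * (‖D‖ + 1)) * ‖D‖ ≤ (r - X.speed γ t) / 2 := by
        rw [div_mul_eq_mul_div, div_le_div_iff₀ (by positivity) (by positivity)]
        nlinarith
      linarith
    have hlim : Tendsto (fun τ => Real.sqrt (X.g.inner (γ t)
        ((τ - t)⁻¹ • (φ (γ τ) - φ (γ t)) : X.E) ((τ - t)⁻¹ • (φ (γ τ) - φ (γ t)) : X.E)) +
        ε * ‖(τ - t)⁻¹ • (φ (γ τ) - φ (γ t))‖) (𝓝[>] t) (𝓝 (X.speed γ t + ε * ‖D‖)) := by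
      let A : X.E →L[ℝ] X.E →L[ℝ] ℝ := X.g.inner (γ t)
      have hcA : Continuous fun w : X.E => Real.sqrt (A w w) + ε * ‖w‖ := by fun_prop
      exact (hcA.tendsto D).comp hζ
    refine Eventually.frequently ?_
    filter_upwards [hlim.eventually (gt_mem_nhds hεr), hγt.eventually (hlip (γ t) ε hε),
      self_mem_nhdsWithin] with τ h1 h2 h3
    refine lt_of_le_of_lt ?_ h1
    have hpos : 0 < τ - t := sub_pos.2 h3
    rw [slope_def_field, div_le_iff₀ hpos]
    refine h2.trans_eq ?_
    let A : X.E →L[ℝ] X.E →L[ℝ] ℝ := X.g.inner (γ t)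
    change Real.sqrt (A (φ (γ τ) - φ (γ t)) (φ (γ τ) - φ (γ t))) + ε * ‖φ (γ τ) - φ (γ t)‖ =
      (Real.sqrt (A ((τ - t)⁻¹ • (φ (γ τ) - φ (γ t))) ((τ - t)⁻¹ • (φ (γ τ) - φ (γ t)))) +
        ε * ‖(τ - t)⁻¹ • (φ (γ τ) - φ (γ t))‖) * (τ - t)
    rw [map_smul, map_smul, smul_apply, smul_eq_mul, smul_eq_mul, ← mul_assoc, norm_smul,
      Real.sqrt_mul (mul_self_nonneg _), Real.sqrt_mul_self (inv_pos.2 hpos).le, Real.norm_eq_abs,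
      abs_of_pos (inv_pos.2 hpos)]
    field_simp

/-- Completeness from a `1`-Lipschitz function that is proper in the sense that its sublevel sets
are contained in compact sets. -/
theorem isComplete_of_lipschitz {h : X.M → ℝ}
    (hlip : ∀ x y, ENNReal.ofReal (h y - h x) ≤ X.edist x y)
    (hcpt : ∀ R, ∃ K, IsCompact K ∧ ∀ x, h x ≤ R → x ∈ K) : X.IsComplete := by
  intro u hu
  obtain ⟨N, hN⟩ := hu 1 one_pos
  obtain ⟨K, hK, hKu⟩ := hcpt (h (u N) + 1)
  have hmem : ∀ n, u (N + n) ∈ K := by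
    intro n
    refine hKu _ ?_
    have h1 := (hlip (u N) (u (N + n))).trans_lt (hN N le_rfl (N + n) (by simp))
    rw [← ENNReal.ofReal_one, ENNReal.ofReal_lt_ofReal_iff one_pos] at h1
    linarith
  obtain ⟨x, -, φ, hφ, hx⟩ := hK.tendsto_subseq hmem
  refine ⟨x, tendsto_def.2 fun s hs => ?_⟩
  obtain ⟨c, hc, hcs⟩ := X.exists_edist_lt_subset hs
  obtain ⟨N', hN'⟩ := hu (c / 2) (ENNReal.half_pos hc.ne')
  obtain ⟨k, hk1, hk2⟩ := ((hx.eventually (X.eventually_edist_lt x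
    (ENNReal.half_pos hc.ne'))).and (eventually_ge_atTop N')).exists
  filter_upwards [eventually_ge_atTop N'] with n hn
  refine hcs ?_
  have h2 : N' ≤ N + φ k := hk2.trans ((hφ.id_le k).trans (Nat.le_add_left _ _))
  calc X.edist x (u n) ≤ X.edist x (u (N + φ k)) + X.edist (u (N + φ k)) (u n) :=
        X.edist_triangle _ _ _
    _ < c / 2 + c / 2 := ENNReal.add_lt_add hk1 (hN' _ h2 _ hn)
    _ = c := ENNReal.add_halves c

/-- A compact Riemannian manifold is complete. -/
theorem isComplete_of_compactSpace [CompactSpace X.M] : X.IsComplete :=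
  X.isComplete_of_lipschitz (h := fun _ => 0) (by simp) fun _ => ⟨Set.univ, isCompact_univ, by simp⟩

theorem edist_fst_le (p q : X.M × Y.M) : X.edist p.1 q.1 ≤ (X.prod Y).edist p q := by
  have h : ∀ (x : X.M × Y.M) (v : TangentSpace (X.I.prod Y.I) x),
      X.g.inner x.1 (mfderiv (X.I.prod Y.I) X.I Prod.fst x v)
        (mfderiv (X.I.prod Y.I) X.I Prod.fst x v) ≤ 1 ^ 2 * prodInner X Y x v v := by
    intro x v
    rw [mfderiv_fst, prodInner_apply, one_pow, one_mul]
    exact le_add_of_nonneg_right ((Y.isInner_inner x.2).self_nonneg _)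
  have h1 : ContMDiff (X.I.prod Y.I) X.I 1 (Prod.fst : X.M × Y.M → X.M) := contMDiff_fst
  simpa using edist_map_le (X := X.prod Y) (Y := X) h1 one_pos h p q

theorem edist_snd_le (p q : X.M × Y.M) : Y.edist p.2 q.2 ≤ (X.prod Y).edist p q := by
  have h : ∀ (x : X.M × Y.M) (v : TangentSpace (X.I.prod Y.I) x),
      Y.g.inner x.2 (mfderiv (X.I.prod Y.I) Y.I Prod.snd x v)
        (mfderiv (X.I.prod Y.I) Y.I Prod.snd x v) ≤ 1 ^ 2 * prodInner X Y x v v := by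
    intro x v
    rw [mfderiv_snd, prodInner_apply, one_pow, one_mul]
    exact le_add_of_nonneg_left ((X.isInner_inner x.1).self_nonneg _)
  have h1 : ContMDiff (X.I.prod Y.I) Y.I 1 (Prod.snd : X.M × Y.M → Y.M) := contMDiff_snd
  simpa using edist_map_le (X := X.prod Y) (Y := Y) h1 one_pos h p q

theorem edist_rescale_ge (a : ℝ) (ha : 0 < a) (x y : X.M) :
    X.edist x y ≤ ENNReal.ofReal a⁻¹ * (X.rescale a ha).edist x y := by
  have h : ∀ (x : X.M) (v : TangentSpace X.I x),
      X.g.inner x (mfderiv X.I X.I id x v) (mfderiv X.I X.I id x v) ≤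
        a⁻¹ ^ 2 * (a ^ 2 * X.g.inner x v v) := by
    intro x v
    rw [mfderiv_id, ← mul_assoc, ← mul_pow, inv_mul_cancel₀ ha.ne', one_pow, one_mul]
    exact le_rfl
  have h1 : ContMDiff X.I X.I 1 (id : X.M → X.M) := contMDiff_id
  exact edist_map_le (X := X.rescale a ha) (Y := X) h1 (inv_pos.2 ha) h x y

theorem ball_prod_subset (p : X.M × Y.M) (r : ℝ) :
    (X.prod Y).ball p r ⊆ X.ball p.1 r ×ˢ Y.ball p.2 r := fun q hq =>
  ⟨(X.edist_fst_le Y p q).trans_lt hq, (X.edist_snd_le Y p q).trans_lt hq⟩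

theorem ball_rescale_subset (a : ℝ) (ha : 0 < a) (x : X.M) (r : ℝ) :
    (X.rescale a ha).ball x r ⊆ X.ball x (a⁻¹ * r) := by
  intro y hy
  refine (X.edist_rescale_ge a ha x y).trans_lt ?_
  rw [ENNReal.ofReal_mul (inv_pos.2 ha).le]
  exact (ENNReal.mul_lt_mul_iff_right (by simpa using ha) ENNReal.ofReal_ne_top).2 hy

theorem IsComplete.prod {X Y : RiemMfd} (hX : X.IsComplete) (hY : Y.IsComplete) :
    (X.prod Y).IsComplete := by
  intro u hu
  obtain ⟨x, hx⟩ := hX (fun n => (u n).1) fun ε hε => (hu ε hε).imp fun N hN m hm n hn =>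
    (X.edist_fst_le Y _ _).trans_lt (hN m hm n hn)
  obtain ⟨y, hy⟩ := hY (fun n => (u n).2) fun ε hε => (hu ε hε).imp fun N hN m hm n hn =>
    (X.edist_snd_le Y _ _).trans_lt (hN m hm n hn)
  exact ⟨(x, y), hx.prodMk_nhds hy⟩

theorem IsComplete.rescale {X : RiemMfd} (hX : X.IsComplete) (a : ℝ) (ha : 0 < a) :
    (X.rescale a ha).IsComplete := by
  intro u hu
  refine hX u fun ε hε => ?_
  have hc0 : ENNReal.ofReal a⁻¹ ≠ 0 := by simpa using ha
  obtain ⟨N, hN⟩ := hu (ε / ENNReal.ofReal a⁻¹) (ENNReal.div_pos hε.ne' ENNReal.ofReal_ne_top)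
  refine ⟨N, fun m hm n hn => (X.edist_rescale_ge a ha _ _).trans_lt ?_⟩
  rw [mul_comm]
  exact (ENNReal.lt_div_iff_mul_lt (Or.inl hc0) (Or.inl ENNReal.ofReal_ne_top)).1 (hN m hm n hn)

theorem mem_ball_self (x : X.M) {r : ℝ} (hr : 0 < r) : x ∈ X.ball x r := by
  change X.edist x x < _
  rw [edist_self]
  simpa using hr

end RiemMfd

/-! ### The Riemannian measure -/

namespace LocalMetric

section gram

variable {E F ι κ : Type} [NormedAddCommGroup E] [NormedSpace ℝ E] [FiniteDimensional ℝ E]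
  [NormedAddCommGroup F] [NormedSpace ℝ F] [FiniteDimensional ℝ F]
  [Fintype ι] [DecidableEq ι] [Fintype κ] [DecidableEq κ]

/-- The Gram matrix of a bilinear form in a basis. -/
def gram (e : Module.Basis ι ℝ E) (B : E →L[ℝ] E →L[ℝ] ℝ) : Matrix ι ι ℝ :=
  Matrix.of fun i j => B (e i) (e j)

/-- Change of variables for Gram determinants; its square root is the Jacobian. -/
theorem det_gram_pullback (e : Module.Basis ι ℝ E) (B : F →L[ℝ] F →L[ℝ] ℝ)
    (f : Module.Basis ι ℝ F) (A : E →L[ℝ] F) :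
    (gram e (pullbackForm B A)).det =
      (LinearMap.toMatrix e f (A : E →ₗ[ℝ] F)).det ^ 2 * (gram f B).det := by
  have : gram e (pullbackForm B A) = (LinearMap.toMatrix e f (A : E →ₗ[ℝ] F)).transpose *
      gram f B * LinearMap.toMatrix e f (A : E →ₗ[ℝ] F) := by
    ext i j
    have h : ∀ i, A (e i) = ∑ k, LinearMap.toMatrix e f (A : E →ₗ[ℝ] F) k i • f k := by
      intro i
      simp only [LinearMap.toMatrix_apply]
      exact (f.sum_repr _).symm
    simp only [Matrix.mul_apply, Matrix.transpose_apply, gram, Matrix.of_apply,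
      pullbackForm_apply]
    rw [h i, h j]
    simp only [map_sum, map_smul, sum_apply, smul_apply, smul_eq_mul, Finset.sum_mul,
      Finset.mul_sum]
    refine Finset.sum_congr rfl fun k _ => Finset.sum_congr rfl fun l _ => by ring
  rw [this, Matrix.det_mul, Matrix.det_mul, Matrix.det_transpose]
  ring

theorem IsInner.det_gram_pos {B : E →L[ℝ] E →L[ℝ] ℝ} (hB : IsInner B)
    (e : Module.Basis ι ℝ E) : 0 < (gram e B).det := by
  refine Matrix.PosDef.det_pos ?_
  refine Matrix.PosDef.of_dotProduct_mulVec_pos ?_ ?_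
  · ext i j
    exact hB.symm _ _
  · intro x hx
    have h : dotProduct (star x) (Matrix.mulVec (gram e B) x) =
        B (∑ i, x i • e i) (∑ i, x i • e i) := by
      simp only [dotProduct, Matrix.mulVec, gram, Matrix.of_apply, map_sum, map_smul,
        sum_apply, smul_apply, smul_eq_mul, Finset.mul_sum, Pi.star_apply, star_trivial]
      rw [Finset.sum_comm]
      refine Finset.sum_congr rfl fun k _ => Finset.sum_congr rfl fun l _ => by ring
    rw [h]
    refine hB.pos _ fun h0 => hx ?_
    ext i
    exact Fintype.linearIndependent_iff.1 e.linearIndependent x h0 i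

theorem det_gram_prod (e : Module.Basis ι ℝ E) (f : Module.Basis κ ℝ F)
    (A : E →L[ℝ] E →L[ℝ] ℝ) (B : F →L[ℝ] F →L[ℝ] ℝ) :
    (gram (e.prod f) (sumForm A B)).det = (gram e A).det * (gram f B).det := by
  have : gram (e.prod f) (sumForm A B) = Matrix.fromBlocks (gram e A) 0 0 (gram f B) := by
    ext i j
    rcases i with i | i <;> rcases j with j | j <;>
      simp [gram, sumForm_apply, Matrix.fromBlocks]
  rw [this, Matrix.det_fromBlocks_zero₂₁]

/-- The Riemannian measure of a field of bilinear forms on a vector space. -/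
def formMeasure [MeasurableSpace E] [BorelSpace E] (e : Module.Basis ι ℝ E)
    (G : E → E →L[ℝ] E →L[ℝ] ℝ) : Measure E :=
  e.addHaar.withDensity fun z => ENNReal.ofReal (Real.sqrt (gram e (G z)).det)

/-- The Riemannian measure does not depend on the basis normalising the Lebesgue measure. -/
theorem formMeasure_basis [MeasurableSpace E] [BorelSpace E] (e : Module.Basis ι ℝ E)
    (e' : Module.Basis κ ℝ E) (G : E → E →L[ℝ] E →L[ℝ] ℝ) :
    formMeasure e G = formMeasure e' G := by
  have hred : ∃ e'' : Module.Basis ι ℝ E, formMeasure e' G = formMeasure e'' G := by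
    let σ : κ ≃ ι := e'.indexEquiv e
    refine ⟨e'.reindex σ, ?_⟩
    unfold formMeasure
    rw [Module.Basis.addHaar_reindex]
    congr 1
    ext z
    have : gram (e'.reindex σ) (G z) = (gram e' (G z)).submatrix σ.symm σ.symm := by
      ext i j
      simp [gram]
    rw [this, Matrix.det_submatrix_equiv_self]
  obtain ⟨e'', he''⟩ := hred
  rw [he'']
  have hdet : e.det e'' ≠ 0 := (e.isUnit_det e'').ne_zero
  have hc : 0 < |e.det e''| := abs_pos.2 hdet
  have hm : e''.addHaar = (ENNReal.ofReal |e.det e''|)⁻¹ • e.addHaar := by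
    have h := Measure.isAddLeftInvariant_eq_smul e''.addHaar e.addHaar
    set c := Measure.addHaarScalarFactor e''.addHaar e.addHaar
    have h1 := e''.addHaar_self
    rw [h, Measure.smul_apply, Measure.addHaar_parallelepiped] at h1
    rw [h, ← ENNReal.eq_inv_of_mul_eq_one_left h1]
    rfl
  have hg : ∀ z, (gram e'' (G z)).det = e.det e'' ^ 2 * (gram e (G z)).det := by
    intro z
    have := det_gram_pullback e'' (G z) e (ContinuousLinearMap.id ℝ E)
    have h2 : pullbackForm (G z) (ContinuousLinearMap.id ℝ E) = G z := by
      ext v w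
      rfl
    rw [h2] at this
    rw [this]
    congr 2
    rw [Module.Basis.det_apply, ← LinearMap.toMatrix_id_eq_basis_toMatrix]
    rfl
  unfold formMeasure
  rw [hm]
  ext s hs
  rw [withDensity_apply _ hs, withDensity_apply _ hs, Measure.restrict_smul,
    lintegral_smul_measure, smul_eq_mul, ← lintegral_const_mul' _ _ (by simpa using hc)]
  congr 1
  ext z
  rw [hg, Real.sqrt_mul (sq_nonneg _), Real.sqrt_sq_eq_abs, ENNReal.ofReal_mul hc.le,
    ← mul_assoc, ENNReal.inv_mul_cancel (by simpa using hc) ENNReal.ofReal_ne_top, one_mul]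

theorem continuous_det_gram (e : Module.Basis ι ℝ E) :
    Continuous fun B : E →L[ℝ] E →L[ℝ] ℝ => ENNReal.ofReal (Real.sqrt (gram e B).det) := by
  have : Continuous fun B : E →L[ℝ] E →L[ℝ] ℝ => gram e B :=
    continuous_matrix fun i j => by
      simp only [gram, Matrix.of_apply]
      fun_prop
  exact ENNReal.continuous_ofReal.comp (this.matrix_det.sqrt)

theorem formMeasure_prod [MeasurableSpace E] [BorelSpace E] [MeasurableSpace F] [BorelSpace F]
    [m : MeasurableSpace (E × F)] [hm : BorelSpace (E × F)]
    {e : Module.Basis ι ℝ E} {f : Module.Basis κ ℝ F}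
    {ν : Type} [Fintype ν] [DecidableEq ν] (p : Module.Basis ν ℝ (E × F))
    {G : E → E →L[ℝ] E →L[ℝ] ℝ} {K : F → F →L[ℝ] F →L[ℝ] ℝ}
    {H : E × F → E × F →L[ℝ] E × F →L[ℝ] ℝ} {S : Set E} {T : Set F} (hS : MeasurableSet S)
    (hT : MeasurableSet T) (hG : ContinuousOn G S) (hK : ContinuousOn K T)
    (hGi : ∀ z ∈ S, IsInner (G z))
    (hH : ∀ z ∈ S ×ˢ T, H z = prodMetric G K z) :
    formMeasure p H (S ×ˢ T) = formMeasure e G S * formMeasure f K T := by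
  obtain rfl : m = Prod.instMeasurableSpace :=
    hm.measurable_eq.trans (Prod.borelSpace (α := E) (β := F)).measurable_eq.symm
  rw [formMeasure_basis p (e.prod f)]
  unfold formMeasure
  rw [withDensity_apply _ (hS.prod hT), withDensity_apply _ hS, withDensity_apply _ hT,
    Module.Basis.prod_addHaar, ← Measure.prod_restrict, ← lintegral_prod_mul, Measure.prod_restrict]
  · refine setLIntegral_congr_fun (hS.prod hT) fun z hz => ?_
    rw [hH z hz]
    unfold prodMetric
    rw [det_gram_prod, Real.sqrt_mul ((hGi _ hz.1).det_gram_pos e).le,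
      ENNReal.ofReal_mul (Real.sqrt_nonneg _)]
  · exact ((continuous_det_gram e).comp_continuousOn hG).aemeasurable hS
  · exact ((continuous_det_gram f).comp_continuousOn hK).aemeasurable hT

theorem formMeasure_smul [MeasurableSpace E] [BorelSpace E] (e : Module.Basis ι ℝ E)
    (G : E → E →L[ℝ] E →L[ℝ] ℝ) {a : ℝ} (ha : 0 < a) :
    formMeasure e (fun z => a ^ 2 • G z) =
      ENNReal.ofReal (a ^ Fintype.card ι) • formMeasure e G := by
  unfold formMeasure
  rw [← withDensity_smul' _ _ ENNReal.ofReal_ne_top]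
  congr 1
  ext z
  have : gram e (a ^ 2 • G z) = a ^ 2 • gram e (G z) := rfl
  rw [this, Matrix.det_smul, ← pow_mul, mul_comm 2, pow_mul, Real.sqrt_mul (sq_nonneg _),
    Real.sqrt_sq (by positivity), ENNReal.ofReal_mul (by positivity)]
  rfl

end gram

end LocalMetric

namespace RiemMfd

variable (X Y : RiemMfd)

/-- The Riemannian measure in the coordinates of the preferred chart at `x`. -/
def coordMeasure (x : X.M) : Measure X.E :=
  LocalMetric.formMeasure (Module.finBasis ℝ X.E) (X.coordMetric x)

theorem continuousOn_coordMetric (x : X.M) :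
    ContinuousOn (X.coordMetric x) (extChartAt X.I x).target := fun _ hz =>
  (X.contDiffAt_coordMetric hz).continuousAt.continuousWithinAt

theorem aemeasurable_extChartAt_symm (x : X.M) (μ : Measure X.E) :
    AEMeasurable (extChartAt X.I x).symm (μ.restrict (extChartAt X.I x).target) :=
  (continuousOn_extChartAt_symm x).aemeasurable (isOpen_extChartAt_target x).measurableSet

theorem measurableSet_coord (x : X.M) {A : Set X.M} (hA : MeasurableSet A) :
    MeasurableSet ((extChartAt X.I x).target ∩ (extChartAt X.I x).symm ⁻¹' A) := by
  have h := (continuousOn_iff_continuous_domRestrict.1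
    (continuousOn_extChartAt_symm (I := X.I) x)).measurable hA
  have h2 := (isOpen_extChartAt_target (I := X.I) x).measurableSet.subtype_image h
  convert h2 using 1
  ext z
  constructor
  · exact fun h => ⟨⟨z, h.1⟩, h.2, rfl⟩
  · rintro ⟨w, hw, rfl⟩
    exact ⟨w.2, hw⟩

theorem chartVol_apply (x : X.M) {A : Set X.M} (hA : MeasurableSet A) :
    X.chartVol x A =
      X.coordMeasure x ((extChartAt X.I x).target ∩ (extChartAt X.I x).symm ⁻¹' A) := by
  rw [chartVol, Measure.map_apply_of_aemeasurable (X.aemeasurable_extChartAt_symm x _) hA,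
    Measure.restrict_apply₀' (isOpen_extChartAt_target x).measurableSet.nullMeasurableSet,
    Set.inter_comm]
  rfl

theorem chartVol_inter_source (x : X.M) {A : Set X.M} (hA : MeasurableSet A) :
    X.chartVol x (A ∩ (extChartAt X.I x).source) = X.chartVol x A := by
  rw [X.chartVol_apply x hA,
    X.chartVol_apply x (hA.inter (isOpen_extChartAt_source x).measurableSet)]
  congr 1
  ext z
  constructor
  · exact fun h => ⟨h.1, h.2.1⟩
  · exact fun h => ⟨h.1, h.2, (extChartAt X.I x).map_target h.1⟩

/-- On the overlap of two chart domains the metric in one chart is the pullback of the metric in the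
other one under the transition map. -/
theorem coordMetric_transition {x y : X.M} {z : X.E} (hz : z ∈ (extChartAt X.I x).target)
    (hy : (extChartAt X.I x).symm z ∈ (extChartAt X.I y).source) :
    ∃ T : X.E →L[ℝ] X.E,
      HasFDerivAt (fun w => extChartAt X.I y ((extChartAt X.I x).symm w)) T z ∧
      X.coordMetric x z =
        pullbackForm (X.coordMetric y (extChartAt X.I y ((extChartAt X.I x).symm z))) T := by
  set φ := extChartAt X.I x
  set ψ := extChartAt X.I y
  have hy' : φ.symm z ∈ (chartAt X.H y).source := by
    rwa [extChartAt_source] at hy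
  have hψt : ψ (φ.symm z) ∈ ψ.target := ψ.map_source hy
  have h1 : MDifferentiableAt 𝓘(ℝ, X.E) X.I φ.symm z :=
    (contMDiffAt_extChartAt_symm hz).mdifferentiableAt (by simp)
  have h2 : MDifferentiableAt X.I 𝓘(ℝ, X.E) ψ (φ.symm z) :=
    (contMDiffAt_extChartAt' hy').mdifferentiableAt (by simp : (∞ : WithTop ℕ∞) ≠ 0)
  have h3 : MDifferentiableAt 𝓘(ℝ, X.E) X.I ψ.symm (ψ (φ.symm z)) :=
    (contMDiffAt_extChartAt_symm hψt).mdifferentiableAt (by simp)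
  have h4 : MDifferentiableAt 𝓘(ℝ, X.E) 𝓘(ℝ, X.E) (fun w => ψ (φ.symm w)) z := h2.comp z h1
  have h5 : (fun w => ψ.symm (ψ (φ.symm w))) =ᶠ[𝓝 z] φ.symm := by
    have : ∀ᶠ w in 𝓝 z, φ.symm w ∈ ψ.source :=
      h1.continuousAt ((isOpen_extChartAt_source y).mem_nhds hy)
    filter_upwards [this] with w hw using ψ.left_inv hw
  have h6 : mfderiv 𝓘(ℝ, X.E) X.I φ.symm z = (mfderiv 𝓘(ℝ, X.E) X.I ψ.symm (ψ (φ.symm z))).comp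
      (mfderiv 𝓘(ℝ, X.E) 𝓘(ℝ, X.E) (fun w => ψ (φ.symm w)) z) := by
    rw [← h5.mfderiv_eq]
    exact mfderiv_comp z h3 h4
  refine ⟨fderiv ℝ (fun w => ψ (φ.symm w)) z,
    (mdifferentiableAt_iff_differentiableAt.1 h4).hasFDerivAt, ?_⟩
  have h7 : ∀ (p q : X.M) (h : p = q) (u v : X.E), X.g.inner p u v = X.g.inner q u v := by
    rintro p q rfl u v
    rfl
  ext u v
  change X.g.inner (φ.symm z) (mfderiv 𝓘(ℝ, X.E) X.I φ.symm z u)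
      (mfderiv 𝓘(ℝ, X.E) X.I φ.symm z v) =
    X.g.inner (ψ.symm (ψ (φ.symm z))) (mfderiv 𝓘(ℝ, X.E) X.I ψ.symm (ψ (φ.symm z)) _)
      (mfderiv 𝓘(ℝ, X.E) X.I ψ.symm (ψ (φ.symm z)) _)
  rw [h6]
  rw [mfderiv_eq_fderiv]
  exact h7 _ _ (ψ.left_inv hy).symm _ _

/-- Two charts induce the same measure on the common part of their domains, by the change of
variables formula. -/
theorem chartVol_eq (x y : X.M) {A : Set X.M} (hA : MeasurableSet A)
    (hx : A ⊆ (extChartAt X.I x).source) (hy : A ⊆ (extChartAt X.I y).source) :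
    X.chartVol x A = X.chartVol y A := by
  rw [X.chartVol_apply x hA, X.chartVol_apply y hA]
  set φ := extChartAt X.I x
  set ψ := extChartAt X.I y
  set S := φ.target ∩ φ.symm ⁻¹' A with hS
  have hSm : MeasurableSet S := X.measurableSet_coord x hA
  have himg : ψ.target ∩ ψ.symm ⁻¹' A = (fun w => ψ (φ.symm w)) '' S := by
    ext w
    constructor
    · rintro ⟨h1, h2⟩
      refine ⟨φ (ψ.symm w), ⟨φ.map_source (hx h2), ?_⟩, ?_⟩
      · change φ.symm (φ (ψ.symm w)) ∈ A
        rwa [φ.left_inv (hx h2)]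
      · change ψ (φ.symm (φ (ψ.symm w))) = w
        rw [φ.left_inv (hx h2), ψ.right_inv h1]
    · rintro ⟨v, ⟨h1, h2⟩, rfl⟩
      refine ⟨ψ.map_source (hy h2), ?_⟩
      change ψ.symm (ψ (φ.symm v)) ∈ A
      rwa [ψ.left_inv (hy h2)]
  have hT : ∀ z : X.E, ∃ T : X.E →L[ℝ] X.E, z ∈ S →
      HasFDerivAt (fun w => ψ (φ.symm w)) T z ∧
      X.coordMetric x z = pullbackForm (X.coordMetric y (ψ (φ.symm z))) T := by
    intro z
    by_cases hz : z ∈ S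
    · obtain ⟨T, hT⟩ := X.coordMetric_transition (y := y) hz.1 (hy hz.2)
      exact ⟨T, fun _ => hT⟩
    · exact ⟨0, fun h => absurd h hz⟩
  choose T hT using hT
  have hm : MeasurableSet (ψ.target ∩ ψ.symm ⁻¹' A) := X.measurableSet_coord y hA
  have hinj : Set.InjOn (fun w => ψ (φ.symm w)) S := by
    intro v hv w hw h
    have := ψ.injOn (hy hv.2) (hy hw.2) h
    exact φ.symm.injOn hv.1 hw.1 this
  unfold coordMeasure LocalMetric.formMeasure
  rw [withDensity_apply _ hSm, withDensity_apply _ hm, himg,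
    lintegral_image_eq_lintegral_abs_det_fderiv_mul _ hSm
      (fun z hz => (hT z hz).1.hasFDerivWithinAt) hinj]
  refine setLIntegral_congr_fun hSm fun z hz => ?_
  rw [(hT z hz).2, LocalMetric.det_gram_pullback _ _ (Module.finBasis ℝ X.E),
    Real.sqrt_mul (sq_nonneg _), Real.sqrt_sq_eq_abs, ENNReal.ofReal_mul (abs_nonneg _),
    LinearMap.det_toMatrix]

/-- On a chart domain the Riemannian measure is given by the chart. -/
theorem vol_apply_of_subset_source (x : X.M) {A : Set X.M} (hA : MeasurableSet A)
    (hx : A ⊆ (extChartAt X.I x).source) : X.vol A = X.chartVol x A := by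
  have hsrc : MeasurableSet (extChartAt X.I x).source := (isOpen_extChartAt_source x).measurableSet
  refine le_antisymm ?_ (Measure.le_iff'.1 (le_iSup X.chartVol x) A)
  -- an upper bound of all the `chartVol y`, infinite off the domain of the chart at `x`
  let ν : Measure X.M := X.chartVol x + (⊤ : Measure X.M).restrict (extChartAt X.I x).sourceᶜ
  have hν : X.vol ≤ ν := by
    refine iSup_le fun y => Measure.le_iff.2 fun B hB => ?_
    rw [← measure_inter_add_sdiff B hsrc]
    refine add_le_add ?_ ?_
    · rw [← X.chartVol_inter_source y (hB.inter hsrc)]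
      rw [X.chartVol_eq y x ((hB.inter hsrc).inter (isOpen_extChartAt_source y).measurableSet)
        Set.inter_subset_right (Set.inter_subset_left.trans Set.inter_subset_right)]
      exact measure_mono (Set.inter_subset_left.trans Set.inter_subset_left)
    · refine le_of_le_of_eq ?_ (Measure.restrict_apply hB).symm
      exact Measure.le_iff'.1 le_top _
  refine (Measure.le_iff'.1 hν A).trans_eq ?_
  rw [Measure.add_apply, Measure.restrict_apply hA, (Set.disjoint_compl_right_iff_subset.2 hx).inter_eq,
    measure_empty, add_zero]

theorem finiteAtFilter_vol (x : X.M) : X.vol.FiniteAtFilter (𝓝 x) := by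
  set φ := extChartAt X.I x
  let d : X.E → ℝ≥0∞ := fun z => ENNReal.ofReal (Real.sqrt (LocalMetric.gram
    (Module.finBasis ℝ X.E) (X.coordMetric x z)).det)
  have hd : ContinuousAt d (φ x) :=
    (LocalMetric.continuous_det_gram _).continuousAt.comp
      (X.contDiffAt_coordMetric (mem_extChartAt_target x)).continuousAt
  obtain ⟨r, hr, hball⟩ := Metric.eventually_nhds_iff_ball.1
    (hd.eventually (gt_mem_nhds (ENNReal.lt_add_right ENNReal.ofReal_ne_top one_ne_zero)))
  have hsm : MeasurableSet (φ.source ∩ φ ⁻¹' Metric.ball (φ x) r) :=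
    ((continuousOn_extChartAt x).isOpen_inter_preimage (isOpen_extChartAt_source x)
      Metric.isOpen_ball).measurableSet
  refine ⟨φ.source ∩ φ ⁻¹' Metric.ball (φ x) r, inter_mem (extChartAt_source_mem_nhds x)
    ((continuousAt_extChartAt x).preimage_mem_nhds (Metric.ball_mem_nhds _ hr)), ?_⟩
  rw [X.vol_apply_of_subset_source x hsm Set.inter_subset_left, X.chartVol_apply x hsm]
  have hsub : φ.target ∩ φ.symm ⁻¹' (φ.source ∩ φ ⁻¹' Metric.ball (φ x) r) ⊆
      Metric.ball (φ x) r := by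
    rintro z ⟨h1, h2, h3⟩
    have : φ (φ.symm z) ∈ Metric.ball (φ x) r := h3
    rwa [φ.right_inv h1] at this
  refine (measure_mono hsub).trans_lt ?_
  unfold coordMeasure LocalMetric.formMeasure
  rw [withDensity_apply _ measurableSet_ball]
  refine (setLIntegral_mono' measurableSet_ball fun z hz => (hball z hz).le).trans_lt ?_
  rw [setLIntegral_const]
  exact ENNReal.mul_lt_top (by simp [d]) measure_ball_lt_top

theorem vol_lt_top_of_isCompact {K : Set X.M} (hK : IsCompact K) : X.vol K < ⊤ :=
  hK.measure_lt_top_of_nhdsWithin fun x _ => (X.finiteAtFilter_vol x).filter_mono nhdsWithin_le_nhds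

theorem chartVol_rescale (a : ℝ) (ha : 0 < a) (x : X.M) :
    (X.rescale a ha).chartVol x = ENNReal.ofReal (a ^ X.dim) • X.chartVol x := by
  have h := LocalMetric.formMeasure_smul (Module.finBasis ℝ X.E) (X.coordMetric x) ha
  rw [Fintype.card_fin] at h
  change ((LocalMetric.formMeasure (Module.finBasis ℝ X.E) (fun z => a ^ 2 • X.coordMetric x z)).restrict
    (extChartAt X.I x).target).map (extChartAt X.I x).symm = ENNReal.ofReal (a ^ X.dim) •
    ((LocalMetric.formMeasure (Module.finBasis ℝ X.E) (X.coordMetric x)).restrict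
    (extChartAt X.I x).target).map (extChartAt X.I x).symm
  rw [h, Measure.restrict_smul, Measure.map_smul]
  rfl

theorem vol_rescale_le (a : ℝ) (ha : 0 < a) (A : Set X.M) :
    (X.rescale a ha).vol A ≤ ENNReal.ofReal (a ^ X.dim) * X.vol A := by
  have : (X.rescale a ha).vol ≤ ENNReal.ofReal (a ^ X.dim) • X.vol := by
    refine iSup_le fun x => ?_
    refine (X.chartVol_rescale a ha x).trans_le ?_
    exact Measure.le_iff'.2 fun B => mul_le_mul_right (Measure.le_iff'.1 (le_iSup X.chartVol x) B) _
  exact Measure.le_iff'.1 this A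

theorem extChartAt_prod_eq (p : X.M × Y.M) :
    extChartAt (X.prod Y).I (show (X.prod Y).M from p) =
      (extChartAt X.I p.1).prod (extChartAt Y.I p.2) :=
  extChartAt_prod p

theorem vol_prod_of_subset_source (p : X.M × Y.M) {A : Set X.M} {B : Set Y.M}
    (hA : MeasurableSet A) (hB : MeasurableSet B) (hAs : A ⊆ (extChartAt X.I p.1).source)
    (hBs : B ⊆ (extChartAt Y.I p.2).source) :
    (X.prod Y).vol (A ×ˢ B) = X.vol A * Y.vol B := by
  have hm : @MeasurableSet (X.prod Y).M _ (A ×ˢ B) := by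
    have h : borel (X.M × Y.M) = Prod.instMeasurableSpace :=
      (Prod.borelSpace (α := X.M) (β := Y.M)).measurable_eq.symm
    change @MeasurableSet (X.M × Y.M) (borel (X.M × Y.M)) (A ×ˢ B)
    rw [h]
    exact hA.prod hB
  have hs : A ×ˢ B ⊆ (extChartAt (X.prod Y).I (show (X.prod Y).M from p)).source := by
    rw [extChartAt_prod_eq]
    exact Set.prod_mono hAs hBs
  rw [X.vol_apply_of_subset_source _ hA hAs, Y.vol_apply_of_subset_source _ hB hBs,
    (X.prod Y).vol_apply_of_subset_source (show (X.prod Y).M from p) hm hs,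
    X.chartVol_apply _ hA, Y.chartVol_apply _ hB,
    (X.prod Y).chartVol_apply (show (X.prod Y).M from p) hm]
  have hset : (extChartAt (X.prod Y).I (show (X.prod Y).M from p)).target ∩
      (extChartAt (X.prod Y).I (show (X.prod Y).M from p)).symm ⁻¹' (A ×ˢ B) =
      ((extChartAt X.I p.1).target ∩ (extChartAt X.I p.1).symm ⁻¹' A) ×ˢ
      ((extChartAt Y.I p.2).target ∩ (extChartAt Y.I p.2).symm ⁻¹' B) := by
    rw [extChartAt_prod_eq]
    ext z
    constructor
    · exact fun h => ⟨⟨h.1.1, h.2.1⟩, h.1.2, h.2.2⟩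
    · exact fun h => ⟨⟨h.1.1, h.2.1⟩, h.1.2, h.2.2⟩
  rw [hset]
  have hb : @BorelSpace (X.E × Y.E) _ (borel (X.E × Y.E)) := @BorelSpace.mk _ _ (borel _) rfl
  exact LocalMetric.formMeasure_prod (m := borel (X.E × Y.E)) (hm := hb)
    (Module.finBasis ℝ (X.E × Y.E)) (X.measurableSet_coord _ hA)
    (Y.measurableSet_coord _ hB) ((X.continuousOn_coordMetric _).mono Set.inter_subset_left)
    ((Y.continuousOn_coordMetric _).mono Set.inter_subset_left)
    (fun z hz => X.isInner_coordMetric hz.1)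
    (fun z hz => X.coordMetric_prod Y p hz.1.1 hz.2.1)

theorem exists_countable_chart_cover : ∃ s : Set X.M, s.Countable ∧
    ⋃ x ∈ s, (extChartAt X.I x).source = Set.univ :=
  TopologicalSpace.countable_cover_nhds fun x => extChartAt_source_mem_nhds x

/-- A measurable set is a disjoint union of measurable pieces of chart domains. -/
theorem exists_chart_partition [Nonempty X.M] {A : Set X.M} (hA : MeasurableSet A) :
    ∃ (x : ℕ → X.M) (P : ℕ → Set X.M), (∀ n, MeasurableSet (P n)) ∧
      (∀ n, P n ⊆ (extChartAt X.I (x n)).source) ∧ Pairwise (Function.onFun Disjoint P) ∧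
      ⋃ n, P n = A := by
  obtain ⟨s, hs, hU⟩ := X.exists_countable_chart_cover
  have hne : s.Nonempty := by
    by_contra h
    rw [Set.not_nonempty_iff_eq_empty] at h
    subst h
    simp at hU
    exact (Set.univ_nonempty (α := X.M)).ne_empty hU.symm
  obtain ⟨x, rfl⟩ := hs.exists_eq_range hne
  have hm : ∀ n, MeasurableSet (A ∩ (extChartAt X.I (x n)).source) := fun n =>
    hA.inter (isOpen_extChartAt_source _).measurableSet
  refine ⟨x, disjointed fun n => A ∩ (extChartAt X.I (x n)).source,
    fun n => MeasurableSet.disjointed hm n,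
    fun n => (disjointed_subset _ n).trans Set.inter_subset_right, disjoint_disjointed _, ?_⟩
  rw [iUnion_disjointed, ← Set.inter_iUnion]
  rw [Set.biUnion_range] at hU
  rw [hU, Set.inter_univ]

/-- The measure of a rectangle in a Riemannian product is at most the product of the measures. This
one-sided bound is all that the energy estimates need, and it holds without `σ`-finiteness. -/
theorem vol_prod_le (A : Set X.M) (B : Set Y.M) :
    (X.prod Y).vol (A ×ˢ B) ≤ X.vol A * Y.vol B := by
  rcases isEmpty_or_nonempty X.M with h | h
  · have : A = ∅ := Set.eq_empty_of_isEmpty A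
    subst this
    rw [Set.empty_prod]
    exact measure_empty.trans_le bot_le
  rcases isEmpty_or_nonempty Y.M with h | h
  · have : B = ∅ := Set.eq_empty_of_isEmpty B
    subst this
    rw [Set.prod_empty]
    exact measure_empty.trans_le bot_le
  rw [← measure_toMeasurable A, ← measure_toMeasurable B]
  refine (measure_mono (Set.prod_mono (subset_toMeasurable X.vol A)
    (subset_toMeasurable Y.vol B))).trans ?_
  obtain ⟨x, P, hP, hPs, hPd, hPU⟩ := X.exists_chart_partition (measurableSet_toMeasurable X.vol A)
  obtain ⟨y, Q, hQ, hQs, hQd, hQU⟩ := Y.exists_chart_partition (measurableSet_toMeasurable Y.vol B)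
  rw [← hPU, ← hQU, measure_iUnion hPd hP, measure_iUnion hQd hQ, ← ENNReal.tsum_mul_right]
  have hsub : (⋃ n, P n) ×ˢ (⋃ n, Q n) = ⋃ n, ⋃ m, P n ×ˢ Q m := by
    rw [Set.iUnion_prod_const]
    simp_rw [Set.prod_iUnion]
  rw [hsub]
  refine (measure_iUnion_le _).trans (ENNReal.tsum_le_tsum fun n => ?_)
  rw [← ENNReal.tsum_mul_left]
  refine (measure_iUnion_le _).trans (ENNReal.tsum_le_tsum fun m => ?_)
  exact (X.vol_prod_of_subset_source Y (x n, y m) (hP n) (hQ m) (hPs n) (hQs m)).le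

end RiemMfd

/-! ### Conformally flat metrics -/

namespace LocalMetric

section conformal

variable {E : Type} [NormedAddCommGroup E] [InnerProductSpace ℝ E] [FiniteDimensional ℝ E]

variable (E) in
/-- The inner product as a bilinear form. -/
def stdForm : E →L[ℝ] E →L[ℝ] ℝ := innerSL ℝ

@[simp] theorem stdForm_apply (v w : E) : stdForm E v w = inner ℝ v w := rfl

theorem isInner_smul_stdForm {c : ℝ} (hc : 0 < c) : IsInner (c • stdForm E) := by
  refine ⟨fun v w => ?_, fun v hv => ?_⟩
  · simp [real_inner_comm]
  · have : 0 < inner ℝ v v := real_inner_self_pos.2 hv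
    simp only [smul_apply, stdForm_apply, smul_eq_mul]
    positivity

theorem hasFDerivAt_norm_sq (w : E) :
    HasFDerivAt (fun w : E => ‖w‖ ^ 2) ((2 : ℝ) • stdForm E w) w := by
  refine (hasStrictFDerivAt_norm_sq w).hasFDerivAt.congr_fderiv ?_
  ext v
  rw [two_smul, two_smul]
  rfl

variable {G : E → E →L[ℝ] E →L[ℝ] ℝ} {l : E → ℝ} {A : E → E} {z : E}

/-- The Levi-Civita connection of the metric `l ⟨·, ·⟩`, where `A = ∇ l / (2 l)`. -/
theorem christoffel_conformal (hG : G =ᶠ[𝓝 z] fun y => l y • stdForm E) (hl : 0 < l z)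
    (hA : HasFDerivAt l ((2 * l z) • stdForm E (A z)) z) (u v : E) :
    christoffel G z u v = inner ℝ (A z) u • v + inner ℝ (A z) v • u - inner ℝ u v • A z := by
  have hGz : G z = l z • stdForm E := hG.self_of_nhds
  have hi : IsInner (G z) := hGz ▸ isInner_smul_stdForm hl
  have hd : fderiv ℝ G z = ((2 * l z) • stdForm E (A z)).smulRight (stdForm E) := by
    rw [hG.fderiv_eq]
    exact (hA.smul_const (stdForm E)).fderiv
  refine christoffel_eq hi fun w => ?_
  rw [hd, hGz]
  simp only [smulRight_apply, smul_apply, stdForm_apply, smul_eq_mul, map_sub, map_add, map_smul,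
    sub_apply, add_apply]
  ring

/-- A conformally flat metric whose conformal field satisfies `DA = β + A ⊗ A` has constant sectional
curvature at the point. -/
theorem hasCurvatureAt_conformal {β : ℝ} (hG : G =ᶠ[𝓝 z] fun y => l y • stdForm E)
    (hA : ∀ᶠ y in 𝓝 z, 0 < l y ∧ HasFDerivAt l ((2 * l y) • stdForm E (A y)) y)
    (hA' : HasFDerivAt A (β • ContinuousLinearMap.id ℝ E + (stdForm E (A z)).smulRight (A z)) z) :
    HasCurvatureAt G z (-(2 * β + ‖A z‖ ^ 2) / l z) := by
  have hl := hA.self_of_nhds.1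
  have hGz : G z = l z • stdForm E := hG.self_of_nhds
  have hΓ : ∀ᶠ y in 𝓝 z, ∀ u v, christoffel G y u v =
      inner ℝ (A y) u • v + inner ℝ (A y) v • u - inner ℝ u v • A y := by
    filter_upwards [hA, hG.eventually_nhds] with y hy hy' u v
    exact christoffel_conformal hy' hy.1 hy.2 u v
  have hdΓ : ∀ u v w, fderiv ℝ (fun y => christoffel G y v w) z u =
      inner ℝ (β • u + inner ℝ (A z) u • A z) v • w + inner ℝ (β • u + inner ℝ (A z) u • A z) w • v
        - inner ℝ v w • (β • u + inner ℝ (A z) u • A z) := by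
    intro u v w
    have h1 : (fun y => christoffel G y v w) =ᶠ[𝓝 z] fun y =>
        stdForm E v (A y) • w + stdForm E w (A y) • v - inner ℝ v w • A y := by
      filter_upwards [hΓ] with y hy
      rw [hy, stdForm_apply, stdForm_apply, real_inner_comm v, real_inner_comm w]
    rw [h1.fderiv_eq]
    have hv := ((stdForm E v).hasFDerivAt.comp z hA').smul_const w
    have hw := ((stdForm E w).hasFDerivAt.comp z hA').smul_const v
    have h2 := (hv.add hw).sub (hA'.const_smul (inner ℝ v w))
    refine (DFunLike.congr_fun h2.fderiv u).trans ?_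
    simp only [sub_apply, add_apply, smulRight_apply, comp_apply, smul_apply, stdForm_apply,
      ContinuousLinearMap.id_apply]
    rw [real_inner_comm v (β • u + _), real_inner_comm w (β • u + _)]
  intro u v w
  have hz := hΓ.self_of_nhds
  unfold riemann
  rw [hdΓ, hdΓ, hz v w, hz u w, hz u, hz v, hGz]
  simp only [smul_apply, stdForm_apply, smul_eq_mul, inner_add_right, inner_sub_right,
    inner_add_left, inner_smul_left, inner_smul_right, real_inner_self_eq_norm_sq, conj_trivial]
  rw [real_inner_comm (A z) u, real_inner_comm (A z) v, real_inner_comm u v]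
  have hl' := hl.ne'
  match_scalars <;> field_simp <;> ring

end conformal

end LocalMetric

/-! ### Round spheres -/

namespace RiemMfd

section sphere

variable (n : ℕ)

local notation "V" => EuclideanSpace ℝ (Fin n)
local notation "W" => EuclideanSpace ℝ (Fin (n + 1))

/-- The conformal factor of the round metric in stereographic coordinates. -/
def stereoFactor (w : V) : ℝ := 16 / (‖w‖ ^ 2 + 4) ^ 2

theorem stereoFactor_pos (w : V) : 0 < stereoFactor n w := by
  unfold stereoFactor
  positivity

theorem sphere_target (x : Metric.sphere (0 : W) 1) : (extChartAt (𝓡 n) x).target = Set.univ := by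
  have := Fact.mk (@finrank_euclideanSpace_fin ℝ _ (n + 1))
  rw [extChartAt_target]
  change _ ∩ Set.range (id : V → V) = _
  change id ⁻¹' (stereographic' n (-x)).target ∩ _ = _
  rw [stereographic'_target]
  simp

theorem sphere_extChartAt_self (x : Metric.sphere (0 : W) 1) : extChartAt (𝓡 n) x x = 0 := by
  have := Fact.mk (@finrank_euclideanSpace_fin ℝ _ (n + 1))
  change stereographic' n (-x) x = 0
  have h := stereographic_apply_neg (-x)
  rw [neg_neg] at h
  simp only [stereographic', OpenPartialHomeomorph.coe_trans, Function.comp_apply]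
  rw [h]
  exact map_zero (OrthonormalBasis.fromOrthogonalSpanSingleton (𝕜 := ℝ) n
    (ne_zero_of_mem_unit_sphere (-x))).repr

/-- The inverse of the preferred chart at `x` is the inverse of the stereographic projection from `-x`
to the hyperplane orthogonal to `x`. -/
theorem exists_sphere_chart_eq (x : Metric.sphere (0 : W) 1) :
    ∃ L : V →ₗᵢ[ℝ] W, (∀ w, inner ℝ (L w) (x : W) = 0) ∧
      ∀ w : V, (((extChartAt (𝓡 n) x).symm w : Metric.sphere (0 : W) 1) : W) =
        (‖w‖ ^ 2 + 4)⁻¹ • ((4 : ℝ) • L w - (‖w‖ ^ 2 - 4) • (x : W)) := by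
  have := Fact.mk (@finrank_euclideanSpace_fin ℝ _ (n + 1))
  let U := (OrthonormalBasis.fromOrthogonalSpanSingleton (𝕜 := ℝ) n
    (ne_zero_of_mem_unit_sphere (-x))).repr
  let L : V →ₗᵢ[ℝ] W := (Submodule.subtypeₗᵢ _).comp U.symm.toLinearIsometry
  refine ⟨L, fun w => ?_, fun w => ?_⟩
  · have h := (U.symm w).2
    rw [Submodule.mem_orthogonal_singleton_iff_inner_left] at h
    have h' : inner ℝ (L w) (-(x : W)) = 0 := h
    rwa [inner_neg_right, neg_eq_zero] at h'
  · have h := stereographic'_symm_apply (n := n) (-x) w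
    have hn : ‖L w‖ = ‖w‖ := L.norm_map w
    change (((stereographic' n (-x)).symm w : Metric.sphere (0 : W) 1) : W) = _
    rw [h]
    change (‖L w‖ ^ 2 + 4)⁻¹ • (4 : ℝ) • L w + (‖L w‖ ^ 2 + 4)⁻¹ • (‖L w‖ ^ 2 - 4) • (-(x : W)) = _
    rw [hn]
    module

/-- The differential of the inverse of a preferred chart, computed in the ambient space. -/
theorem mfderiv_coe_mfderiv_sphere_symm (x : Metric.sphere (0 : W) 1) {L : V →ₗᵢ[ℝ] W}
    (hL : ∀ w : V, (((extChartAt (𝓡 n) x).symm w : Metric.sphere (0 : W) 1) : W) =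
      (‖w‖ ^ 2 + 4)⁻¹ • ((4 : ℝ) • L w - (‖w‖ ^ 2 - 4) • (x : W))) (w u : V) :
    mfderiv (𝓡 n) 𝓘(ℝ, W) (Subtype.val : Metric.sphere (0 : W) 1 → W) ((extChartAt (𝓡 n) x).symm w)
      (mfderiv 𝓘(ℝ, V) (𝓡 n) (extChartAt (𝓡 n) x).symm w u) =
      (4 / (‖w‖ ^ 2 + 4)) • L u + (-(8 * inner ℝ w u / (‖w‖ ^ 2 + 4) ^ 2)) • L w +
      (16 * inner ℝ w u / (‖w‖ ^ 2 + 4) ^ 2) • (-(x : W)) := by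
  have := Fact.mk (@finrank_euclideanSpace_fin ℝ _ (n + 1))
  have hw : w ∈ (extChartAt (𝓡 n) x).target := by rw [sphere_target]; trivial
  have h1 : MDifferentiableAt 𝓘(ℝ, V) (𝓡 n) (extChartAt (𝓡 n) x).symm w :=
    (contMDiffAt_extChartAt_symm hw).mdifferentiableAt (by simp)
  have h2 : MDifferentiableAt (𝓡 n) 𝓘(ℝ, W) (Subtype.val : Metric.sphere (0 : W) 1 → W)
      ((extChartAt (𝓡 n) x).symm w) :=
    (contMDiff_coe_sphere (n := n) (m := ∞) _).mdifferentiableAt (by simp)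
  set ρ := ‖w‖ ^ 2 + 4 with hρ
  have hρ0 : ρ ≠ 0 := by positivity
  let D : V →L[ℝ] W := ρ⁻¹ • ((4 : ℝ) • L.toContinuousLinearMap -
      ((2 : ℝ) • LocalMetric.stdForm V w).smulRight (x : W)) +
      (-(ρ ^ 2)⁻¹ • (2 : ℝ) • LocalMetric.stdForm V w).smulRight
        ((4 : ℝ) • L w - (‖w‖ ^ 2 - 4) • (x : W))
  have h3 : HasFDerivAt (fun w : V => (‖w‖ ^ 2 + 4)⁻¹ • ((4 : ℝ) • L w - (‖w‖ ^ 2 - 4) • (x : W)))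
      D w := by
    have hn : HasFDerivAt (fun w : V => ‖w‖ ^ 2) ((2 : ℝ) • LocalMetric.stdForm V w) w :=
      LocalMetric.hasFDerivAt_norm_sq w
    have ha := (hasDerivAt_inv hρ0).comp_hasFDerivAt w (hn.add_const 4)
    have hb := (L.toContinuousLinearMap.hasFDerivAt (x := w)).const_smul (4 : ℝ)
    exact ha.smul (hb.sub ((hn.sub_const 4).smul_const (x : W)))
  have h4 : (mfderiv (𝓡 n) 𝓘(ℝ, W) (Subtype.val : Metric.sphere (0 : W) 1 → W)
      ((extChartAt (𝓡 n) x).symm w)).comp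
      (mfderiv 𝓘(ℝ, V) (𝓡 n) (extChartAt (𝓡 n) x).symm w) = D := by
    rw [← mfderiv_comp w h2 h1, mfderiv_eq_fderiv]
    have : (Subtype.val : Metric.sphere (0 : W) 1 → W) ∘ (extChartAt (𝓡 n) x).symm =
      fun w : V => (‖w‖ ^ 2 + 4)⁻¹ • ((4 : ℝ) • L w - (‖w‖ ^ 2 - 4) • (x : W)) := funext hL
    rw [this]
    exact h3.fderiv
  have hD : D u = (4 / ρ) • L u + (-(8 * inner ℝ w u / ρ ^ 2)) • L w +
      (16 * inner ℝ w u / ρ ^ 2) • (-(x : W)) := by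
    simp only [D, add_apply, smul_apply, sub_apply, smulRight_apply, LocalMetric.stdForm_apply,
      LinearIsometry.coe_toContinuousLinearMap, smul_eq_mul]
    have : ‖w‖ ^ 2 = ρ - 4 := by rw [hρ]; ring
    rw [this]
    match_scalars <;> field_simp <;> ring
  exact (DFunLike.congr_fun h4 u).trans hD

/-- The round metric in stereographic coordinates, `16 |dw|² / (|w|² + 4)²`. -/
theorem coordMetric_sphere (x : Metric.sphere (0 : W) 1) (w : V) :
    (roundSphere n).coordMetric x w = stereoFactor n w • LocalMetric.stdForm V := by
  have := Fact.mk (@finrank_euclideanSpace_fin ℝ _ (n + 1))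
  obtain ⟨L, hLx, hL⟩ := exists_sphere_chart_eq n x
  have hD := mfderiv_coe_mfderiv_sphere_symm n x hL w
  set ρ := ‖w‖ ^ 2 + 4 with hρ
  have hρ0 : ρ ≠ 0 := by positivity
  refine ContinuousLinearMap.ext fun (u : V) => ContinuousLinearMap.ext fun (v : V) => ?_
  have h5 : (roundSphere n).coordMetric x w u v =
      inner ℝ ((4 / ρ) • L u + (-(8 * inner ℝ w u / ρ ^ 2)) • L w +
        (16 * inner ℝ w u / ρ ^ 2) • (-(x : W)))
        ((4 / ρ) • L v + (-(8 * inner ℝ w v / ρ ^ 2)) • L w +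
        (16 * inner ℝ w v / ρ ^ 2) • (-(x : W))) := by
    exact congrArg₂ (inner ℝ : W → W → ℝ) (hD u) (hD v)
  refine h5.trans (Eq.trans ?_ (rfl : stereoFactor n w * inner ℝ u v = _))
  have hx : inner ℝ (x : W) (x : W) = 1 := by
    rw [real_inner_self_eq_norm_sq, norm_eq_of_mem_sphere]
    norm_num
  have hxL : ∀ w, inner ℝ (x : W) (L w) = 0 := fun w => by rw [real_inner_comm, hLx]
  simp only [inner_add_left, inner_add_right, inner_smul_left, inner_smul_right, inner_neg_left,
    inner_neg_right, L.inner_map_map, hLx, hxL, hx, conj_trivial,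
    real_inner_self_eq_norm_sq]
  have : ‖w‖ ^ 2 = ρ - 4 := by rw [hρ]; ring
  unfold stereoFactor
  rw [this, sub_add_cancel, real_inner_comm u w]
  field_simp
  ring

theorem hasFDerivAt_stereoFactor (w : V) :
    HasFDerivAt (stereoFactor n)
      ((2 * stereoFactor n w) • LocalMetric.stdForm V (-(2 / (‖w‖ ^ 2 + 4)) • w)) w := by
  have hn : HasFDerivAt (fun w : V => ‖w‖ ^ 2) ((2 : ℝ) • LocalMetric.stdForm V w) w :=
    LocalMetric.hasFDerivAt_norm_sq w
  have hd : HasDerivAt (fun s : ℝ => 16 / (s + 4) ^ 2) (-32 / (‖w‖ ^ 2 + 4) ^ 3) (‖w‖ ^ 2) := by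
    have h0 : ‖w‖ ^ 2 + 4 ≠ 0 := by positivity
    have h1 := (((hasDerivAt_id (‖w‖ ^ 2)).add_const 4).pow 2).fun_inv (pow_ne_zero 2 h0)
    have h2 := h1.const_mul 16
    refine h2.congr_deriv ?_
    simp only [id]
    field_simp
    norm_num
    ring
  have := hd.comp_hasFDerivAt w hn
  refine this.congr_fderiv ?_
  ext u
  have h0 : ‖w‖ ^ 2 + 4 ≠ 0 := by positivity
  simp only [smul_apply, LocalMetric.stdForm_apply, smul_eq_mul, inner_smul_left, conj_trivial,
    stereoFactor]
  field_simp
  ring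

theorem hasCurvatureAt_sphere (x : Metric.sphere (0 : W) 1) (w : V) :
    LocalMetric.HasCurvatureAt (E := V) ((roundSphere n).coordMetric x) w 1 := by
  have h0 : ‖w‖ ^ 2 + 4 ≠ 0 := by positivity
  have hn : HasFDerivAt (fun w : V => ‖w‖ ^ 2) ((2 : ℝ) • LocalMetric.stdForm V w) w :=
    LocalMetric.hasFDerivAt_norm_sq w
  have key := LocalMetric.hasCurvatureAt_conformal (E := V) (l := stereoFactor n) (z := w)
    (G := (roundSphere n).coordMetric x) (A := fun w => -(2 / (‖w‖ ^ 2 + 4)) • w)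
    (β := -(2 / (‖w‖ ^ 2 + 4)))
    (Eventually.of_forall (coordMetric_sphere n x))
    (Eventually.of_forall fun y => ⟨stereoFactor_pos n y, hasFDerivAt_stereoFactor n y⟩) ?_
  · convert key using 1
    unfold stereoFactor
    rw [norm_smul, Real.norm_eq_abs, mul_pow, sq_abs]
    field_simp
    ring
  · have hd : HasDerivAt (fun s : ℝ => -(2 / (s + 4))) (2 / (‖w‖ ^ 2 + 4) ^ 2) (‖w‖ ^ 2) := by
      have h1 := ((hasDerivAt_id (‖w‖ ^ 2)).add_const 4).fun_inv h0
      have h2 := (h1.const_mul 2).neg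
      refine h2.congr_deriv ?_
      simp only [id]
      field_simp
    have h3 := (hd.comp_hasFDerivAt w hn).smul (hasFDerivAt_id w)
    refine h3.congr_fderiv ?_
    ext1 u
    simp only [add_apply, smul_apply, smulRight_apply, LocalMetric.stdForm_apply, smul_eq_mul,
      inner_smul_left, conj_trivial, ContinuousLinearMap.id_apply, Function.comp_apply, id]
    match_scalars <;> field_simp

theorem isComplete_roundSphere : (roundSphere n).IsComplete := by
  have : CompactSpace (roundSphere n).M :=
    inferInstanceAs (CompactSpace (Metric.sphere (0 : W) 1))
  exact isComplete_of_compactSpace _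

theorem vol_roundSphere_lt_top (A : Set (roundSphere n).M) : (roundSphere n).vol A < ⊤ := by
  have : CompactSpace (roundSphere n).M :=
    inferInstanceAs (CompactSpace (Metric.sphere (0 : W) 1))
  exact (measure_mono (Set.subset_univ A)).trans_lt ((roundSphere n).vol_lt_top_of_isCompact isCompact_univ)

theorem connectedSpace_roundSphere (hn : 1 ≤ n) : ConnectedSpace (roundSphere n).M := by
  refine isConnected_iff_connectedSpace.1 (isConnected_sphere ?_ (0 : W) zero_le_one)
  rw [← Module.finrank_eq_rank, finrank_euclideanSpace_fin]
  exact_mod_cast Nat.lt_add_of_pos_left hn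

theorem dim_roundSphere : (roundSphere n).dim = n := finrank_euclideanSpace_fin

end sphere

end RiemMfd

/-! ### The Taub-NUT metric -/

theorem fderiv_apply_eq_of_hasDerivAt {E F : Type} [NormedAddCommGroup E] [NormedSpace ℝ E]
    [NormedAddCommGroup F] [NormedSpace ℝ F] {f : E → F} {z u : E} {d : F}
    (hf : DifferentiableAt ℝ f z) (hd : HasDerivAt (fun t : ℝ => f (z + t • u)) d 0) :
    fderiv ℝ f z u = d := by
  have h : HasDerivAt (fun t : ℝ => z + t • u) u 0 := by
    simpa using ((hasDerivAt_id (0 : ℝ)).smul_const u).const_add z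
  have hf' : HasFDerivAt f (fderiv ℝ f z) (z + (0 : ℝ) • u) := by
    simpa using hf.hasFDerivAt
  exact (hf'.comp_hasDerivAt 0 h).unique hd

namespace LocalMetric

section taubNUT

variable {E : Type} [NormedAddCommGroup E] [InnerProductSpace ℝ E] [FiniteDimensional ℝ E]

/-- The Taub-NUT metric `f ⟨·, ·⟩ - (1 + 1 / f) α ⊗ α` with `f = 1 + |z|²` and `α = ⟨J z, ·⟩`. -/
def taubNUT (J : E →L[ℝ] E) (z : E) : E →L[ℝ] E →L[ℝ] ℝ :=
  (1 + ‖z‖ ^ 2) • stdForm E -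
    (1 + (1 + ‖z‖ ^ 2)⁻¹) • (stdForm E (J z)).smulRight (stdForm E (J z))

variable (J : E →L[ℝ] E)

theorem taubNUT_apply (z v w : E) : taubNUT J z v w = (1 + ‖z‖ ^ 2) * inner ℝ v w -
    (1 + (1 + ‖z‖ ^ 2)⁻¹) * (inner ℝ (J z) v * inner ℝ (J z) w) := rfl

theorem contDiff_taubNUT : ContDiff ℝ ∞ (taubNUT J) := by
  have h1 : ContDiff ℝ ∞ fun z : E => 1 + ‖z‖ ^ 2 := contDiff_const.add (contDiff_norm_sq ℝ)
  have h2 : ContDiff ℝ ∞ fun z : E => stdForm E (J z) :=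
    (stdForm E).contDiff.comp J.contDiff
  have h3 : ContDiff ℝ ∞ fun z : E => (1 + ‖z‖ ^ 2)⁻¹ := h1.inv fun z => by positivity
  exact (h1.smul contDiff_const).sub ((contDiff_const.add h3).smul (h2.smulRight h2))

variable {J} (hJ : ∀ u v, inner ℝ (J u) v = -inner ℝ u (J v)) (hJJ : ∀ u, J (J u) = -u)

include hJ in
theorem inner_J_self (z : E) : inner ℝ (J z) z = 0 := by
  have := hJ z z
  rw [real_inner_comm (J z) z] at this
  linarith [real_inner_comm (J z) z]

include hJ hJJ in
theorem norm_J_sq (z : E) : inner ℝ (J z) (J z) = ‖z‖ ^ 2 := by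
  rw [hJ, hJJ, inner_neg_right, neg_neg, real_inner_self_eq_norm_sq]

include hJ hJJ in
/-- Bessel's inequality for the orthogonal vectors `z` and `J z`. -/
theorem bessel_J (z v : E) :
    inner ℝ z v ^ 2 + inner ℝ (J z) v ^ 2 ≤ ‖z‖ ^ 2 * ‖v‖ ^ 2 := by
  rcases eq_or_ne z 0 with rfl | hz
  · simp
  have hs : 0 < ‖z‖ ^ 2 := by positivity
  have h : 0 ≤ inner ℝ (‖z‖ ^ 2 • v - inner ℝ z v • z - inner ℝ (J z) v • J z)
      (‖z‖ ^ 2 • v - inner ℝ z v • z - inner ℝ (J z) v • J z) := real_inner_self_nonneg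
  have h0 := inner_J_self hJ z
  have h0' : inner ℝ z (J z) = 0 := by rw [real_inner_comm, h0]
  have hn := norm_J_sq hJ hJJ z
  simp only [inner_sub_left, inner_sub_right, inner_smul_left, inner_smul_right, conj_trivial,
    h0, h0', hn, real_inner_self_eq_norm_sq] at h
  rw [real_inner_comm z v, real_inner_comm (J z) v] at h
  have : 0 ≤ ‖z‖ ^ 2 * (‖z‖ ^ 2 * ‖v‖ ^ 2 - (inner ℝ z v ^ 2 + inner ℝ (J z) v ^ 2)) := by
    linarith
  nlinarith [nonneg_of_mul_nonneg_right this hs]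

include hJ hJJ in
/-- A lower bound of the metric, which shows that it is positive definite and that `√(1 + |z|²)` is
`1`-Lipschitz. -/
theorem taubNUT_ge (z v : E) :
    inner ℝ z v ^ 2 + (1 + ‖z‖ ^ 2)⁻¹ * ‖v‖ ^ 2 ≤ taubNUT J z v v := by
  rw [taubNUT_apply, real_inner_self_eq_norm_sq]
  have hb := bessel_J hJ hJJ z v
  set s := ‖z‖ ^ 2
  have hs : 0 ≤ s := by positivity
  have hp : (1 + s)⁻¹ * (1 + s) = 1 := inv_mul_cancel₀ (by positivity)
  have hp0 : 0 ≤ (1 + s)⁻¹ := by positivity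
  nlinarith [mul_le_mul_of_nonneg_left hb hp0]

include hJ hJJ in
theorem isInner_taubNUT (z : E) : IsInner (taubNUT J z) := by
  refine ⟨fun v w => ?_, fun v hv => ?_⟩
  · rw [taubNUT_apply, taubNUT_apply, real_inner_comm]
    ring
  · refine lt_of_lt_of_le ?_ (taubNUT_ge hJ hJJ z v)
    positivity

include hJ hJJ in
theorem isMetricAt_taubNUT (z : E) : IsMetricAt (taubNUT J) z :=
  Eventually.of_forall fun y => ⟨(contDiff_taubNUT J).contDiffAt, isInner_taubNUT hJ hJJ y⟩

section derivatives

variable (J) (z u v : E)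

theorem hasDerivAt_line : HasDerivAt (fun t : ℝ => z + t • u) u 0 := by
  simpa using ((hasDerivAt_id (0 : ℝ)).smul_const u).const_add z

theorem hasDerivAt_J_line : HasDerivAt (fun t : ℝ => J (z + t • u)) (J u) 0 :=
  J.hasFDerivAt.comp_hasDerivAt 0 (hasDerivAt_line z u)

theorem hasDerivAt_inner_line : HasDerivAt (fun t : ℝ => inner ℝ (z + t • u) v) (inner ℝ u v) 0 := by
  simpa using (hasDerivAt_line z u).inner ℝ (hasDerivAt_const (0 : ℝ) v)

theorem hasDerivAt_inner_J_line :
    HasDerivAt (fun t : ℝ => inner ℝ (J (z + t • u)) v) (inner ℝ (J u) v) 0 := by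
  simpa using (hasDerivAt_J_line J z u).inner ℝ (hasDerivAt_const (0 : ℝ) v)

theorem hasDerivAt_one_add_norm_sq_line :
    HasDerivAt (fun t : ℝ => 1 + ‖z + t • u‖ ^ 2) (2 * inner ℝ z u) 0 := by
  simpa using (hasDerivAt_line z u).norm_sq.const_add 1

theorem hasDerivAt_inv_line : HasDerivAt (fun t : ℝ => (1 + ‖z + t • u‖ ^ 2)⁻¹)
    (-(2 * (1 + ‖z‖ ^ 2)⁻¹ ^ 2 * inner ℝ z u)) 0 := by
  have h := (hasDerivAt_one_add_norm_sq_line z u).fun_inv (by positivity)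
  refine h.congr_deriv ?_
  simp only [zero_smul, add_zero]
  field_simp

end derivatives

theorem fderiv_taubNUT (z u v w : E) : fderiv ℝ (taubNUT J) z u v w =
    2 * inner ℝ z u * inner ℝ v w +
      2 * (1 + ‖z‖ ^ 2)⁻¹ ^ 2 * inner ℝ z u * (inner ℝ (J z) v * inner ℝ (J z) w) -
      (1 + (1 + ‖z‖ ^ 2)⁻¹) *
        (inner ℝ (J u) v * inner ℝ (J z) w + inner ℝ (J z) v * inner ℝ (J u) w) := by
  have hd : DifferentiableAt ℝ (taubNUT J) z :=
    (contDiff_taubNUT J).contDiffAt.differentiableAt (by simp)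
  have hd2 : DifferentiableAt ℝ (fun y => taubNUT J y v w) z :=
    (hd.clm_apply (differentiableAt_const v)).clm_apply (differentiableAt_const w)
  have h1 : fderiv ℝ (taubNUT J) z u v w = fderiv ℝ (fun y => taubNUT J y v w) z u := by
    have := ((hd.hasFDerivAt.clm_apply (hasFDerivAt_const v z)).clm_apply
      (hasFDerivAt_const w z)).fderiv
    rw [this]
    simp
  rw [h1]
  refine fderiv_apply_eq_of_hasDerivAt hd2 ?_
  have h2 := ((hasDerivAt_one_add_norm_sq_line z u).mul_const (inner ℝ v w)).sub
    (((hasDerivAt_inv_line z u).const_add 1).mul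
      ((hasDerivAt_inner_J_line J z u v).mul (hasDerivAt_inner_J_line J z u w)))
  refine h2.congr_deriv ?_
  simp only [zero_smul, add_zero, Pi.mul_apply]
  ring

include hJ hJJ in
/-- The Levi-Civita connection of the Taub-NUT metric. -/
theorem christoffel_taubNUT (z u v : E) : christoffel (taubNUT J) z u v =
    (1 + ‖z‖ ^ 2)⁻¹ • (inner ℝ z u • v + inner ℝ z v • u - inner ℝ u v • z) -
      ((1 + ‖z‖ ^ 2)⁻¹ ^ 2 * (inner ℝ z u * inner ℝ (J z) v + inner ℝ z v * inner ℝ (J z) u)) •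
        J z -
      ((1 + ‖z‖ ^ 2)⁻¹ ^ 3 * (inner ℝ (J z) u * inner ℝ (J z) v)) • z -
      ((1 + ‖z‖ ^ 2)⁻¹ + (1 + ‖z‖ ^ 2)⁻¹ ^ 2) •
        (inner ℝ (J z) v • J u + inner ℝ (J z) u • J v) := by
  refine christoffel_eq (isInner_taubNUT hJ hJJ z) fun w => ?_
  rw [fderiv_taubNUT, fderiv_taubNUT, fderiv_taubNUT, taubNUT_apply]
  have h0 := inner_J_self hJ z
  have h0' : inner ℝ z (J z) = 0 := by rw [real_inner_comm, h0]
  have hn := norm_J_sq hJ hJJ z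
  have h3 : ∀ u, inner ℝ (J z) (J u) = inner ℝ z u := fun u => by
    rw [hJ, hJJ, inner_neg_right, neg_neg]
  have h4 : inner ℝ (J v) u = - inner ℝ (J u) v := by rw [hJ, real_inner_comm]
  have h5 : inner ℝ (J w) u = - inner ℝ (J u) w := by rw [hJ, real_inner_comm]
  have h6 : inner ℝ (J w) v = - inner ℝ (J v) w := by rw [hJ, real_inner_comm]
  simp only [inner_add_left, inner_sub_left, inner_add_right, inner_sub_right, inner_smul_left,
    inner_smul_right, conj_trivial, h0, h3, h4, h5, h6, real_inner_self_eq_norm_sq]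
  have hs : 1 + ‖z‖ ^ 2 ≠ 0 := by positivity
  field_simp
  ring

include hJ hJJ in
theorem fderiv_christoffel_taubNUT (z u v w : E) (p : ℝ) (hp : (1 + ‖z‖ ^ 2)⁻¹ = p) :
    fderiv ℝ (fun y => christoffel (taubNUT J) y v w) z u =
      (-2 * p ^ 2 * inner ℝ z u) • (inner ℝ z v • w + inner ℝ z w • v - inner ℝ v w • z) +
      p • (inner ℝ u v • w + inner ℝ u w • v - inner ℝ v w • u) +
      (4 * p ^ 3 * inner ℝ z u *
        (inner ℝ z v * inner ℝ (J z) w + inner ℝ z w * inner ℝ (J z) v)) • J z -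
      (p ^ 2 * (inner ℝ u v * inner ℝ (J z) w + inner ℝ z v * inner ℝ (J u) w +
        inner ℝ u w * inner ℝ (J z) v + inner ℝ z w * inner ℝ (J u) v)) • J z -
      (p ^ 2 * (inner ℝ z v * inner ℝ (J z) w + inner ℝ z w * inner ℝ (J z) v)) • J u +
      (6 * p ^ 4 * inner ℝ z u * (inner ℝ (J z) v * inner ℝ (J z) w)) • z -
      (p ^ 3 * (inner ℝ (J u) v * inner ℝ (J z) w + inner ℝ (J z) v * inner ℝ (J u) w)) • z -
      (p ^ 3 * (inner ℝ (J z) v * inner ℝ (J z) w)) • u +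
      (2 * p ^ 2 * (1 + 2 * p) * inner ℝ z u) • (inner ℝ (J z) w • J v + inner ℝ (J z) v • J w) -
      (p + p ^ 2) • (inner ℝ (J u) w • J v + inner ℝ (J u) v • J w) := by
  refine fderiv_apply_eq_of_hasDerivAt
    ((isMetricAt_taubNUT hJ hJJ z).differentiableAt_christoffel v w) ?_
  simp only [christoffel_taubNUT hJ hJJ]
  have hpd := hasDerivAt_inv_line z u
  have hz := hasDerivAt_line z u
  have hJz := hasDerivAt_J_line J z u
  have hv := hasDerivAt_inner_line z u v
  have hw := hasDerivAt_inner_line z u w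
  have hav := hasDerivAt_inner_J_line J z u v
  have haw := hasDerivAt_inner_J_line J z u w
  have h1 := hpd.fun_smul (((hv.smul_const w).fun_add (hw.smul_const v)).fun_sub
    (hz.fun_const_smul (inner ℝ v w)))
  have h2 := ((hpd.fun_pow 2).fun_mul ((hv.fun_mul haw).fun_add (hw.fun_mul hav))).fun_smul hJz
  have h3 := ((hpd.fun_pow 3).fun_mul (hav.fun_mul haw)).fun_smul hz
  have h4 := (hpd.fun_add (hpd.fun_pow 2)).fun_smul
    ((haw.smul_const (J v)).fun_add (hav.smul_const (J w)))
  refine (((h1.fun_sub h2).fun_sub h3).fun_sub h4).congr_deriv ?_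
  simp only [zero_smul, add_zero, hp]
  push_cast
  match_scalars <;> ring

/-- The standard basis of the self-dual two-forms of the Taub-NUT metric at a point with
`f = 1 + |z|²`, in a Euclidean orthonormal basis `b` adapted to the point: there the metric is diagonal
with entries `f, 1 / f, f, f`. -/
def tnForm (f : ℝ) (a : Fin 3) (u v : Fin 4 → ℝ) : ℝ :=
  ![(u 0 * v 1 - u 1 * v 0) + f * (u 2 * v 3 - u 3 * v 2),
    f * (u 0 * v 2 - u 2 * v 0) + (u 3 * v 1 - u 1 * v 3),
    f * (u 0 * v 3 - u 3 * v 0) + (u 1 * v 2 - u 2 * v 1)] a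

section adapted

variable (b : OrthonormalBasis (Fin 4) ℝ E) (h01 : J (b 0) = b 1) (h23 : J (b 2) = b 3)

include hJ hJJ h01 h23 in
theorem inner_basis_J (u : E) : inner ℝ (b 0) (J u) = -inner ℝ (b 1) u ∧
    inner ℝ (b 1) (J u) = inner ℝ (b 0) u ∧ inner ℝ (b 2) (J u) = -inner ℝ (b 3) u ∧
    inner ℝ (b 3) (J u) = inner ℝ (b 2) u := by
  have h := fun x => hJ x u
  refine ⟨?_, ?_, ?_, ?_⟩
  · rw [← h01, hJ, neg_neg]
  · rw [← h01, hJ, hJJ, inner_neg_right, neg_neg]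
  · rw [← h23, hJ, neg_neg]
  · rw [← h23, hJ, hJJ, inner_neg_right, neg_neg]

set_option maxHeartbeats 4000000 in
include hJ hJJ h01 h23 in
/-- The lowered curvature tensor of the Taub-NUT metric. As an operator on two-forms it vanishes on the
anti-self-dual forms and is diagonal with entries proportional to `2, -1, -1` on the self-dual ones; the
metric is Ricci-flat because these add up to zero. -/
theorem riemann_taubNUT (t : ℝ) (u v w x : E) :
    taubNUT J (t • b 0) (riemann (taubNUT J) (t • b 0) u v w) x =
      -2 * (1 + t ^ 2)⁻¹ ^ 3 * ∑ a, ![2, -1, -1] a *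
        (tnForm (1 + t ^ 2) a (b.repr u) (b.repr v) * tnForm (1 + t ^ 2) a (b.repr w) (b.repr x)) := by
  have hn : ‖t • b 0‖ ^ 2 = t ^ 2 := by
    rw [norm_smul, b.norm_eq_one, mul_one, Real.norm_eq_abs, sq_abs]
  have hb : ∀ i j, inner ℝ (b i) (b j) = if i = j then (1 : ℝ) else 0 :=
    fun i j => orthonormal_iff_ite.1 b.orthonormal i j
  have hJb := inner_basis_J hJ hJJ b h01 h23
  have hsum : ∀ x y : E, inner ℝ x y = inner ℝ (b 0) x * inner ℝ (b 0) y +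
      inner ℝ (b 1) x * inner ℝ (b 1) y + inner ℝ (b 2) x * inner ℝ (b 2) y +
      inner ℝ (b 3) x * inner ℝ (b 3) y := by
    intro x y
    rw [← b.sum_inner_mul_inner x y, Fin.sum_univ_four]
    simp only [real_inner_comm (b _) x]
  set z := t • b 0 with hz
  have hJz : J z = t • b 1 := by rw [hz, map_smul, h01]
  have hzi : ∀ x, inner ℝ z x = t * inner ℝ (b 0) x := fun x => by
    rw [hz, inner_smul_left, conj_trivial]
  have hJzi : ∀ x, inner ℝ (J z) x = t * inner ℝ (b 1) x := fun x => by
    rw [hJz, inner_smul_left, conj_trivial]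
  have hJi : ∀ x y, inner ℝ (J x) y = - inner ℝ (b 1) x * inner ℝ (b 0) y +
      inner ℝ (b 0) x * inner ℝ (b 1) y - inner ℝ (b 3) x * inner ℝ (b 2) y +
      inner ℝ (b 2) x * inner ℝ (b 3) y := by
    intro x y
    rw [hsum (J x) y, (hJb x).1, (hJb x).2.1, (hJb x).2.2.1, (hJb x).2.2.2]
    ring
  have hbz : ∀ i, inner ℝ (b i) z = if i = 0 then t else 0 := fun i => by
    rw [hz, inner_smul_right, hb]
    split <;> simp
  have hbJz : ∀ i, inner ℝ (b i) (J z) = if i = 1 then t else 0 := fun i => by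
    rw [hJz, inner_smul_right, hb]
    split <;> simp
  have hp : (1 + ‖z‖ ^ 2)⁻¹ = (1 + t ^ 2)⁻¹ := by rw [hn]
  have hf : (1 : ℝ) + t ^ 2 ≠ 0 := by positivity
  set p : ℝ := (1 + t ^ 2)⁻¹ with hpdef
  have hΓ : ∀ u v : E, ∀ i, inner ℝ (b i) (christoffel (taubNUT J) z u v) =
      p * (t * inner ℝ (b 0) u * inner ℝ (b i) v + t * inner ℝ (b 0) v * inner ℝ (b i) u -
        inner ℝ u v * if i = 0 then t else 0) -
      p ^ 2 * (t * inner ℝ (b 0) u * (t * inner ℝ (b 1) v) +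
        t * inner ℝ (b 0) v * (t * inner ℝ (b 1) u)) * (if i = 1 then t else 0) -
      p ^ 3 * (t * inner ℝ (b 1) u * (t * inner ℝ (b 1) v)) * (if i = 0 then t else 0) -
      (p + p ^ 2) * (t * inner ℝ (b 1) v * inner ℝ (b i) (J u) +
        t * inner ℝ (b 1) u * inner ℝ (b i) (J v)) := fun u v i => by
    rw [christoffel_taubNUT hJ hJJ, hp]
    simp only [inner_add_right, inner_sub_right, inner_smul_right, hzi, hJzi, hbz, hbJz]
  set q := christoffel (taubNUT J) z v w with hq
  set q' := christoffel (taubNUT J) z u w with hq'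
  have hR : ∀ i, inner ℝ (b i) (riemann (taubNUT J) z u v w) =
      inner ℝ (b i) (fderiv ℝ (fun y => christoffel (taubNUT J) y v w) z u) -
      inner ℝ (b i) (fderiv ℝ (fun y => christoffel (taubNUT J) y u w) z v) +
      inner ℝ (b i) (christoffel (taubNUT J) z u q) -
      inner ℝ (b i) (christoffel (taubNUT J) z v q') := fun i => by
    rw [← inner_sub_right, ← inner_add_right, ← inner_sub_right]
    rfl
  have hq0 := hΓ v w 0
  have hq1 := hΓ v w 1
  have hq2 := hΓ v w 2
  have hq3 := hΓ v w 3
  have hq0' := hΓ u w 0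
  have hq1' := hΓ u w 1
  have hq2' := hΓ u w 2
  have hq3' := hΓ u w 3
  rw [← hq] at hq0 hq1 hq2 hq3
  rw [← hq'] at hq0' hq1' hq2' hq3'
  simp only [hsum v w, hsum u w, (hJb _).1, (hJb _).2.1, (hJb _).2.2.1, (hJb _).2.2.2,
    Fin.isValue, if_true, if_false, Fin.reduceEq] at hq0 hq1 hq2 hq3 hq0' hq1' hq2' hq3'
  have hR0 := hR 0
  have hR1 := hR 1
  have hR2 := hR 2
  have hR3 := hR 3
  rw [fderiv_christoffel_taubNUT hJ hJJ z u v w _ hp, fderiv_christoffel_taubNUT hJ hJJ z v u w _ hp,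
    hΓ u q, hΓ v q'] at hR0 hR1 hR2 hR3
  simp only [inner_add_right, inner_sub_right, inner_smul_right, hzi, hJzi, hbz, hbJz, hJi u, hJi v,
    hsum u v, hsum v u, hsum u w, hsum v w, hsum u q, hsum v q', (hJb _).1, (hJb _).2.1,
    (hJb _).2.2.1, (hJb _).2.2.2,
    Fin.isValue, if_true, if_false, Fin.reduceEq] at hR0 hR1 hR2 hR3
  have hG : taubNUT J z (riemann (taubNUT J) z u v w) x =
      (1 + t ^ 2) * inner ℝ (b 0) (riemann (taubNUT J) z u v w) * inner ℝ (b 0) x +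
      p * inner ℝ (b 1) (riemann (taubNUT J) z u v w) * inner ℝ (b 1) x +
      (1 + t ^ 2) * inner ℝ (b 2) (riemann (taubNUT J) z u v w) * inner ℝ (b 2) x +
      (1 + t ^ 2) * inner ℝ (b 3) (riemann (taubNUT J) z u v w) * inner ℝ (b 3) x := by
    rw [taubNUT_apply, hsum _ x, hJzi, hJzi, hn, hpdef]
    field_simp
    ring
  rw [hG]
  rw [hq0, hq1, hq2, hq3, hq0', hq1', hq2', hq3'] at hR0 hR1 hR2 hR3
  simp only [Fin.sum_univ_three, tnForm, b.repr_apply_apply]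
  simp only [Matrix.cons_val]
  clear_value q q'
  clear hq0 hq1 hq2 hq3 hq0' hq1' hq2' hq3' hG hR hΓ hq hq'
  generalize inner ℝ (b 0) (riemann (taubNUT J) z u v w) = R0 at hR0 hR1 hR2 hR3 ⊢
  generalize inner ℝ (b 1) (riemann (taubNUT J) z u v w) = R1 at hR0 hR1 hR2 hR3 ⊢
  generalize inner ℝ (b 2) (riemann (taubNUT J) z u v w) = R2 at hR0 hR1 hR2 hR3 ⊢
  generalize inner ℝ (b 3) (riemann (taubNUT J) z u v w) = R3 at hR0 hR1 hR2 hR3 ⊢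
  generalize inner ℝ (b 0) u = u0 at hR0 hR1 hR2 hR3 ⊢
  generalize inner ℝ (b 1) u = u1 at hR0 hR1 hR2 hR3 ⊢
  generalize inner ℝ (b 2) u = u2 at hR0 hR1 hR2 hR3 ⊢
  generalize inner ℝ (b 3) u = u3 at hR0 hR1 hR2 hR3 ⊢
  generalize inner ℝ (b 0) v = v0 at hR0 hR1 hR2 hR3 ⊢
  generalize inner ℝ (b 1) v = v1 at hR0 hR1 hR2 hR3 ⊢
  generalize inner ℝ (b 2) v = v2 at hR0 hR1 hR2 hR3 ⊢
  generalize inner ℝ (b 3) v = v3 at hR0 hR1 hR2 hR3 ⊢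
  generalize inner ℝ (b 0) w = w0 at hR0 hR1 hR2 hR3 ⊢
  generalize inner ℝ (b 1) w = w1 at hR0 hR1 hR2 hR3 ⊢
  generalize inner ℝ (b 2) w = w2 at hR0 hR1 hR2 hR3 ⊢
  generalize inner ℝ (b 3) w = w3 at hR0 hR1 hR2 hR3 ⊢
  have hpf : (1 + t ^ 2) * p = 1 := mul_inv_cancel₀ hf
  -- the components of the lowered curvature tensor, one for each direction of `x`
  have k0 : (1 + t ^ 2) * R0 =
      -2 * p ^ 3 * (2 * (u0 * v1 - u1 * v0 + (1 + t ^ 2) * (u2 * v3 - u3 * v2)) * (-w1) -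
      ((1 + t ^ 2) * (u0 * v2 - u2 * v0) + (u3 * v1 - u1 * v3)) * (-((1 + t ^ 2) * w2)) -
      ((1 + t ^ 2) * (u0 * v3 - u3 * v0) + (u1 * v2 - u2 * v1)) * (-((1 + t ^ 2) * w3))) := by
    rw [hR0, hpdef]
    clear hR0 hR1 hR2 hR3
    field_simp
    ring
  have k1 : p * R1 =
      -2 * p ^ 3 * (2 * (u0 * v1 - u1 * v0 + (1 + t ^ 2) * (u2 * v3 - u3 * v2)) * (w0) -
      ((1 + t ^ 2) * (u0 * v2 - u2 * v0) + (u3 * v1 - u1 * v3)) * (w3) -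
      ((1 + t ^ 2) * (u0 * v3 - u3 * v0) + (u1 * v2 - u2 * v1)) * (-w2)) := by
    rw [hR1, hpdef]
    clear hR0 hR1 hR2 hR3
    field_simp
    ring
  have k2 : (1 + t ^ 2) * R2 =
      -2 * p ^ 3 * (2 * (u0 * v1 - u1 * v0 + (1 + t ^ 2) * (u2 * v3 - u3 * v2)) * (-((1 + t ^ 2) * w3)) -
      ((1 + t ^ 2) * (u0 * v2 - u2 * v0) + (u3 * v1 - u1 * v3)) * ((1 + t ^ 2) * w0) -
      ((1 + t ^ 2) * (u0 * v3 - u3 * v0) + (u1 * v2 - u2 * v1)) * (w1)) := by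
    rw [hR2, hpdef]
    clear hR0 hR1 hR2 hR3
    field_simp
    ring
  have k3 : (1 + t ^ 2) * R3 =
      -2 * p ^ 3 * (2 * (u0 * v1 - u1 * v0 + (1 + t ^ 2) * (u2 * v3 - u3 * v2)) * ((1 + t ^ 2) * w2) -
      ((1 + t ^ 2) * (u0 * v2 - u2 * v0) + (u3 * v1 - u1 * v3)) * (-w1) -
      ((1 + t ^ 2) * (u0 * v3 - u3 * v0) + (u1 * v2 - u2 * v1)) * ((1 + t ^ 2) * w0)) := by
    rw [hR3, hpdef]
    clear hR0 hR1 hR2 hR3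
    field_simp
    ring
  linear_combination inner ℝ (b 0) x * k0 + inner ℝ (b 1) x * k1 + inner ℝ (b 2) x * k2 +
    inner ℝ (b 3) x * k3

end adapted

end taubNUT

end LocalMetric

namespace LocalMetric

section taubNUT

variable {E : Type} [NormedAddCommGroup E] [InnerProductSpace ℝ E] [FiniteDimensional ℝ E]
variable {J : E →L[ℝ] E}

section adapted

variable (hJ : ∀ u v, inner ℝ (J u) v = -inner ℝ u (J v)) (hJJ : ∀ u, J (J u) = -u)
variable (b : OrthonormalBasis (Fin 4) ℝ E) (h01 : J (b 0) = b 1) (h23 : J (b 2) = b 3)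

include h01 in
theorem taubNUT_basis (t : ℝ) (i j : Fin 4) : taubNUT J (t • b 0) (b i) (b j) =
    if i = j then ![1 + t ^ 2, (1 + t ^ 2)⁻¹, 1 + t ^ 2, 1 + t ^ 2] i else 0 := by
  have hn : ‖t • b 0‖ ^ 2 = t ^ 2 := by
    rw [norm_smul, b.norm_eq_one, mul_one, Real.norm_eq_abs, sq_abs]
  have hb : ∀ i j, inner ℝ (b i) (b j) = if i = j then (1 : ℝ) else 0 :=
    fun i j => orthonormal_iff_ite.1 b.orthonormal i j
  have hf : (1 : ℝ) + t ^ 2 ≠ 0 := by positivity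
  rw [taubNUT_apply, map_smul, h01, inner_smul_left, inner_smul_left, conj_trivial, hb, hb, hb, hn]
  fin_cases i <;> fin_cases j <;> simp
  field_simp
  ring

include hJ hJJ h01 h23 in
theorem ricci_taubNUT_adapted (t : ℝ) (v w : E) : ricci (taubNUT J) (t • b 0) v w = 0 := by
  have hb : ∀ i j, i ≠ j → taubNUT J (t • b 0) (b.toBasis i) (b.toBasis j) = 0 := by
    intro i j hij
    rw [b.coe_toBasis, taubNUT_basis b h01, if_neg hij]
  have hf : (1 : ℝ) + t ^ 2 ≠ 0 := by positivity
  rw [ricci_eq_sum (isMetricAt_taubNUT hJ hJJ _) b.toBasis hb]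
  simp only [b.coe_toBasis, riemann_taubNUT hJ hJJ b h01 h23, taubNUT_basis b h01,
    Fin.sum_univ_four, Fin.sum_univ_three, tnForm, b.repr_self, PiLp.single_apply]
  simp only [if_true, Matrix.cons_val, Fin.isValue, Fin.reduceEq, if_false]
  field_simp
  ring

include hJ hJJ h01 h23 in
theorem rmNormSq_taubNUT_adapted (t : ℝ) :
    rmNormSq (taubNUT J) (t • b 0) = 384 * (1 + t ^ 2)⁻¹ ^ 6 := by
  have hb : ∀ i j, i ≠ j → taubNUT J (t • b 0) (b.toBasis i) (b.toBasis j) = 0 := by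
    intro i j hij
    rw [b.coe_toBasis, taubNUT_basis b h01, if_neg hij]
  have hf : (1 : ℝ) + t ^ 2 ≠ 0 := by positivity
  rw [rmNormSq_eq_sum (isMetricAt_taubNUT hJ hJJ _) b.toBasis hb]
  simp only [b.coe_toBasis, riemann_taubNUT hJ hJJ b h01 h23, taubNUT_basis b h01]
  set f := 1 + t ^ 2
  -- the three forms are orthogonal to each other, of squared norm 4
  have hin : ∀ A B C : ℝ, ∑ k, (![f, f⁻¹, f, f] k)⁻¹ * ∑ l, (![f, f⁻¹, f, f] l)⁻¹ *
      (A * tnForm f 0 (b.repr (b k)) (b.repr (b l)) + B * tnForm f 1 (b.repr (b k)) (b.repr (b l)) +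
        C * tnForm f 2 (b.repr (b k)) (b.repr (b l))) ^ 2 = 4 * (A ^ 2 + B ^ 2 + C ^ 2) := by
    intro A B C
    simp only [Fin.sum_univ_four, tnForm, b.repr_self, PiLp.single_apply]
    simp only [if_true, Matrix.cons_val, Fin.isValue, Fin.reduceEq, if_false]
    field_simp
    ring
  have hin2 := hin (2 * √2) √2 √2
  simp only [if_true, Fin.sum_univ_three]
  have e : ∀ i j, ∑ k, (![f, f⁻¹, f, f] k)⁻¹ * ∑ l, (![f, f⁻¹, f, f] l)⁻¹ *
      (-2 * f⁻¹ ^ 3 * ((![2, -1, -1] : Fin 3 → ℝ) 0 *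
          (tnForm f 0 (b.repr (b i)) (b.repr (b j)) * tnForm f 0 (b.repr (b k)) (b.repr (b l))) +
        (![2, -1, -1] : Fin 3 → ℝ) 1 *
          (tnForm f 1 (b.repr (b i)) (b.repr (b j)) * tnForm f 1 (b.repr (b k)) (b.repr (b l))) +
        (![2, -1, -1] : Fin 3 → ℝ) 2 * (tnForm f 2 (b.repr (b i)) (b.repr (b j)) *
          tnForm f 2 (b.repr (b k)) (b.repr (b l))))) ^ 2 =
      16 * f⁻¹ ^ 6 * (2 * tnForm f 0 (b.repr (b i)) (b.repr (b j)) +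
        0 * tnForm f 1 (b.repr (b i)) (b.repr (b j)) +
        0 * tnForm f 2 (b.repr (b i)) (b.repr (b j))) ^ 2 +
      16 * f⁻¹ ^ 6 * (0 * tnForm f 0 (b.repr (b i)) (b.repr (b j)) +
        1 * tnForm f 1 (b.repr (b i)) (b.repr (b j)) +
        0 * tnForm f 2 (b.repr (b i)) (b.repr (b j))) ^ 2 +
      16 * f⁻¹ ^ 6 * (0 * tnForm f 0 (b.repr (b i)) (b.repr (b j)) +
        0 * tnForm f 1 (b.repr (b i)) (b.repr (b j)) +
        1 * tnForm f 2 (b.repr (b i)) (b.repr (b j))) ^ 2 := by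
    intro i j
    have := hin (-4 * f⁻¹ ^ 3 * tnForm f 0 (b.repr (b i)) (b.repr (b j)))
      (2 * f⁻¹ ^ 3 * tnForm f 1 (b.repr (b i)) (b.repr (b j)))
      (2 * f⁻¹ ^ 3 * tnForm f 2 (b.repr (b i)) (b.repr (b j)))
    refine Eq.trans ?_ (this.trans (by ring))
    refine Finset.sum_congr rfl fun k _ => congrArg _ (Finset.sum_congr rfl fun l _ => congrArg _ ?_)
    simp only [Matrix.cons_val]
    ring
  simp only [e]
  have h1 := hin 2 0 0
  have h2 := hin 0 1 0
  have h3 := hin 0 0 1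
  simp only [mul_add, Finset.sum_add_distrib, mul_left_comm _ (16 * f⁻¹ ^ 6), ← Finset.mul_sum]
  rw [h1, h2, h3]
  ring

end adapted

/-- Multiplication by `i` on `ℝ⁴ = ℂ²`. -/
def complexJ : EuclideanSpace ℝ (Fin 4) →L[ℝ] EuclideanSpace ℝ (Fin 4) :=
  LinearMap.toContinuousLinearMap
    { toFun := fun x => !₂[-x 1, x 0, -x 3, x 2]
      map_add' := fun x y => by
        ext i
        fin_cases i <;> simp <;> ring
      map_smul' := fun c x => by
        ext i
        fin_cases i <;> simp }

theorem complexJ_apply (x : EuclideanSpace ℝ (Fin 4)) : complexJ x = !₂[-x 1, x 0, -x 3, x 2] := rfl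

theorem inner_complexJ (u v : EuclideanSpace ℝ (Fin 4)) :
    inner ℝ (complexJ u) v = -inner ℝ u (complexJ v) := by
  rw [complexJ_apply, complexJ_apply, PiLp.inner_apply, PiLp.inner_apply]
  simp [Fin.sum_univ_four]
  ring

theorem complexJ_complexJ (u : EuclideanSpace ℝ (Fin 4)) : complexJ (complexJ u) = -u := by
  ext i
  rw [complexJ_apply, complexJ_apply]
  fin_cases i <;> simp

/-- Every point is a multiple of the first vector of an orthonormal basis that is adapted to the complex
structure, so that it suffices to know the curvature at the points `t • b 0`. -/
theorem exists_adapted_basis (z : EuclideanSpace ℝ (Fin 4)) :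
    ∃ b : OrthonormalBasis (Fin 4) ℝ (EuclideanSpace ℝ (Fin 4)),
      complexJ (b 0) = b 1 ∧ complexJ (b 2) = b 3 ∧ z = ‖z‖ • b 0 := by
  obtain ⟨e, he, hz⟩ : ∃ e : EuclideanSpace ℝ (Fin 4), ‖e‖ = 1 ∧ z = ‖z‖ • e := by
    by_cases h : z = 0
    · exact ⟨EuclideanSpace.single 0 1, by simp, by simp [h]⟩
    · exact ⟨‖z‖⁻¹ • z, by simp [norm_smul, h], by simp [h]⟩
  have he' : e 0 ^ 2 + e 1 ^ 2 + e 2 ^ 2 + e 3 ^ 2 = 1 := by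
    have := EuclideanSpace.real_norm_sq_eq e
    rw [he, Fin.sum_univ_four] at this
    linarith
  -- the second pair is obtained from the quaternion multiplication by `j`
  let k : EuclideanSpace ℝ (Fin 4) := !₂[-e 2, e 3, e 0, -e 1]
  have ho : Orthonormal ℝ (![e, complexJ e, k, complexJ k] :
      Fin 4 → EuclideanSpace ℝ (Fin 4)) := by
    rw [orthonormal_iff_ite]
    have hi : ∀ x y : EuclideanSpace ℝ (Fin 4),
        inner ℝ x y = x 0 * y 0 + x 1 * y 1 + x 2 * y 2 + x 3 * y 3 := fun x y => by
      simp [PiLp.inner_apply, Fin.sum_univ_four]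
      ring
    intro i j
    rw [hi]
    fin_cases i <;> fin_cases j <;> simp [k, complexJ_apply] <;> linarith
  let b := basisOfOrthonormalOfCardEqFinrank ho (by simp)
  have hb : ⇑b = ![e, complexJ e, k, complexJ k] := coe_basisOfOrthonormalOfCardEqFinrank _ _
  refine ⟨b.toOrthonormalBasis (by rwa [hb]), ?_, ?_, ?_⟩ <;>
    simp only [Module.Basis.coe_toOrthonormalBasis, hb]
  · rfl
  · rfl
  · exact hz

theorem ricci_taubNUT (z v w : EuclideanSpace ℝ (Fin 4)) : ricci (taubNUT complexJ) z v w = 0 := by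
  obtain ⟨b, h01, h23, hz⟩ := exists_adapted_basis z
  rw [hz]
  exact ricci_taubNUT_adapted inner_complexJ complexJ_complexJ b h01 h23 _ v w

theorem rmNormSq_taubNUT (z : EuclideanSpace ℝ (Fin 4)) :
    rmNormSq (taubNUT complexJ) z = 384 * (1 + ‖z‖ ^ 2)⁻¹ ^ 6 := by
  obtain ⟨b, h01, h23, hz⟩ := exists_adapted_basis z
  conv_lhs => rw [hz]
  exact rmNormSq_taubNUT_adapted inner_complexJ complexJ_complexJ b h01 h23 _

end taubNUT

end LocalMetric

namespace RiemMfd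

section ofMetric

variable (E : Type) [NormedAddCommGroup E] [NormedSpace ℝ E] [FiniteDimensional ℝ E]
  (G : E → E →L[ℝ] E →L[ℝ] ℝ)

theorem mfderiv_extChartAt_symm_self (x z : E) :
    mfderiv 𝓘(ℝ, E) 𝓘(ℝ, E) (extChartAt 𝓘(ℝ, E) x).symm z = ContinuousLinearMap.id ℝ E := by
  rw [extChartAt_model_space_eq_id]
  exact mfderiv_id

/-- A metric on a vector space as a Riemannian manifold. -/
def ofMetric (hG : ContDiff ℝ ∞ G) (hi : ∀ z, LocalMetric.IsInner (G z)) : RiemMfd where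
  E := E
  H := E
  M := E
  I := 𝓘(ℝ, E)
  secondCountable := inferInstance
  g :=
    { inner := fun z => G z
      symm := fun z v w => (hi z).symm v w
      pos := fun z v hv => (hi z).pos v hv
      isVonNBounded := fun z => isVonNBounded_of_posDef (E := E) (G z) (hi z).pos
      contMDiff := by
        intro x
        have hx : x ∈ (extChartAt 𝓘(ℝ, E) x).target := by
          rw [extChartAt_model_space_eq_id]
          trivial
        have h := (contMDiffAt_bilinear_iff (I := 𝓘(ℝ, E)) (h := fun z => G z) hx).2 ?_
        · have e : (extChartAt 𝓘(ℝ, E) x).symm x = x := by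
            rw [extChartAt_model_space_eq_id]
            rfl
          rw [e] at h
          exact h
        · refine hG.contDiffAt.congr_of_eventuallyEq (Eventually.of_forall fun w => ?_)
          refine ContinuousLinearMap.ext fun u => ContinuousLinearMap.ext fun v => ?_
          simp only [mfderiv_extChartAt_symm_self, extChartAt_model_space_eq_id]
          rfl }

variable {E G} (hG : ContDiff ℝ ∞ G) (hi : ∀ z, LocalMetric.IsInner (G z))

theorem coordMetric_ofMetric (x : E) : (ofMetric E G hG hi).coordMetric x = G := by
  refine funext fun (w : E) => ContinuousLinearMap.ext fun (u : E) => ContinuousLinearMap.ext fun (v : E) => ?_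
  change G ((extChartAt 𝓘(ℝ, E) x).symm w)
    (mfderiv 𝓘(ℝ, E) 𝓘(ℝ, E) (extChartAt 𝓘(ℝ, E) x).symm w u)
    (mfderiv 𝓘(ℝ, E) 𝓘(ℝ, E) (extChartAt 𝓘(ℝ, E) x).symm w v) = _
  rw [mfderiv_extChartAt_symm_self, extChartAt_model_space_eq_id]
  rfl

theorem extChartAt_ofMetric (x y : E) : extChartAt (ofMetric E G hG hi).I (show
    (ofMetric E G hG hi).M from x) y = y := by
  change extChartAt 𝓘(ℝ, E) x y = y
  rw [extChartAt_model_space_eq_id]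
  rfl

end ofMetric

variable (X : RiemMfd)

/-- A differentiable function whose differential has norm at most one satisfies the first order
Lipschitz condition. -/
theorem eventually_sub_le_of_hasFDerivAt {h : X.M → ℝ} {x : X.M} {D : X.E →L[ℝ] ℝ}
    (hd : HasFDerivAt (h ∘ (extChartAt X.I x).symm) D (extChartAt X.I x x))
    (hD : ∀ ζ : X.E, D ζ ≤ Real.sqrt (X.g.inner x ζ ζ)) {ε : ℝ} (hε : 0 < ε) :
    ∀ᶠ y in 𝓝 x, h y - h x ≤
      Real.sqrt (X.g.inner x (extChartAt X.I x y - extChartAt X.I x x : X.E)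
        (extChartAt X.I x y - extChartAt X.I x x : X.E)) +
        ε * ‖extChartAt X.I x y - extChartAt X.I x x‖ := by
  have h1 := (continuousAt_extChartAt (I := X.I) x).eventually
    (hd.isLittleO.bound hε)
  filter_upwards [h1, extChartAt_source_mem_nhds (I := X.I) x] with y hy hys
  simp only [Function.comp_apply, (extChartAt X.I x).left_inv hys,
    (extChartAt X.I x).left_inv (mem_extChartAt_source x), map_sub] at hy
  have h2 := (le_abs_self _).trans hy
  have h3 := hD (extChartAt X.I x y - extChartAt X.I x x)
  rw [map_sub] at h3
  linarith

end RiemMfd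

namespace RiemMfd

/-! ### Curvature of products and rescalings -/

section products

variable (X Y : RiemMfd)

/-- `|Rm|²` at the point `x`. -/
def rmSq (x : X.M) : ℝ := LocalMetric.rmNormSq (X.coordMetric x) (extChartAt X.I x x)

theorem rmNorm_eq_sqrt (x : X.M) : X.rmNorm x = Real.sqrt (X.rmSq x) := rfl

theorem coordMetric_prod_eventuallyEq (x : X.M) (y : Y.M) :
    (X.prod Y).coordMetric (x, y) =ᶠ[𝓝 (extChartAt X.I x x, extChartAt Y.I y y)]
      LocalMetric.prodMetric (X.coordMetric x) (Y.coordMetric y) := by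
  have h := prod_mem_nhds (extChartAt_target_mem_nhds (I := X.I) x)
    (extChartAt_target_mem_nhds (I := Y.I) y)
  filter_upwards [h] with z hz
  exact X.coordMetric_prod Y (x, y) hz.1 hz.2

theorem extChartAt_prod_self (x : X.M) (y : Y.M) :
    extChartAt (X.prod Y).I (show (X.prod Y).M from (x, y)) (x, y) =
      (extChartAt X.I x x, extChartAt Y.I y y) := by
  rw [X.extChartAt_prod_eq Y (x, y)]
  rfl

theorem rmSq_prod (x : X.M) (y : Y.M) :
    (X.prod Y).rmSq (show (X.prod Y).M from (x, y)) = X.rmSq x + Y.rmSq y := by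
  have h := (LocalMetric.rmNormSq_congr (X.coordMetric_prod_eventuallyEq Y x y)).trans
    (LocalMetric.rmNormSq_prod (p := (extChartAt X.I x x, extChartAt Y.I y y))
      (X.isMetricAt_coordMetric_self x) (Y.isMetricAt_coordMetric_self y))
  unfold rmSq
  rw [extChartAt_prod_self]
  exact h

theorem ricci_prod (x : X.M) (y : Y.M) (u v : X.E × Y.E) :
    (X.prod Y).ricci (show (X.prod Y).M from (x, y)) u v = X.ricci x u.1 v.1 + Y.ricci y u.2 v.2 := by
  have h := (LocalMetric.ricci_congr (X.coordMetric_prod_eventuallyEq Y x y) u v).trans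
    (LocalMetric.ricci_prod (p := (extChartAt X.I x x, extChartAt Y.I y y))
      (X.isMetricAt_coordMetric_self x) (Y.isMetricAt_coordMetric_self y) u v)
  unfold ricci
  rw [extChartAt_prod_self]
  exact h

theorem IsRicciFlat.prod {X Y : RiemMfd} (hX : X.IsRicciFlat) (hY : Y.IsRicciFlat) :
    (X.prod Y).IsRicciFlat := by
  rintro ⟨x, y⟩ u v
  refine (X.ricci_prod Y x y u v).trans ?_
  rw [hX, hY, add_zero]

theorem rmSq_rescale (a : ℝ) (ha : 0 < a) (x : X.M) :
    (X.rescale a ha).rmSq x = (a⁻¹ ^ 2) ^ 2 * X.rmSq x := by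
  have h := LocalMetric.rmNormSq_const_smul (X.isMetricAt_coordMetric_self x) (pow_pos ha 2)
  rw [← inv_pow] at h
  exact h

theorem ricci_rescale (a : ℝ) (ha : 0 < a) (x : X.M) (u v : X.E) :
    (X.rescale a ha).ricci x u v = X.ricci x u v :=
  LocalMetric.ricci_const_smul (X.isMetricAt_coordMetric_self x) (pow_pos ha 2) u v

theorem IsRicciFlat.rescale {X : RiemMfd} (hX : X.IsRicciFlat) (a : ℝ) (ha : 0 < a) :
    (X.rescale a ha).IsRicciFlat := fun x u v => (X.ricci_rescale a ha x u v).trans (hX x u v)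

theorem dim_prod : (X.prod Y).dim = X.dim + Y.dim := Module.finrank_prod

theorem dim_rescale (a : ℝ) (ha : 0 < a) : (X.rescale a ha).dim = X.dim := rfl

/-- All geodesic balls are contained in compact sets. -/
def HasCompactBalls : Prop := ∀ (x : X.M) (r : ℝ), ∃ K, IsCompact K ∧ X.ball x r ⊆ K

variable {X Y}

theorem hasCompactBalls_of_lipschitz {h : X.M → ℝ}
    (hlip : ∀ x y, ENNReal.ofReal (h y - h x) ≤ X.edist x y)
    (hcpt : ∀ R, ∃ K, IsCompact K ∧ ∀ x, h x ≤ R → x ∈ K) : X.HasCompactBalls := by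
  intro x r
  obtain ⟨K, hK, hKs⟩ := hcpt (h x + r)
  refine ⟨K, hK, fun y hy => hKs y ?_⟩
  have h1 := (hlip x y).trans_lt hy
  have h2 : h y - h x < r := lt_of_not_ge fun hle => h1.not_ge (ENNReal.ofReal_le_ofReal hle)
  linarith

theorem HasCompactBalls.prod (hX : X.HasCompactBalls) (hY : Y.HasCompactBalls) :
    (X.prod Y).HasCompactBalls := by
  rintro ⟨x, y⟩ r
  obtain ⟨K, hK, hKs⟩ := hX x r
  obtain ⟨L, hL, hLs⟩ := hY y r
  exact ⟨K ×ˢ L, hK.prod hL, (X.ball_prod_subset Y (x, y) r).trans (Set.prod_mono hKs hLs)⟩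

theorem HasCompactBalls.rescale (hX : X.HasCompactBalls) (a : ℝ) (ha : 0 < a) :
    (X.rescale a ha).HasCompactBalls := by
  intro x r
  obtain ⟨K, hK, hKs⟩ := hX x (a⁻¹ * r)
  exact ⟨K, hK, (X.ball_rescale_subset a ha x r).trans hKs⟩

theorem HasCompactBalls.vol_ball_lt_top (hX : X.HasCompactBalls) (x : X.M) (r : ℝ) :
    X.vol (X.ball x r) < ⊤ := by
  obtain ⟨K, hK, hKs⟩ := hX x r
  exact (measure_mono hKs).trans_lt (X.vol_lt_top_of_isCompact hK)

/-- The energy of a ball is at most the maximal energy density times the volume. -/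
theorem energy_le {a : ℝ} (h : ∀ x, X.rmNorm x ≤ a) (x : X.M) (r : ℝ) :
    X.energy x r ≤ ENNReal.ofReal (a ^ ((X.dim : ℝ) / 2)) * X.vol (X.ball x r) := by
  unfold energy
  refine (lintegral_mono fun y => ENNReal.ofReal_le_ofReal (Real.rpow_le_rpow
    (Real.sqrt_nonneg _) (h y) (by positivity))).trans ?_
  rw [lintegral_const, Measure.restrict_apply_univ]

theorem rmSq_of_hasCurvatureAt {κ : ℝ} {x : X.M}
    (h : LocalMetric.HasCurvatureAt (X.coordMetric x) (extChartAt X.I x x) κ) :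
    X.rmSq x = κ ^ 2 * (2 * X.dim * (X.dim - 1)) := by
  have := h.rmNormSq_eq (X.isMetricAt_coordMetric_self x)
  unfold rmSq dim
  rw [this]
  ring

end products

/-! ### Flat space, the circle and the Taub-NUT manifold -/

section examples

/-- Euclidean space. -/
def euclidean (k : ℕ) : RiemMfd :=
  ofMetric (EuclideanSpace ℝ (Fin k)) (fun _ => LocalMetric.stdForm _) contDiff_const fun _ => by
    simpa using LocalMetric.isInner_smul_stdForm (E := EuclideanSpace ℝ (Fin k)) one_pos

theorem dim_euclidean (k : ℕ) : (euclidean k).dim = k := finrank_euclideanSpace_fin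

theorem coordMetric_euclidean (k : ℕ) (x : (euclidean k).M) :
    (euclidean k).coordMetric x = fun _ => LocalMetric.stdForm (EuclideanSpace ℝ (Fin k)) :=
  coordMetric_ofMetric (E := EuclideanSpace ℝ (Fin k)) (G := fun _ => LocalMetric.stdForm _)
    contDiff_const (fun _ => by
      simpa using LocalMetric.isInner_smul_stdForm (E := EuclideanSpace ℝ (Fin k)) one_pos) x

theorem hasCurvatureAt_stdForm {E : Type} [NormedAddCommGroup E] [InnerProductSpace ℝ E]
    [FiniteDimensional ℝ E] (z : E) :
    LocalMetric.HasCurvatureAt (fun _ => LocalMetric.stdForm E) z 0 := by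
  have h0 : (0 : E →L[ℝ] ℝ) = ((2 * 1 : ℝ) • LocalMetric.stdForm E 0) := by simp
  have h1 : (0 : E →L[ℝ] E) = (0 : ℝ) • ContinuousLinearMap.id ℝ E +
      (LocalMetric.stdForm E 0).smulRight (0 : E) := by
    ext v
    simp
  have key := LocalMetric.hasCurvatureAt_conformal (E := E) (l := fun _ => 1)
    (z := z) (G := fun _ => LocalMetric.stdForm E) (A := fun _ => 0) (β := 0)
    (Eventually.of_forall fun _ => by simp)
    (Eventually.of_forall fun y => ⟨one_pos, (hasFDerivAt_const (1 : ℝ) y).congr_fderiv h0⟩)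
    ((hasFDerivAt_const (0 : E) z).congr_fderiv h1)
  have h2 : (-(2 * (0 : ℝ) + ‖(0 : E)‖ ^ 2) / 1) = 0 := by simp
  rw [h2] at key
  exact key

theorem hasCurvatureAt_euclidean (k : ℕ) (x : (euclidean k).M) (z : (euclidean k).E) :
    LocalMetric.HasCurvatureAt ((euclidean k).coordMetric x) z 0 := by
  rw [coordMetric_euclidean]
  exact hasCurvatureAt_stdForm (E := EuclideanSpace ℝ (Fin k)) z

theorem isRicciFlat_euclidean (k : ℕ) : (euclidean k).IsRicciFlat := by
  intro x u v
  have := (hasCurvatureAt_euclidean k x (extChartAt (euclidean k).I x x)).ricci_eq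
    ((euclidean k).isMetricAt_coordMetric_self x) u v
  refine this.trans ?_
  rw [zero_mul, zero_mul]

theorem rmSq_euclidean (k : ℕ) (x : (euclidean k).M) : (euclidean k).rmSq x = 0 := by
  rw [rmSq_of_hasCurvatureAt (hasCurvatureAt_euclidean k x _)]
  simp

theorem lipschitz_norm_euclidean (k : ℕ) (x y : EuclideanSpace ℝ (Fin k)) :
    ENNReal.ofReal (‖y‖ - ‖x‖) ≤ (euclidean k).edist x y := by
  have hc : Continuous fun x : EuclideanSpace ℝ (Fin k) => ‖x‖ := continuous_norm
  refine (euclidean k).ofReal_sub_le_edist (h := fun x : EuclideanSpace ℝ (Fin k) => ‖x‖)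
    hc (fun (x : EuclideanSpace ℝ (Fin k)) ε hε => ?_) x y
  refine Eventually.of_forall fun (y : EuclideanSpace ℝ (Fin k)) => ?_
  have e : ∀ y : EuclideanSpace ℝ (Fin k), extChartAt 𝓘(ℝ, EuclideanSpace ℝ (Fin k)) x y = y :=
    fun y => rfl
  change ‖y‖ - ‖x‖ ≤ Real.sqrt (inner ℝ (y - x) (y - x)) + ε * ‖y - x‖
  rw [real_inner_self_eq_norm_sq, Real.sqrt_sq (norm_nonneg _)]
  have h1 := norm_sub_norm_le y x
  have h2 : 0 ≤ ε * ‖y - x‖ := by positivity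
  linarith

theorem exists_compact_norm_le {E : Type} [NormedAddCommGroup E] [NormedSpace ℝ E]
    [FiniteDimensional ℝ E] (R : ℝ) : ∃ K : Set E, IsCompact K ∧ ∀ x : E, ‖x‖ ≤ R → x ∈ K :=
  ⟨Metric.closedBall 0 R, isCompact_closedBall 0 R, fun x hx => by simpa using hx⟩

theorem hasCompactBalls_euclidean (k : ℕ) : (euclidean k).HasCompactBalls :=
  hasCompactBalls_of_lipschitz (lipschitz_norm_euclidean k)
    (exists_compact_norm_le (E := EuclideanSpace ℝ (Fin k)))

theorem isComplete_euclidean (k : ℕ) : (euclidean k).IsComplete :=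
  isComplete_of_lipschitz _ (lipschitz_norm_euclidean k)
    (exists_compact_norm_le (E := EuclideanSpace ℝ (Fin k)))

/-- The Taub-NUT manifold. -/
def taubNUT : RiemMfd :=
  ofMetric (EuclideanSpace ℝ (Fin 4)) (LocalMetric.taubNUT LocalMetric.complexJ)
    (LocalMetric.contDiff_taubNUT _)
    (LocalMetric.isInner_taubNUT LocalMetric.inner_complexJ LocalMetric.complexJ_complexJ)

theorem dim_taubNUT : taubNUT.dim = 4 := finrank_euclideanSpace_fin

theorem coordMetric_taubNUT (x : taubNUT.M) :
    taubNUT.coordMetric x = LocalMetric.taubNUT (E := EuclideanSpace ℝ (Fin 4)) LocalMetric.complexJ :=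
  coordMetric_ofMetric (E := EuclideanSpace ℝ (Fin 4)) (LocalMetric.contDiff_taubNUT _)
    (LocalMetric.isInner_taubNUT LocalMetric.inner_complexJ LocalMetric.complexJ_complexJ) x

theorem isRicciFlat_taubNUT : taubNUT.IsRicciFlat := by
  intro x u v
  unfold ricci
  rw [coordMetric_taubNUT]
  exact LocalMetric.ricci_taubNUT (extChartAt taubNUT.I x x) u v

theorem rmSq_taubNUT (x : EuclideanSpace ℝ (Fin 4)) :
    taubNUT.rmSq x = 384 * (1 + ‖x‖ ^ 2)⁻¹ ^ 6 := by
  have e : extChartAt taubNUT.I (show taubNUT.M from x) x = x := extChartAt_ofMetric _ _ x x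
  unfold rmSq
  rw [coordMetric_taubNUT (show taubNUT.M from x)]
  exact (congrArg (LocalMetric.rmNormSq (LocalMetric.taubNUT LocalMetric.complexJ)) e).trans
    (LocalMetric.rmNormSq_taubNUT x)

/-- The function `√(1 + |x|²)` is `1`-Lipschitz for the Taub-NUT metric. -/
theorem lipschitz_taubNUT (x y : EuclideanSpace ℝ (Fin 4)) :
    ENNReal.ofReal (Real.sqrt (1 + ‖y‖ ^ 2) - Real.sqrt (1 + ‖x‖ ^ 2)) ≤ taubNUT.edist x y := by
  have hc : Continuous fun x : EuclideanSpace ℝ (Fin 4) => Real.sqrt (1 + ‖x‖ ^ 2) := by fun_prop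
  refine taubNUT.ofReal_sub_le_edist
    (h := fun x : EuclideanSpace ℝ (Fin 4) => Real.sqrt (1 + ‖x‖ ^ 2))
    hc (fun (x : EuclideanSpace ℝ (Fin 4)) ε hε => ?_) x y
  have e : ∀ y : EuclideanSpace ℝ (Fin 4), extChartAt taubNUT.I
    (show taubNUT.M from x) y = y := extChartAt_ofMetric _ _ x
  have hs : 0 < Real.sqrt (1 + ‖x‖ ^ 2) := Real.sqrt_pos.2 (by positivity)
  have hd : HasFDerivAt (fun x : EuclideanSpace ℝ (Fin 4) => Real.sqrt (1 + ‖x‖ ^ 2))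
      ((Real.sqrt (1 + ‖x‖ ^ 2))⁻¹ • LocalMetric.stdForm _ x) x := by
    have h := ((LocalMetric.hasFDerivAt_norm_sq x).const_add 1).sqrt (by positivity)
    refine h.congr_fderiv ?_
    rw [smul_smul]
    congr 1
    field_simp
  refine taubNUT.eventually_sub_le_of_hasFDerivAt
    (D := (Real.sqrt (1 + ‖x‖ ^ 2))⁻¹ • LocalMetric.stdForm (EuclideanSpace ℝ (Fin 4)) x) ?_ ?_ hε
  · have e2 : ⇑(extChartAt 𝓘(ℝ, EuclideanSpace ℝ (Fin 4)) x).symm =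
        (id : EuclideanSpace ℝ (Fin 4) → EuclideanSpace ℝ (Fin 4)) := by
      rw [extChartAt_model_space_eq_id]
      rfl
    have e3 : (fun x : EuclideanSpace ℝ (Fin 4) => Real.sqrt (1 + ‖x‖ ^ 2)) ∘
        (extChartAt 𝓘(ℝ, EuclideanSpace ℝ (Fin 4)) x).symm =
        fun x : EuclideanSpace ℝ (Fin 4) => Real.sqrt (1 + ‖x‖ ^ 2) := by
      rw [e2]; rfl
    rw [← e3] at hd
    exact hd
  · intro (ζ : EuclideanSpace ℝ (Fin 4))
    refine (le_abs_self _).trans (Real.abs_le_sqrt ?_)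
    have h1 := LocalMetric.taubNUT_ge LocalMetric.inner_complexJ LocalMetric.complexJ_complexJ x ζ
    change _ ≤ LocalMetric.taubNUT LocalMetric.complexJ x ζ ζ
    refine le_trans ?_ h1
    change ((Real.sqrt (1 + ‖x‖ ^ 2))⁻¹ * inner ℝ x ζ) ^ 2 ≤ _
    rw [mul_pow, inv_pow, Real.sq_sqrt (by positivity)]
    have h2 : (1 + ‖x‖ ^ 2)⁻¹ ≤ 1 := inv_le_one_of_one_le₀ (by nlinarith [sq_nonneg ‖x‖])
    have h3 : 0 ≤ (1 + ‖x‖ ^ 2)⁻¹ * ‖ζ‖ ^ 2 := by positivity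
    nlinarith [sq_nonneg (inner ℝ x ζ)]

theorem exists_compact_taubNUT (R : ℝ) : ∃ K : Set (EuclideanSpace ℝ (Fin 4)), IsCompact K ∧
    ∀ x : EuclideanSpace ℝ (Fin 4), Real.sqrt (1 + ‖x‖ ^ 2) ≤ R → x ∈ K := by
  obtain ⟨K, hK, h⟩ := exists_compact_norm_le (E := EuclideanSpace ℝ (Fin 4)) R
  refine ⟨K, hK, fun x hx => h x (le_trans ?_ hx)⟩
  exact Real.le_sqrt_of_sq_le (by linarith)

theorem hasCompactBalls_taubNUT : taubNUT.HasCompactBalls :=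
  hasCompactBalls_of_lipschitz lipschitz_taubNUT exists_compact_taubNUT

theorem isComplete_taubNUT : taubNUT.IsComplete :=
  isComplete_of_lipschitz _ lipschitz_taubNUT exists_compact_taubNUT

theorem isRicciFlat_circle : (roundSphere 1).IsRicciFlat := by
  intro x u v
  have := (hasCurvatureAt_sphere 1 x (extChartAt (roundSphere 1).I x x)).ricci_eq
    ((roundSphere 1).isMetricAt_coordMetric_self x) u v
  refine this.trans ?_
  have h : ((Module.finrank ℝ (EuclideanSpace ℝ (Fin 1)) : ℕ) : ℝ) - 1 = 0 := by simp
  refine (congrArg (· * _) ((congrArg ((1 : ℝ) * ·) h).trans (mul_zero 1))).trans (zero_mul _)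

theorem rmSq_circle (x : (roundSphere 1).M) : (roundSphere 1).rmSq x = 0 := by
  rw [rmSq_of_hasCurvatureAt (hasCurvatureAt_sphere 1 x (extChartAt (roundSphere 1).I x x)), dim_roundSphere]
  simp

end examples

end RiemMfd

/-! ### Ricci-flat products with small circles -/

namespace RiemMfd

/-- Complete Ricci-flat manifolds of every dimension at least four with prescribed maximum of the
curvature: rescaled products of the Taub-NUT manifold with Euclidean spaces. -/
theorem exists_ricciFlat_rmNorm_max (k : ℕ) {a : ℝ} (ha : 0 < a) :
    ∃ N : RiemMfd, N.dim = 4 + k ∧ ConnectedSpace N.M ∧ N.IsComplete ∧ N.IsRicciFlat ∧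
      N.HasCompactBalls ∧ ∃ p : N.M, N.rmNorm p = a ∧ ∀ x, N.rmNorm x ≤ a := by
  let B := taubNUT.prod (euclidean k)
  -- the scaling factor is chosen such that the maximum of the curvature becomes `a`
  let c : ℝ := Real.sqrt (Real.sqrt 384 / a)
  have hc : 0 < c := Real.sqrt_pos.2 (by positivity)
  have hc2 : c⁻¹ ^ 2 = a / Real.sqrt 384 := by
    rw [inv_pow, Real.sq_sqrt (by positivity), inv_div]
  let N := B.rescale c hc
  have hrm : ∀ (x : EuclideanSpace ℝ (Fin 4)) (y : (euclidean k).M),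
      N.rmNorm (show N.M from (x, y)) = a * Real.sqrt ((1 + ‖x‖ ^ 2)⁻¹ ^ 6) := by
    intro x y
    have h1 : N.rmSq (show N.M from (x, y)) = (c⁻¹ ^ 2) ^ 2 * (384 * (1 + ‖x‖ ^ 2)⁻¹ ^ 6) := by
      refine (B.rmSq_rescale c hc (show B.M from (x, y))).trans ?_
      rw [taubNUT.rmSq_prod (euclidean k) x y, rmSq_euclidean, rmSq_taubNUT, add_zero]
    rw [rmNorm_eq_sqrt, h1, Real.sqrt_mul (sq_nonneg _), Real.sqrt_sq (by positivity), hc2,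
      Real.sqrt_mul (by norm_num)]
    field_simp
  have hc4 : ConnectedSpace taubNUT.M :=
    inferInstanceAs (ConnectedSpace (EuclideanSpace ℝ (Fin 4)))
  have hck : ConnectedSpace (euclidean k).M :=
    inferInstanceAs (ConnectedSpace (EuclideanSpace ℝ (Fin k)))
  have hcN : ConnectedSpace N.M := inferInstanceAs (ConnectedSpace (taubNUT.M × (euclidean k).M))
  have hdim : N.dim = 4 + k := by
    refine (taubNUT.dim_prod (euclidean k)).trans ?_
    rw [dim_taubNUT, dim_euclidean]
  have hNc : N.IsComplete := (isComplete_taubNUT.prod (isComplete_euclidean k)).rescale c hc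
  have hNr : N.IsRicciFlat := (isRicciFlat_taubNUT.prod (isRicciFlat_euclidean k)).rescale c hc
  have hNb : N.HasCompactBalls :=
    (hasCompactBalls_taubNUT.prod (hasCompactBalls_euclidean k)).rescale c hc
  let p : N.M := ((0 : EuclideanSpace ℝ (Fin 4)), (0 : EuclideanSpace ℝ (Fin k)))
  have hp : N.rmNorm p = a := by
    refine (hrm 0 _).trans ?_
    simp
  have hmax : ∀ x, N.rmNorm x ≤ a := by
    rintro ⟨(x : EuclideanSpace ℝ (Fin 4)), y⟩
    refine (hrm x y).trans_le ?_
    have h1 : (1 + ‖x‖ ^ 2)⁻¹ ≤ 1 :=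
      inv_le_one_of_one_le₀ (le_add_of_nonneg_right (sq_nonneg _))
    have h2 : Real.sqrt ((1 + ‖x‖ ^ 2)⁻¹ ^ 6) ≤ 1 :=
      Real.sqrt_le_one.2 (pow_le_one₀ (by positivity) h1)
    nlinarith
  exact ⟨N, hdim, hcN, hNc, hNr, hNb, p, hp, hmax⟩

theorem rmNorm_prod_circle (N : RiemMfd) {θ : ℝ} (hθ : 0 < θ) (x : N.M) (q : (roundSphere 1).M) :
    (N.prod ((roundSphere 1).rescale θ hθ)).rmNorm
        (show (N.prod ((roundSphere 1).rescale θ hθ)).M from (x, q)) = N.rmNorm x := by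
  have hS : ((roundSphere 1).rescale θ hθ).rmSq q = 0 :=
    ((roundSphere 1).rmSq_rescale θ hθ q).trans ((congrArg _ (rmSq_circle q)).trans (mul_zero _))
  have h := N.rmSq_prod ((roundSphere 1).rescale θ hθ) x q
  rw [hS, add_zero] at h
  exact congrArg Real.sqrt h

theorem dim_prod_circle (N : RiemMfd) {θ : ℝ} (hθ : 0 < θ) :
    (N.prod ((roundSphere 1).rescale θ hθ)).dim = N.dim + 1 := by
  rw [dim_prod, dim_rescale, dim_roundSphere]

/-- A ball of a product is contained in the product of a ball and the second factor. -/
theorem vol_ball_prod_le (X Y : RiemMfd) (x : X.M) (y : Y.M) (r : ℝ) :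
    (X.prod Y).vol ((X.prod Y).ball (show (X.prod Y).M from (x, y)) r) ≤
      X.vol (X.ball x r) * Y.vol Set.univ :=
  (measure_mono ((X.ball_prod_subset Y (x, y) r).trans
    (Set.prod_mono_right (Set.subset_univ _)))).trans (X.vol_prod_le Y _ _)

/-- The energy of a product with a circle is at most proportional to the length of the circle. -/
theorem energy_prod_circle_le (N : RiemMfd) {a θ : ℝ} (hθ : 0 < θ) (h : ∀ x, N.rmNorm x ≤ a)
    (p : N.M) (q : (roundSphere 1).M) :
    (N.prod ((roundSphere 1).rescale θ hθ)).energy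
        (show (N.prod ((roundSphere 1).rescale θ hθ)).M from (p, q)) 1 ≤
      ENNReal.ofReal θ * (ENNReal.ofReal (a ^ (((N.dim + 1 : ℕ) : ℝ) / 2)) *
        (N.vol (N.ball p 1) * (roundSphere 1).vol Set.univ)) := by
  have hX : ∀ x : (N.prod ((roundSphere 1).rescale θ hθ)).M,
      (N.prod ((roundSphere 1).rescale θ hθ)).rmNorm x ≤ a := by
    rintro ⟨x, q⟩
    exact (N.rmNorm_prod_circle hθ x q).trans_le (h x)
  refine (energy_le hX (show (N.prod ((roundSphere 1).rescale θ hθ)).M from (p, q)) 1).trans ?_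
  rw [dim_prod_circle]
  have hball := (N.vol_ball_prod_le ((roundSphere 1).rescale θ hθ) p q 1).trans
    (mul_le_mul_right ((roundSphere 1).vol_rescale_le θ hθ Set.univ) _)
  rw [dim_roundSphere, pow_one] at hball
  refine (mul_le_mul_right hball _).trans (le_of_eq ?_)
  ring

/-- Complete Ricci-flat manifolds times small circles: the curvature is bounded below at a point while
the energy is arbitrarily small. -/
theorem exists_ricciFlat_collapsing (n : ℕ) (hn : 5 ≤ n) (a : ℝ) (ha : 0 < a) :
    ∃ N : RiemMfd, N.dim + 1 = n ∧ ConnectedSpace N.M ∧ N.IsComplete ∧ N.IsRicciFlat ∧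
      ∃ p : N.M, N.rmNorm p = a ∧ (∀ x, N.rmNorm x ≤ a) ∧
      ∀ ε : ℝ, 0 < ε → ∃ θ₀ : ℝ, 0 < θ₀ ∧ ∀ (θ : ℝ) (hθ : 0 < θ), θ ≤ θ₀ →
        let X := N.prod ((RiemMfd.roundSphere 1).rescale θ hθ)
        X.dim = n ∧ ConnectedSpace X.M ∧ X.IsComplete ∧ X.IsRicciFlat ∧
        ∀ q : Metric.sphere (0 : EuclideanSpace ℝ (Fin (1 + 1))) 1,
          X.rmNorm (p, q) = a ∧ X.energy (p, q) 1 ≤ ENNReal.ofReal ε := by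
  obtain ⟨k, rfl⟩ := Nat.exists_eq_add_of_le hn
  obtain ⟨N, hdim, hcN, hNc, hNr, hNb, p, hp, hmax⟩ := exists_ricciFlat_rmNorm_max k ha
  refine ⟨N, by rw [hdim]; ring, hcN, hNc, hNr, p, hp, hmax, fun ε hε => ?_⟩
  let C : ℝ≥0∞ := ENNReal.ofReal (a ^ (((N.dim + 1 : ℕ) : ℝ) / 2)) *
    (N.vol (N.ball p 1) * (roundSphere 1).vol Set.univ)
  have hC : C ≠ ⊤ := ENNReal.mul_ne_top ENNReal.ofReal_ne_top
    (ENNReal.mul_ne_top (hNb.vol_ball_lt_top p 1).ne (vol_roundSphere_lt_top 1 _).ne)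
  have hC0 : 0 ≤ C.toReal := ENNReal.toReal_nonneg
  refine ⟨ε / (C.toReal + 1), by positivity, fun θ hθ hθε => ?_⟩
  have hcS := connectedSpace_roundSphere 1 le_rfl
  refine ⟨(N.dim_prod_circle hθ).trans (by rw [hdim]; ring), ?_,
    hNc.prod ((isComplete_roundSphere 1).rescale θ hθ),
    hNr.prod (isRicciFlat_circle.rescale θ hθ),
    fun q => ⟨(N.rmNorm_prod_circle hθ p q).trans hp, ?_⟩⟩
  · exact inferInstanceAs (ConnectedSpace (N.M × (roundSphere 1).M))
  · refine (N.energy_prod_circle_le hθ hmax p q).trans ?_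
    change ENNReal.ofReal θ * C ≤ _
    rw [← ENNReal.ofReal_toReal hC, ← ENNReal.ofReal_mul hθ.le]
    refine ENNReal.ofReal_le_ofReal ?_
    rw [le_div_iff₀ (by positivity)] at hθε
    nlinarith [hθ.le]

end RiemMfd

/-! ### The quotient of the upper half plane by the principal congruence subgroup of level three -/

theorem LocalMetric.form_ext {E : Type} [NormedAddCommGroup E] [NormedSpace ℝ E]
    {B C : E →L[ℝ] E →L[ℝ] ℝ} (h : ∀ u v, B u v = C u v) : B = C :=
  ContinuousLinearMap.ext fun u => ContinuousLinearMap.ext fun v => h u v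

namespace LevelThree

open scoped MatrixGroups UpperHalfPlane
open CongruenceSubgroup

instance : ContinuousConstSMul SL(2, ℤ) ℍ :=
  ⟨fun g => continuous_const_smul (Matrix.SpecialLinearGroup.toGL
    (Matrix.SpecialLinearGroup.map (algebraMap ℤ ℝ) g))⟩

instance : SMulInvariantMeasure SL(2, ℤ) ℍ volume :=
  ⟨fun g _ hs => SMulInvariantMeasure.measure_preimage_smul (μ := (volume : Measure ℍ))
    (Matrix.SpecialLinearGroup.toGL (Matrix.SpecialLinearGroup.map (algebraMap ℤ ℝ) g)) hs⟩

instance : ProperlyDiscontinuousSMul SL(2, ℤ) ℍ := by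
  have h := properlyDiscontinuousSL2ZRange
  rw [Subgroup.properlyDiscontinuousSMul_iff] at h
  constructor
  intro K L hK hL
  have hinj : Function.Injective (fun g : SL(2, ℤ) => (Matrix.SpecialLinearGroup.toGL
      (Matrix.SpecialLinearGroup.map (Int.castRingHom ℝ) g) : GL (Fin 2) ℝ)) := by
    intro g g' h
    ext i j
    have h1 := congrArg (fun A : GL (Fin 2) ℝ => A.1 i j) h
    have h2 : ((g i j : ℤ) : ℝ) = ((g' i j : ℤ) : ℝ) := by simpa using h1
    exact_mod_cast h2
  refine (Set.Finite.preimage hinj.injOn (h hK hL)).subset fun g hg => ?_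
  exact ⟨⟨g, rfl⟩, hg⟩

/-- An element of `Γ(3)` has trace congruent to two modulo nine. -/
theorem exists_trace_eq {g : SL(2, ℤ)} (hg : g ∈ Gamma 3) : ∃ m : ℤ, g 0 0 + g 1 1 = 2 + 9 * m := by
  obtain ⟨h1, h2, h3, h4⟩ := Gamma_mem.1 hg
  have e1 : ((g 0 0 - 1 : ℤ) : ZMod 3) = 0 := by push_cast; rw [h1, sub_self]
  have e4 : ((g 1 1 - 1 : ℤ) : ZMod 3) = 0 := by push_cast; rw [h4, sub_self]
  obtain ⟨a, ha⟩ := (ZMod.intCast_zmod_eq_zero_iff_dvd _ 3).1 e1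
  obtain ⟨b, hb⟩ := (ZMod.intCast_zmod_eq_zero_iff_dvd _ 3).1 h2
  obtain ⟨c, hc⟩ := (ZMod.intCast_zmod_eq_zero_iff_dvd _ 3).1 h3
  obtain ⟨d, hd⟩ := (ZMod.intCast_zmod_eq_zero_iff_dvd _ 3).1 e4
  have hdet := g.2
  rw [Matrix.det_fin_two] at hdet
  have ha' : g 0 0 = 1 + 3 * a := by push_cast at ha; linarith
  have hd' : g 1 1 = 1 + 3 * d := by push_cast at hd; linarith
  push_cast at hb hc
  change g 0 0 * g 1 1 - g 0 1 * g 1 0 = 1 at hdet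
  rw [ha', hd', hb, hc] at hdet
  refine ⟨b * c - a * d, ?_⟩
  rw [ha', hd']
  linarith

/-- The group `Γ(3)` acts freely: the trace of an element with a fixed point has absolute value at most
two, so that it equals two by the congruence modulo nine, and then the element is the identity. -/
theorem eq_one_of_smul_eq {g : SL(2, ℤ)} (hg : g ∈ Gamma 3) {z : ℍ} (h : g • z = z) : g = 1 := by
  have hdet := g.2
  rw [Matrix.det_fin_two] at hdet
  change g 0 0 * g 1 1 - g 0 1 * g 1 0 = 1 at hdet
  have h1 := congrArg UpperHalfPlane.coe h
  rw [UpperHalfPlane.coe_specialLinearGroup_apply] at h1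
  have hden : ((g 1 0 : ℝ) : ℂ) * z + ((g 1 1 : ℝ) : ℂ) ≠ 0 := by
    have := UpperHalfPlane.denom_ne_zero (Matrix.SpecialLinearGroup.toGL
      (Matrix.SpecialLinearGroup.map (algebraMap ℤ ℝ) g)) z
    simpa [UpperHalfPlane.denom] using this
  have hq : (z : ℂ) * (((g 1 0 : ℝ) : ℂ) * z + ((g 1 1 : ℝ) : ℂ)) =
      ((g 0 0 : ℝ) : ℂ) * z + ((g 0 1 : ℝ) : ℂ) := by
    rw [div_eq_iff (by simpa using hden)] at h1
    simpa using h1.symm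
  have hy := z.im_pos
  have hre := congrArg Complex.re hq
  have him := congrArg Complex.im hq
  simp only [Complex.mul_re, Complex.mul_im, Complex.add_re, Complex.add_im, Complex.ofReal_re,
    Complex.ofReal_im, UpperHalfPlane.coe_re, UpperHalfPlane.coe_im, zero_mul, add_zero, sub_zero]
    at hre him
  have hdet' : (g 0 0 : ℝ) * g 1 1 - g 0 1 * g 1 0 = 1 := by exact_mod_cast hdet
  obtain ⟨m, hm⟩ := exists_trace_eq hg
  -- the imaginary part gives `a = d + 2 c x`
  have ha : (g 0 0 : ℝ) = g 1 1 + 2 * g 1 0 * z.re := by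
    have : z.im * ((g 0 0 : ℝ) - (g 1 1 + 2 * g 1 0 * z.re)) = 0 := by nlinarith
    rcases mul_eq_zero.1 this with h | h
    · exact absurd h hy.ne'
    · linarith
  have hb : (g 0 1 : ℝ) = -(g 1 0 : ℝ) * (z.re ^ 2 + z.im ^ 2) := by
    rw [ha] at hre
    nlinarith
  have htr : ((g 0 0 : ℝ) + g 1 1) ^ 2 = 4 - 4 * (g 1 0 : ℝ) ^ 2 * z.im ^ 2 := by
    rw [hb] at hdet'
    rw [ha] at hdet' ⊢
    nlinarith
  have hle : (g 0 0 + g 1 1) ^ 2 ≤ 4 := by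
    have : ((g 0 0 : ℝ) + g 1 1) ^ 2 ≤ 4 := by
      rw [htr]
      nlinarith [mul_nonneg (sq_nonneg (g 1 0 : ℝ)) (sq_nonneg z.im)]
    exact_mod_cast this
  have hm0 : m = 0 := by
    rw [hm] at hle
    have h1 : m ≤ 0 := by nlinarith
    have h2 : -1 < m := by nlinarith
    omega
  have htr2 : (g 0 0 : ℝ) + g 1 1 = 2 := by
    rw [hm0] at hm
    exact_mod_cast hm
  have hc : (g 1 0 : ℝ) = 0 := by
    rw [htr2] at htr
    have : (g 1 0 : ℝ) * z.im = 0 := by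
      have : ((g 1 0 : ℝ) * z.im) ^ 2 = 0 := by nlinarith
      exact pow_eq_zero_iff two_ne_zero |>.1 this
    exact (mul_eq_zero.1 this).resolve_right hy.ne'
  rw [hc] at ha hb
  have e10 : g 1 0 = 0 := by exact_mod_cast hc
  have e01 : g 0 1 = 0 := by
    have : (g 0 1 : ℝ) = 0 := by rw [hb]; ring
    exact_mod_cast this
  have e00 : g 0 0 = 1 := by
    have : (g 0 0 : ℝ) = 1 := by linarith
    exact_mod_cast this
  have e11 : g 1 1 = 1 := by
    have : (g 1 1 : ℝ) = 1 := by linarith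
    exact_mod_cast this
  ext i j
  fin_cases i <;> fin_cases j
  · exact e00
  · exact e01
  · exact e10
  · exact e11

instance : ContinuousConstSMul (Gamma 3) ℍ := ⟨fun g => continuous_const_smul (g : SL(2, ℤ))⟩

instance : IsCancelSMul (Gamma 3) ℍ where
  left_cancel' g _ _ h := MulAction.injective g h
  right_cancel' a b z h := by
    have h1 : (b⁻¹ * a) • z = z := by rw [mul_smul, h, inv_smul_smul]
    have h2 := eq_one_of_smul_eq (b⁻¹ * a).2 h1
    exact (inv_mul_eq_one.1 (Subtype.ext h2)).symm

/-- The quotient `Γ(3) \ ℍ`. -/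
abbrev Surface : Type := MulAction.orbitRel.Quotient (Gamma 3) ℍ

instance : T2Space Surface := t2Space_of_properlyDiscontinuousSMul_of_t2Space
instance : SecondCountableTopology Surface := ContinuousConstSMul.secondCountableTopology

/-- The projection `ℍ → Γ(3) \ ℍ`. -/
def proj : ℍ → Surface := Quotient.mk _

theorem isLocalHomeomorph_proj : IsLocalHomeomorph proj :=
  isQuotientCoveringMap_quotientMk_of_properlyDiscontinuousSMul.isCoveringMap.isLocalHomeomorph

theorem surjective_proj : Function.Surjective proj := Quotient.mk_surjective

theorem continuous_proj : Continuous proj := isLocalHomeomorph_proj.continuous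

theorem proj_eq_iff {z w : ℍ} : proj z = proj w ↔ ∃ g ∈ Gamma 3, g • w = z := by
  refine Quotient.eq.trans ?_
  constructor
  · rintro ⟨g, hg⟩
    exact ⟨g, g.2, hg⟩
  · rintro ⟨g, hg, h⟩
    exact ⟨⟨g, hg⟩, h⟩

/-- The lift of a point at which its preferred chart is based. -/
def lift : Surface → ℍ := surjective_proj.hasRightInverse.choose

theorem proj_lift (x : Surface) : proj (lift x) = x :=
  surjective_proj.hasRightInverse.choose_spec x

/-- The sheet over the domain of the preferred chart at `x`. -/
def sheet (x : Surface) : Set ℍ := (isLocalHomeomorph_proj.localInverseAt (lift x)).target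

theorem chartAt_eq (x : Surface) : chartAt ℂ x =
    (isLocalHomeomorph_proj.localInverseAt (lift x)).trans (chartAt ℂ (lift x)) := rfl

theorem isOpen_sheet (x : Surface) : IsOpen (sheet x) :=
  (isLocalHomeomorph_proj.localInverseAt (lift x)).open_target

theorem lift_mem_sheet (x : Surface) : lift x ∈ sheet x :=
  isLocalHomeomorph_proj.self_mem_localInverseAt_target

theorem injOn_sheet (x : Surface) : Set.InjOn proj (sheet x) :=
  isLocalHomeomorph_proj.injOn_localInverseAt_target

theorem chartAt_coe (p q : ℍ) : chartAt ℂ p q = (q : ℂ) := rfl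

theorem chartAt_source (p : ℍ) : (chartAt ℂ p).source = Set.univ := rfl

theorem chartAt_symm_coe (p q : ℍ) : (chartAt ℂ p).symm (q : ℂ) = q :=
  (chartAt ℂ p).left_inv (Set.mem_univ q)

theorem extChartAt_symm_coe (x : Surface) (p : ℍ) :
    (extChartAt 𝓘(ℝ, ℂ) x).symm (p : ℂ) = proj p := by
  have : ⇑(extChartAt 𝓘(ℝ, ℂ) x).symm =
    (isLocalHomeomorph_proj.localInverseAt (lift x)).symm ∘ (chartAt ℂ (lift x)).symm := rfl
  rw [this, isLocalHomeomorph_proj.localInverseAt_symm, Function.comp_apply, chartAt_symm_coe]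

theorem source_eq (x : Surface) :
    (extChartAt 𝓘(ℝ, ℂ) x).source = proj '' sheet x := by
  rw [extChartAt_source, chartAt_eq, OpenPartialHomeomorph.trans_source, chartAt_source,
    Set.preimage_univ, Set.inter_univ,
    ← (isLocalHomeomorph_proj.localInverseAt (lift x)).symm_image_target_eq_source,
    isLocalHomeomorph_proj.localInverseAt_symm]
  rfl

theorem extChartAt_proj {x : Surface} {p : ℍ} (hp : p ∈ sheet x) :
    extChartAt 𝓘(ℝ, ℂ) x (proj p) = p := by
  have : ⇑(extChartAt 𝓘(ℝ, ℂ) x) =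
    chartAt ℂ (lift x) ∘ (isLocalHomeomorph_proj.localInverseAt (lift x)) := rfl
  rw [this, Function.comp_apply, chartAt_coe]
  congr 1
  have h := (isLocalHomeomorph_proj.localInverseAt (lift x)).right_inv hp
  rwa [isLocalHomeomorph_proj.localInverseAt_symm] at h

theorem target_eq (x : Surface) :
    (extChartAt 𝓘(ℝ, ℂ) x).target = UpperHalfPlane.coe '' sheet x := by
  rw [← (extChartAt 𝓘(ℝ, ℂ) x).image_source_eq_target, source_eq, Set.image_image]
  exact Set.image_congr fun p hp => extChartAt_proj hp

theorem extChartAt_self (x : Surface) : extChartAt 𝓘(ℝ, ℂ) x x = lift x := by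
  conv_lhs => rw [← proj_lift x]
  rw [proj_lift]
  conv_lhs => arg 2; rw [← proj_lift x]
  exact extChartAt_proj (lift_mem_sheet x)

/-- The action of `g` in the coordinate of `ℂ`. -/
def moebius (g : SL(2, ℤ)) (z : ℂ) : ℂ := ↑(g • UpperHalfPlane.ofComplex z)

/-- The complex derivative of `moebius g`. -/
def moebiusDeriv (g : SL(2, ℤ)) (p : ℍ) : ℂ :=
  1 / UpperHalfPlane.denom (Matrix.SpecialLinearGroup.toGL
    (Matrix.SpecialLinearGroup.map (algebraMap ℤ ℝ) g)) p ^ 2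

theorem det_toGL (g : SL(2, ℤ)) : (Matrix.SpecialLinearGroup.toGL
    (Matrix.SpecialLinearGroup.map (algebraMap ℤ ℝ) g)).val.det = 1 :=
  (Matrix.SpecialLinearGroup.map (algebraMap ℤ ℝ) g).2

theorem hasDerivAt_moebius (g : SL(2, ℤ)) (p : ℍ) :
    HasDerivAt (moebius g) (moebiusDeriv g p) p := by
  have h := (UpperHalfPlane.hasStrictDerivAt_smul (g := Matrix.SpecialLinearGroup.toGL
    (Matrix.SpecialLinearGroup.map (algebraMap ℤ ℝ) g))
    (by rw [det_toGL]; exact one_pos) p).hasDerivAt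
  rw [det_toGL, Complex.ofReal_one] at h
  exact h

theorem contDiffAt_moebius (g : SL(2, ℤ)) (p : ℍ) : ContDiffAt ℝ ∞ (moebius g) p := by
  have h := (UpperHalfPlane.analyticAt_smul (g := Matrix.SpecialLinearGroup.toGL
    (Matrix.SpecialLinearGroup.map (algebraMap ℤ ℝ) g))
    (by rw [det_toGL]; exact one_pos) p).contDiffAt (n := ∞)
  exact h.restrict_scalars ℝ

/-- Elements of `SL(2, ℤ)` act by isometries of the metric `|dz|² / y²`. -/
theorem norm_moebiusDeriv (g : SL(2, ℤ)) (p : ℍ) :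
    ‖moebiusDeriv g p‖ = (g • p).im / p.im := by
  have h : (g • p).im = _ := ModularGroup.im_smul_eq_div_normSq g p
  have hp := p.im_pos
  rw [h, moebiusDeriv, norm_div, norm_one, norm_pow, Complex.normSq_eq_norm_sq]
  field_simp
  rfl

/-- The changes of coordinates are given by elements of `Γ(3)`. -/
theorem transition {x y : Surface} {p : ℍ} (hp : proj p ∈ (extChartAt 𝓘(ℝ, ℂ) y).source) :
    ∃ g ∈ Gamma 3, g • p ∈ sheet y ∧ (fun w => extChartAt 𝓘(ℝ, ℂ) y
      ((extChartAt 𝓘(ℝ, ℂ) x).symm w)) =ᶠ[𝓝 (p : ℂ)] moebius g := by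
  rw [source_eq] at hp
  obtain ⟨q, hq, hqp⟩ := hp
  obtain ⟨g, hg, rfl⟩ := proj_eq_iff.1 hqp
  refine ⟨g, hg, hq, ?_⟩
  have h1 : ∀ᶠ p' in 𝓝 p, g • p' ∈ sheet y :=
    (continuous_const_smul g).continuousAt ((isOpen_sheet y).mem_nhds hq)
  rw [← UpperHalfPlane.isOpenEmbedding_coe.map_nhds_eq]
  refine eventually_map.2 (h1.mono fun p' hp' => ?_)
  change extChartAt 𝓘(ℝ, ℂ) y ((extChartAt 𝓘(ℝ, ℂ) x).symm (p' : ℂ)) = moebius g p'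
  rw [extChartAt_symm_coe, moebius, UpperHalfPlane.ofComplex_apply,
    ← proj_eq_iff.2 ⟨g, hg, rfl⟩]
  exact extChartAt_proj hp'

instance : IsManifold 𝓘(ℝ, ℂ) ∞ Surface := by
  refine isManifold_of_contDiffOn _ _ _ fun e e' he he' => ?_
  obtain ⟨x, rfl⟩ := he
  obtain ⟨y, rfl⟩ := he'
  rintro z ⟨hz, -⟩
  have hz' : z ∈ ((extChartAt 𝓘(ℝ, ℂ) x).symm ≫ extChartAt 𝓘(ℝ, ℂ) y).source := by
    rw [PartialEquiv.trans_source, PartialEquiv.symm_source]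
    refine ⟨?_, ?_⟩
    · rw [_root_.extChartAt_target]
      exact ⟨hz.1, Set.mem_range_self _⟩
    · rw [Set.mem_preimage, extChartAt_source]
      exact hz.2
  rw [PartialEquiv.trans_source, PartialEquiv.symm_source, target_eq] at hz'
  obtain ⟨⟨p, hp, rfl⟩, hp2⟩ := hz'
  rw [Set.mem_preimage, extChartAt_symm_coe] at hp2
  obtain ⟨g, -, -, h⟩ := transition (x := x) hp2
  exact ((contDiffAt_moebius g p).congr_of_eventuallyEq h).contDiffWithinAt

/-- The hyperbolic metric at `x`, in the preferred chart at `x`. -/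
def metric (x : Surface) : TangentSpace 𝓘(ℝ, ℂ) x →L[ℝ] TangentSpace 𝓘(ℝ, ℂ) x →L[ℝ] ℝ :=
  (((lift x).im ^ 2)⁻¹ : ℝ) • LocalMetric.stdForm ℂ

/-- The preferred chart at `proj p` differs from the one at `x` by an element `g` of `Γ(3)`, so that the
differential of the inverse of the latter is multiplication by the derivative of `g`. -/
theorem mfderiv_symm {x : Surface} {p : ℍ} (hp : p ∈ sheet x) :
    ∃ g ∈ Gamma 3, lift (proj p) = g • p ∧
      ∀ v : ℂ, mfderiv 𝓘(ℝ, ℂ) 𝓘(ℝ, ℂ) (extChartAt 𝓘(ℝ, ℂ) x).symm (p : ℂ) v =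
        moebiusDeriv g p * v := by
  have hp2 : (p : ℂ) ∈ (extChartAt 𝓘(ℝ, ℂ) x).target := by
    rw [target_eq]
    exact ⟨p, hp, rfl⟩
  obtain ⟨g, hg, hgp, h⟩ := transition (x := x) (mem_extChartAt_source (I := 𝓘(ℝ, ℂ)) (proj p))
  have hl : lift (proj p) = g • p :=
    injOn_sheet _ (lift_mem_sheet _) hgp ((proj_lift _).trans (proj_eq_iff.2 ⟨g⁻¹, inv_mem hg, by simp⟩))
  refine ⟨g, hg, hl, fun v => ?_⟩
  have hd : MDifferentiableAt 𝓘(ℝ, ℂ) 𝓘(ℝ, ℂ) (extChartAt 𝓘(ℝ, ℂ) x).symm (p : ℂ) :=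
    (contMDiffAt_extChartAt_symm hp2).mdifferentiableAt (by simp)
  have hf : HasFDerivAt (fun w => extChartAt 𝓘(ℝ, ℂ) (proj p) ((extChartAt 𝓘(ℝ, ℂ) x).symm w))
      (((ContinuousLinearMap.toSpanSingleton ℂ (moebiusDeriv g p)).restrictScalars ℝ) : ℂ →L[ℝ] ℂ) (p : ℂ) :=
    ((hasDerivAt_moebius g p).hasFDerivAt.restrictScalars ℝ).congr_of_eventuallyEq h
  have e : writtenInExtChartAt 𝓘(ℝ, ℂ) 𝓘(ℝ, ℂ) (p : ℂ) (extChartAt 𝓘(ℝ, ℂ) x).symm =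
      fun w => extChartAt 𝓘(ℝ, ℂ) (proj p) ((extChartAt 𝓘(ℝ, ℂ) x).symm w) := by
    simp only [writtenInExtChartAt, extChartAt_symm_coe]
    rfl
  have key : fderivWithin ℝ (writtenInExtChartAt 𝓘(ℝ, ℂ) 𝓘(ℝ, ℂ) (p : ℂ)
      (extChartAt 𝓘(ℝ, ℂ) x).symm) (Set.range 𝓘(ℝ, ℂ)) (extChartAt 𝓘(ℝ, ℂ) (p : ℂ) p) v =
      moebiusDeriv g p * v := by
    rw [e, modelWithCornersSelf_coe, Set.range_id, fderivWithin_univ]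
    refine (DFunLike.congr_fun hf.fderiv v).trans ?_
    simp [mul_comm]
  exact (congrArg (fun T : ℂ →L[ℝ] ℂ => T v) hd.mfderiv).trans key

theorem inner_mul_mul (d u v : ℂ) : inner ℝ (d * u) (d * v) = ‖d‖ ^ 2 * inner ℝ u v := by
  simp only [Complex.inner, ← Complex.normSq_eq_norm_sq, Complex.normSq_apply, map_mul,
    Complex.mul_re, Complex.mul_im, Complex.conj_re, Complex.conj_im]
  ring

/-- In every preferred chart the metric is `|dz|² / y²`, by the invariance of this metric. -/
theorem pullbackForm_metric {x : Surface} {p : ℍ} (hp : p ∈ sheet x) :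
    pullbackForm (V := ℂ) (metric ((extChartAt 𝓘(ℝ, ℂ) x).symm p))
      (mfderiv 𝓘(ℝ, ℂ) 𝓘(ℝ, ℂ) (extChartAt 𝓘(ℝ, ℂ) x).symm (p : ℂ)) =
      ((p.im ^ 2)⁻¹ : ℝ) • LocalMetric.stdForm ℂ := by
  obtain ⟨g, hg, hl, h⟩ := mfderiv_symm hp
  have hp0 := p.im_pos
  have hg0 := (g • p).im_pos
  have key : ∀ u v : ℂ, metric (proj p) (moebiusDeriv g p * u : ℂ) (moebiusDeriv g p * v : ℂ) =
      (p.im ^ 2)⁻¹ * inner ℝ u v := by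
    intro u v
    change ((lift (proj p)).im ^ 2)⁻¹ * inner ℝ (moebiusDeriv g p * u) (moebiusDeriv g p * v) = _
    rw [inner_mul_mul, norm_moebiusDeriv, hl]
    field_simp
  refine LocalMetric.form_ext (E := ℂ) fun u v => ?_
  have h1 : ∀ (y : Surface) (a a' b b' : ℂ), y = proj p → a = a' → b = b' →
      metric y a b = metric (proj p) a' b' := by
    rintro y a a' b b' rfl rfl rfl
    rfl
  exact (h1 _ _ _ _ _ (extChartAt_symm_coe x p) (h u) (h v)).trans (key u v)

theorem contDiffAt_inv_im_sq {z : ℂ} (hz : 0 < z.im) :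
    ContDiffAt ℝ ∞ (fun w : ℂ => (w.im ^ 2)⁻¹) z := by
  have h : ContDiff ℝ ∞ fun w : ℂ => w.im ^ 2 := Complex.imCLM.contDiff.pow 2
  exact h.contDiffAt.inv (by positivity)

theorem pos_metric (x : Surface) (v : TangentSpace 𝓘(ℝ, ℂ) x) (hv : v ≠ 0) : 0 < metric x v v :=
  (LocalMetric.isInner_smul_stdForm (E := ℂ)
    (inv_pos.2 (pow_pos (lift x).im_pos 2))).pos v hv

theorem contMDiff_metric : ContMDiff 𝓘(ℝ, ℂ) (𝓘(ℝ, ℂ).prod 𝓘(ℝ, ℂ →L[ℝ] ℂ →L[ℝ] ℝ)) ∞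
    (fun x : Surface ↦ TotalSpace.mk' (ℂ →L[ℝ] ℂ →L[ℝ] ℝ)
      (E := fun x : Surface ↦ TangentSpace 𝓘(ℝ, ℂ) x →L[ℝ] TangentSpace 𝓘(ℝ, ℂ) x →L[ℝ] ℝ) x
      (metric x)) := by
  intro x
  have hx : (lift x : ℂ) ∈ (extChartAt 𝓘(ℝ, ℂ) x).target := by
    rw [target_eq]
    exact ⟨_, lift_mem_sheet x, rfl⟩
  have h := (contMDiffAt_bilinear_iff (h := metric) hx).2 ?_
  · rwa [extChartAt_symm_coe, proj_lift] at h
  · refine ((contDiffAt_inv_im_sq (lift x).im_pos).smul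
      (contDiffAt_const (c := LocalMetric.stdForm ℂ))).congr_of_eventuallyEq ?_
    rw [← UpperHalfPlane.isOpenEmbedding_coe.map_nhds_eq]
    refine eventually_map.2 ?_
    filter_upwards [(isOpen_sheet x).mem_nhds (lift_mem_sheet x)] with p hp
    exact pullbackForm_metric hp

end LevelThree

open LevelThree

set_option synthInstance.maxHeartbeats 400000 in
/-- The surface `Γ(3) \ ℍ` with the hyperbolic metric. -/
def RiemMfd.hyperbolic : RiemMfd where
  E := ℂ
  H := ℂ
  M := Surface
  I := 𝓘(ℝ, ℂ)
  g :=
    { inner := metric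
      symm := fun x v w => (LocalMetric.isInner_smul_stdForm (E := ℂ)
        (inv_pos.2 (pow_pos (lift x).im_pos 2))).symm v w
      pos := pos_metric
      isVonNBounded := fun x => isVonNBounded_of_posDef (E := ℂ) (metric x) (pos_metric x)
      contMDiff := contMDiff_metric }

/-! ### Geometry of the hyperbolic surface -/

open scoped MatrixGroups UpperHalfPlane
open CongruenceSubgroup

namespace LevelThree

/-- The logarithm of the maximal imaginary part in an `SL(2, ℤ)`-orbit. -/
def logHeight (p : ℍ) : ℝ := Real.log ((ModularGroup.exists_max_im p).choose • p).im

theorem log_im_le_logHeight (p : ℍ) (g : SL(2, ℤ)) : Real.log (g • p).im ≤ logHeight p :=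
  Real.log_le_log (g • p).im_pos ((ModularGroup.exists_max_im p).choose_spec g)

theorem exists_logHeight_eq (p : ℍ) : ∃ g : SL(2, ℤ), logHeight p = Real.log (g • p).im :=
  ⟨_, rfl⟩

theorem logHeight_smul (g : SL(2, ℤ)) (p : ℍ) : logHeight (g • p) = logHeight p := by
  apply le_antisymm
  · obtain ⟨h, hh⟩ := exists_logHeight_eq (g • p)
    rw [hh, ← mul_smul]
    exact log_im_le_logHeight p _
  · obtain ⟨h, hh⟩ := exists_logHeight_eq p
    have := log_im_le_logHeight (g • p) (h * g⁻¹)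
    rwa [← mul_smul, inv_mul_cancel_right, ← hh] at this

theorem dist_smul_smul (g : SL(2, ℤ)) (p q : ℍ) : dist (g • p) (g • q) = dist p q :=
  dist_smul (Matrix.SpecialLinearGroup.map (algebraMap ℤ ℝ) g : SL(2, ℝ)) p q

/-- The imaginary part of a point changes at most by the factor `exp d` over the hyperbolic distance `d`. -/
theorem logHeight_sub_le (p q : ℍ) : logHeight q - logHeight p ≤ dist q p := by
  obtain ⟨g, hg⟩ := exists_logHeight_eq q
  have h1 := log_im_le_logHeight p g
  have h2 := UpperHalfPlane.dist_log_im_le (g • q) (g • p)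
  rw [dist_smul_smul, Real.dist_eq] at h2
  have := le_abs_self (Real.log (g • q).im - Real.log (g • p).im)
  linarith

theorem continuous_logHeight : Continuous logHeight := by
  refine (LipschitzWith.of_dist_le_mul (K := 1) fun p q => ?_).continuous
  rw [NNReal.coe_one, one_mul, Real.dist_eq, abs_le]
  have h1 := logHeight_sub_le p q
  have h2 := logHeight_sub_le q p
  rw [dist_comm] at h1
  constructor <;> linarith

/-- The function induced by `logHeight` on the surface. -/
def height : Surface → ℝ := Quotient.lift logHeight fun p q h => by
  obtain ⟨g, rfl⟩ := h
  exact logHeight_smul g q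

theorem height_proj (p : ℍ) : height (proj p) = logHeight p := rfl

theorem continuous_height : Continuous height := continuous_logHeight.quotient_lift _

/-- The part of the strip `|re z| ≤ 1/2` above height `t`. -/
def strip (t : ℝ) : Set ℍ := {p | |p.re| ≤ 1 / 2 ∧ t < p.im}

/-- Every orbit has a point of maximal imaginary part in the strip. -/
theorem exists_smul_strip (p : ℍ) :
    ∃ g : SL(2, ℤ), |(g • p).re| ≤ 1 / 2 ∧ Real.log (g • p).im = logHeight p := by
  obtain ⟨g, hg⟩ := exists_logHeight_eq p
  refine ⟨ModularGroup.T ^ (-round (g • p).re) * g, ?_, ?_⟩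
  · rw [mul_smul, ModularGroup.re_T_zpow_smul]
    push_cast
    exact abs_sub_round (g • p).re
  · rw [mul_smul, ModularGroup.im_T_zpow_smul, hg]

theorem log_half_le_logHeight (p : ℍ) : Real.log (1 / 2) ≤ logHeight p := by
  obtain ⟨g, hg⟩ := ModularGroup.exists_one_half_le_im_smul p
  exact (Real.log_le_log (by norm_num) hg).trans (log_im_le_logHeight p g)

/-- A finite set of representatives of the cosets of `Γ(3)`. -/
theorem exists_coset_representatives :
    ∃ s : Finset SL(2, ℤ), ∀ g : SL(2, ℤ), ∃ h ∈ s, ∃ d ∈ Gamma 3, g⁻¹ = d * h := by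
  have : Finite (SL(2, ℤ) ⧸ Gamma 3) := inferInstance
  have := Fintype.ofFinite (SL(2, ℤ) ⧸ Gamma 3)
  classical
  refine ⟨Finset.univ.image fun q : SL(2, ℤ) ⧸ Gamma 3 => (Quotient.out q)⁻¹, fun g => ?_⟩
  refine ⟨(Quotient.out (g : SL(2, ℤ) ⧸ Gamma 3))⁻¹, by simp, ?_⟩
  have h := QuotientGroup.out_eq' (g : SL(2, ℤ) ⧸ Gamma 3)
  rw [QuotientGroup.eq] at h
  refine ⟨((Quotient.out (g : SL(2, ℤ) ⧸ Gamma 3))⁻¹ * g)⁻¹, inv_mem h, ?_⟩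
  simp

end LevelThree

namespace RiemMfd
open LevelThree

theorem dim_hyperbolic : hyperbolic.dim = 2 := Complex.finrank_real_complex

theorem connectedSpace_hyperbolic : ConnectedSpace hyperbolic.M :=
  inferInstanceAs (ConnectedSpace (Quotient (MulAction.orbitRel (Gamma 3) ℍ)))

theorem coordMetric_hyperbolic (x : Surface) {p : ℍ} (hp : p ∈ sheet x) :
    hyperbolic.coordMetric x (p : ℂ) = ((p.im ^ 2)⁻¹ : ℝ) • LocalMetric.stdForm ℂ :=
  pullbackForm_metric hp

theorem coordMetric_hyperbolic_eventuallyEq (x : Surface) {p : ℍ} (hp : p ∈ sheet x) :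
    hyperbolic.coordMetric x =ᶠ[𝓝 (p : ℂ)]
      fun w : ℂ => ((w.im ^ 2)⁻¹ : ℝ) • LocalMetric.stdForm ℂ := by
  rw [← UpperHalfPlane.isOpenEmbedding_coe.map_nhds_eq]
  refine eventually_map.2 ?_
  filter_upwards [(isOpen_sheet x).mem_nhds hp] with q hq
  exact coordMetric_hyperbolic x hq

theorem hasFDerivAt_inv_im_sq {z : ℂ} (hz : z.im ≠ 0) :
    HasFDerivAt (fun w : ℂ => (w.im ^ 2)⁻¹)
      ((2 * (z.im ^ 2)⁻¹ : ℝ) • LocalMetric.stdForm ℂ (-(z.im)⁻¹ • Complex.I : ℂ)) z := by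
  have h1 : HasFDerivAt (fun w : ℂ => w.im) Complex.imCLM z := Complex.imCLM.hasFDerivAt
  have h2 := (hasDerivAt_inv (pow_ne_zero 2 hz)).comp_hasFDerivAt z (h1.pow 2)
  refine h2.congr_fderiv ?_
  ext v
  change -((z.im ^ 2) ^ 2)⁻¹ * ((2 • z.im ^ (2 - 1)) * v.im) =
    2 * (z.im ^ 2)⁻¹ * inner ℝ (-(z.im)⁻¹ • Complex.I : ℂ) v
  simp [Complex.inner]
  field_simp

theorem hasFDerivAt_inv_im_smul_I {z : ℂ} (hz : z.im ≠ 0) :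
    HasFDerivAt (fun w : ℂ => (-(w.im)⁻¹ • Complex.I : ℂ))
      ((0 : ℝ) • ContinuousLinearMap.id ℝ ℂ +
        (LocalMetric.stdForm ℂ (-(z.im)⁻¹ • Complex.I : ℂ)).smulRight (-(z.im)⁻¹ • Complex.I : ℂ)) z := by
  have h1 : HasFDerivAt (fun w : ℂ => w.im) Complex.imCLM z := Complex.imCLM.hasFDerivAt
  have h2 := (((hasDerivAt_inv hz).comp_hasFDerivAt z h1).neg).smul_const Complex.I
  refine h2.congr_fderiv ?_
  ext v
  change -(-(z.im ^ 2)⁻¹ * v.im) • Complex.I = (0 : ℝ) • v +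
    (inner ℝ (-(z.im)⁻¹ • Complex.I : ℂ) v : ℝ) • (-(z.im)⁻¹ • Complex.I : ℂ)
  simp [Complex.inner]
  field_simp

theorem hasCurvatureAt_hyperbolic (x : Surface) {p : ℍ} (hp : p ∈ sheet x) :
    LocalMetric.HasCurvatureAt (hyperbolic.coordMetric x) (p : ℂ) (-1) := by
  have key := LocalMetric.hasCurvatureAt_conformal (E := ℂ) (l := fun w : ℂ => (w.im ^ 2)⁻¹)
    (z := p) (A := fun w : ℂ => (-(w.im)⁻¹ • Complex.I : ℂ)) (β := 0)
    (coordMetric_hyperbolic_eventuallyEq x hp) ?_ (hasFDerivAt_inv_im_smul_I p.im_ne_zero)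
  · have h : -(2 * (0 : ℝ) + ‖(-((p : ℂ).im)⁻¹ • Complex.I : ℂ)‖ ^ 2) / ((p : ℂ).im ^ 2)⁻¹ = -1 := by
      have := p.im_ne_zero
      simp
      field_simp
    rw [h] at key
    exact key
  · filter_upwards [UpperHalfPlane.isOpen_upperHalfPlaneSet.mem_nhds p.im_pos] with w hw
    have hw' : 0 < w.im := hw
    exact ⟨by positivity, hasFDerivAt_inv_im_sq hw'.ne'⟩

theorem hasCurvatureAt_hyperbolic_self (x : hyperbolic.M) :
    LocalMetric.HasCurvatureAt (hyperbolic.coordMetric x) (extChartAt hyperbolic.I x x) (-1) := by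
  have h := hasCurvatureAt_hyperbolic x (lift_mem_sheet x)
  have h' : LocalMetric.HasCurvatureAt (hyperbolic.coordMetric x)
      (extChartAt 𝓘(ℝ, ℂ) (show Surface from x) x) (-1) := by
    rw [extChartAt_self]
    exact h
  exact h'

theorem hasConstantCurvature_hyperbolic : hyperbolic.HasConstantCurvature (-1) :=
  fun x u v w => hasCurvatureAt_hyperbolic_self x u v w

/-- The function `height` is `1`-Lipschitz. It is also proper, so that the surface is complete, and it
measures the depth in the cusps. -/
theorem height_lipschitz (x y : Surface) :
    ENNReal.ofReal (height y - height x) ≤ hyperbolic.edist x y := by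
  refine hyperbolic.ofReal_sub_le_edist (h := height) continuous_height
    (fun (x : Surface) ε hε => ?_) x y
  have hx : 𝓝 x = map proj (𝓝 (lift x)) := by
    rw [isLocalHomeomorph_proj.map_nhds_eq, proj_lift]
  have key : ∀ᶠ q : ℍ in 𝓝 (lift x), height (proj q) - height x ≤
      Real.sqrt ((((lift x).im ^ 2)⁻¹ : ℝ) * inner ℝ ((q : ℂ) - lift x) ((q : ℂ) - lift x)) +
        ε * ‖(q : ℂ) - lift x‖ := by
    have hp := (lift x).im_pos
    have hc : ContinuousAt (fun q : ℍ => (Real.sqrt (q.im * (lift x).im))⁻¹) (lift x) := by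
      have h1 : Continuous fun q : ℍ => Real.sqrt (q.im * (lift x).im) :=
        (UpperHalfPlane.continuous_im.mul continuous_const).sqrt
      exact h1.continuousAt.inv₀ (Real.sqrt_pos.2 (by positivity)).ne'
    have hlt : (Real.sqrt ((lift x).im * (lift x).im))⁻¹ < (lift x).im⁻¹ + ε := by
      rw [Real.sqrt_mul_self hp.le]
      linarith
    filter_upwards [hc.eventually_lt_const hlt] with q hq
    have h1 : height (proj q) - height x ≤ dist q (lift x) := by
      have := logHeight_sub_le (lift x) q
      rwa [← height_proj, ← height_proj, proj_lift] at this
    have h2 : dist q (lift x) ≤ ‖(q : ℂ) - lift x‖ * (Real.sqrt (q.im * (lift x).im))⁻¹ := by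
      rw [UpperHalfPlane.dist_eq, dist_eq_norm]
      have hq0 : 0 < Real.sqrt (q.im * (lift x).im) :=
        Real.sqrt_pos.2 (mul_pos q.im_pos hp)
      have h3 : Real.arsinh (‖(q : ℂ) - lift x‖ / (2 * Real.sqrt (q.im * (lift x).im))) ≤
          ‖(q : ℂ) - lift x‖ / (2 * Real.sqrt (q.im * (lift x).im)) := by
        rw [← Real.sinh_le_sinh, Real.sinh_arsinh]
        exact Real.self_le_sinh_iff.2 (by positivity)
      refine (mul_le_mul_of_nonneg_left h3 zero_le_two).trans (le_of_eq ?_)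
      field_simp
    have h4 : Real.sqrt ((((lift x).im ^ 2)⁻¹ : ℝ) *
        inner ℝ ((q : ℂ) - lift x) ((q : ℂ) - lift x)) = (lift x).im⁻¹ * ‖(q : ℂ) - lift x‖ := by
      rw [real_inner_self_eq_norm_sq, ← inv_pow, ← mul_pow, Real.sqrt_sq (by positivity)]
    rw [h4]
    have h5 : ‖(q : ℂ) - lift x‖ * (Real.sqrt (q.im * (lift x).im))⁻¹ ≤
        ‖(q : ℂ) - lift x‖ * ((lift x).im⁻¹ + ε) :=
      mul_le_mul_of_nonneg_left hq.le (norm_nonneg _)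
    linarith
  have key2 : ∀ᶠ y : Surface in 𝓝 x, height y - height x ≤
      Real.sqrt ((((lift x).im ^ 2)⁻¹ : ℝ) * inner ℝ (extChartAt 𝓘(ℝ, ℂ) x y - extChartAt 𝓘(ℝ, ℂ) x x)
        (extChartAt 𝓘(ℝ, ℂ) x y - extChartAt 𝓘(ℝ, ℂ) x x)) +
        ε * ‖extChartAt 𝓘(ℝ, ℂ) x y - extChartAt 𝓘(ℝ, ℂ) x x‖ := by
    rw [hx]
    refine eventually_map.2 ?_
    filter_upwards [key, (isOpen_sheet x).mem_nhds (lift_mem_sheet x)] with q hq hs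
    rw [extChartAt_proj hs, extChartAt_self]
    exact hq
  exact key2

/-- Finitely many translates of the strip cover the surface, with control of the height. -/
theorem exists_representatives : ∃ s : Finset SL(2, ℤ), ∀ p : ℍ, ∃ h ∈ s, ∃ q : ℍ,
    |q.re| ≤ 1 / 2 ∧ Real.log q.im = logHeight p ∧ proj (h • q) = proj p := by
  obtain ⟨s, hs⟩ := exists_coset_representatives
  refine ⟨s, fun p => ?_⟩
  obtain ⟨g, hg1, hg2⟩ := exists_smul_strip p
  obtain ⟨h, hh, d, hd, e⟩ := hs g
  refine ⟨h, hh, g • p, hg1, hg2, (proj_eq_iff.2 ⟨d, hd, ?_⟩).symm⟩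
  rw [← mul_smul, ← mul_smul, ← e, inv_mul_cancel, one_smul]

/-- The function `height` is proper: on the strip, a bound of the height bounds the imaginary part from
both sides. -/
theorem exists_compact_height_le (R : ℝ) :
    ∃ K : Set Surface, IsCompact K ∧ ∀ x, height x ≤ R → x ∈ K := by
  obtain ⟨s, hs⟩ := exists_representatives
  have hK0 : IsCompact (UpperHalfPlane.coe ⁻¹'
      (Set.Icc (-(1 / 2)) (1 / 2) ×ℂ Set.Icc (1 / 2) (Real.exp R)) : Set ℍ) := by
    refine UpperHalfPlane.isOpenEmbedding_coe.isInducing.isCompact_preimage'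
      (isCompact_Icc.reProdIm isCompact_Icc) ?_
    rintro z hz
    have : 0 < z.im := lt_of_lt_of_le (by norm_num) hz.2.1
    exact ⟨⟨z, this⟩, rfl⟩
  refine ⟨⋃ h ∈ s, proj '' ((fun q => h • q) '' _), s.isCompact_biUnion fun h _ =>
    (hK0.image (continuous_const_smul h)).image continuous_proj, fun x hx => ?_⟩
  obtain ⟨p, rfl⟩ := surjective_proj x
  obtain ⟨h, hh, q, hq1, hq2, hq3⟩ := hs p
  refine Set.mem_biUnion hh ⟨h • q, ⟨q, ⟨?_, ?_, ?_⟩, rfl⟩, hq3⟩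
  · exact abs_le.1 hq1
  · have := log_half_le_logHeight p
    rw [← hq2] at this
    exact (Real.log_le_log_iff (by norm_num) q.im_pos).1 this
  · rw [height_proj, ← hq2] at hx
    exact (Real.log_le_iff_le_exp q.im_pos).1 hx

theorem isComplete_hyperbolic : hyperbolic.IsComplete :=
  hyperbolic.isComplete_of_lipschitz height_lipschitz exists_compact_height_le

theorem exists_lt_height (R : ℝ) : ∃ x, R < height x := by
  refine ⟨proj ⟨⟨0, Real.exp (R + 1)⟩, Real.exp_pos _⟩, ?_⟩
  rw [height_proj]
  refine lt_of_lt_of_le ?_ (log_im_le_logHeight _ 1)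
  rw [one_smul]
  change R < Real.log (Real.exp (R + 1))
  rw [Real.log_exp]
  linarith

theorem noncompactSpace_hyperbolic : NoncompactSpace hyperbolic.M := by
  rw [← not_compactSpace_iff]
  intro (hc : CompactSpace Surface)
  obtain ⟨C, hC⟩ := (isCompact_univ.image continuous_height).bddAbove
  obtain ⟨x, hx⟩ := exists_lt_height C
  exact hx.not_ge (hC ⟨x, trivial, rfl⟩)

end RiemMfd

/-! ### The area of the hyperbolic surface -/

/-- In the upper half plane the measure of a metric that is `|dz|² / y²` on a set is the hyperbolic area
there. -/
theorem LocalMetric.formMeasure_halfPlane {G : ℂ → ℂ →L[ℝ] ℂ →L[ℝ] ℝ} {A : Set ℂ}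
    (hA : MeasurableSet A) (hpos : ∀ z ∈ A, 0 < z.im)
    (hG : ∀ z ∈ A, G z = ((z.im ^ 2)⁻¹ : ℝ) • LocalMetric.stdForm ℂ) :
    LocalMetric.formMeasure (Module.finBasis ℝ ℂ) G A =
      ∫⁻ z in A, ↑((1 / ‖z.im‖₊) ^ 2 : NNReal) := by
  rw [LocalMetric.formMeasure_basis (Module.finBasis ℝ ℂ) Complex.orthonormalBasisOneI.toBasis G]
  have h1 : (Complex.orthonormalBasisOneI.toBasis).addHaar = (volume : Measure ℂ) :=
    Complex.orthonormalBasisOneI.addHaar_eq_volume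
  change ((Complex.orthonormalBasisOneI.toBasis).addHaar.withDensity _) A = _
  rw [h1, withDensity_apply _ hA]
  refine setLIntegral_congr_fun hA fun z hz => ?_
  have hz0 := hpos z hz
  have h2 : (LocalMetric.gram Complex.orthonormalBasisOneI.toBasis (G z)).det =
      ((z.im ^ 2)⁻¹) ^ 2 := by
    have h3 : ∀ u v : ℂ, G z u v = (z.im ^ 2)⁻¹ * inner ℝ u v := fun u v => by
      rw [hG z hz]
      rfl
    rw [Matrix.det_fin_two]
    simp [LocalMetric.gram, h3, Complex.inner]
    ring
  change ENNReal.ofReal (Real.sqrt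
    (LocalMetric.gram Complex.orthonormalBasisOneI.toBasis (G z)).det) = _
  rw [h2, Real.sqrt_sq (by positivity), ENNReal.ofReal]
  congr 1
  ext
  rw [Real.coe_toNNReal _ (by positivity)]
  simp

namespace RiemMfd
open LevelThree

/-- The covering of the hyperbolic surface by the upper half plane. -/
def covering : ℍ → hyperbolic.M := proj

/-- Within a sheet, volumes on the surface are bounded by the volumes of sets of representatives. -/
theorem vol_covering_le_of_subset (x : Surface) {S : Set ℍ} (hS : MeasurableSet S)
    (h : S ⊆ sheet x) : hyperbolic.vol (covering '' S) ≤ (volume : Measure ℍ) S := by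
  have hcS : MeasurableSet (UpperHalfPlane.coe '' S) :=
    UpperHalfPlane.measurableEmbedding_coe.measurableSet_image.2 hS
  have ht : UpperHalfPlane.coe '' S ⊆ (extChartAt 𝓘(ℝ, ℂ) x).target := by
    rw [target_eq]
    exact Set.image_mono h
  have himg : covering '' S = (extChartAt 𝓘(ℝ, ℂ) x).symm '' (UpperHalfPlane.coe '' S) := by
    rw [Set.image_image]
    exact Set.image_congr fun q _ => (extChartAt_symm_coe x q).symm
  have hA : MeasurableSet (covering '' S) := by
    have hc : ContinuousOn (extChartAt 𝓘(ℝ, ℂ) x).symm (UpperHalfPlane.coe '' S) :=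
      (continuousOn_extChartAt_symm x).mono ht
    have hi : Set.InjOn (extChartAt 𝓘(ℝ, ℂ) x).symm (UpperHalfPlane.coe '' S) :=
      (extChartAt 𝓘(ℝ, ℂ) x).symm.injOn.mono ht
    rw [himg]
    exact MeasurableSet.image_of_continuousOn_injOn (β := hyperbolic.M) hcS hc hi
  have hsrc : covering '' S ⊆ (extChartAt 𝓘(ℝ, ℂ) x).source := by
    rw [source_eq]
    exact Set.image_mono h
  have hset : (extChartAt 𝓘(ℝ, ℂ) x).target ∩ (extChartAt 𝓘(ℝ, ℂ) x).symm ⁻¹' (covering '' S) =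
      UpperHalfPlane.coe '' S := by
    apply Set.Subset.antisymm
    · rintro z ⟨hz, q, hq, hqz⟩
      rw [target_eq] at hz
      obtain ⟨p, hp, rfl⟩ := hz
      rw [extChartAt_symm_coe] at hqz
      rw [← injOn_sheet x (h hq) hp hqz]
      exact ⟨q, hq, rfl⟩
    · rintro _ ⟨q, hq, rfl⟩
      exact ⟨ht ⟨q, hq, rfl⟩, q, hq, (extChartAt_symm_coe x q).symm⟩
  have h1 := (hyperbolic.vol_apply_of_subset_source x hA hsrc).trans (hyperbolic.chartVol_apply x hA)
  refine (h1.trans ((congrArg (hyperbolic.coordMeasure x) hset).trans ?_)).le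
  rw [UpperHalfPlane.volume_eq_lintegral]
  refine LocalMetric.formMeasure_halfPlane (G := hyperbolic.coordMetric x) hcS ?_ ?_
  · rintro _ ⟨q, -, rfl⟩
    exact q.im_pos
  · rintro _ ⟨q, hq, rfl⟩
    exact coordMetric_hyperbolic x (h hq)

/-- The covering does not increase volumes locally. A point need not lie in the sheet chosen for its
image, but a translate of it does, and both measures are invariant. -/
theorem exists_nhds_vol_covering_le (p : ℍ) : ∃ U ∈ 𝓝 p, ∀ S ⊆ U, MeasurableSet S →
    hyperbolic.vol (covering '' S) ≤ (volume : Measure ℍ) S := by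
  obtain ⟨g, hg, hgp⟩ := proj_eq_iff.1 (proj_lift (LevelThree.proj p))
  refine ⟨(fun q => g • q) ⁻¹' sheet (LevelThree.proj p), ?_, fun S hS hm => ?_⟩
  · refine (continuous_const_smul g).continuousAt ((isOpen_sheet _).mem_nhds ?_)
    rw [hgp]
    exact lift_mem_sheet _
  · have h1 : covering '' S = covering '' ((fun q => g • q) '' S) := by
      rw [Set.image_image]
      exact Set.image_congr fun q _ => (proj_eq_iff.2 ⟨g, hg, rfl⟩).symm
    have h2 : (fun q : ℍ => g • q) '' S = (fun q => g⁻¹ • q) ⁻¹' S := by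
      ext q
      constructor
      · rintro ⟨q, hq, rfl⟩
        simpa using hq
      · intro hq
        exact ⟨_, hq, by simp⟩
    have hm' : MeasurableSet ((fun q : ℍ => g⁻¹ • q) ⁻¹' S) :=
      (continuous_const_smul g⁻¹).measurable hm
    have h3 := SMulInvariantMeasure.measure_preimage_smul (μ := (volume : Measure ℍ)) g⁻¹ hm
    rw [h1, ← h3, h2]
    refine vol_covering_le_of_subset (LevelThree.proj p) hm' ?_
    intro q hq
    have := hS hq
    simpa using this

/-- The covering does not increase volumes. -/
theorem vol_covering_le {S : Set ℍ} (hS : MeasurableSet S) :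
    hyperbolic.vol (covering '' S) ≤ (volume : Measure ℍ) S := by
  choose U hU hUS using exists_nhds_vol_covering_le
  obtain ⟨s, hs, hc⟩ := TopologicalSpace.countable_cover_nhds (fun p => interior_mem_nhds.2 (hU p))
  have hne : s.Nonempty := by
    have : UpperHalfPlane.I ∈ ⋃ x ∈ s, interior (U x) := by rw [hc]; trivial
    obtain ⟨x, hx, -⟩ := Set.mem_iUnion₂.1 this
    exact ⟨x, hx⟩
  obtain ⟨f, rfl⟩ := hs.exists_eq_range hne
  have hcov : ⋃ n, interior (U (f n)) = Set.univ := by rwa [Set.biUnion_range] at hc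
  let D : ℕ → Set ℍ := disjointed fun n => interior (U (f n))
  have hD : ∀ n, MeasurableSet (S ∩ D n) := fun n =>
    hS.inter (MeasurableSet.disjointed (fun n => isOpen_interior.measurableSet) n)
  have hSD : S = ⋃ n, S ∩ D n := by
    rw [← Set.inter_iUnion, iUnion_disjointed, hcov, Set.inter_univ]
  calc hyperbolic.vol (covering '' S) = hyperbolic.vol (⋃ n, covering '' (S ∩ D n)) := by
        rw [← Set.image_iUnion, ← hSD]
    _ ≤ ∑' n, hyperbolic.vol (covering '' (S ∩ D n)) := measure_iUnion_le _
    _ ≤ ∑' n, (volume : Measure ℍ) (S ∩ D n) := ENNReal.tsum_le_tsum fun n =>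
        hUS (f n) _ (Set.inter_subset_right.trans
          ((disjointed_subset _ n).trans interior_subset)) (hD n)
    _ = (volume : Measure ℍ) S := by
        rw [← measure_iUnion (fun i j hij => ((disjoint_disjointed _ hij).mono
          Set.inter_subset_right Set.inter_subset_right)) hD, ← hSD]

theorem measurableSet_strip (t : ℝ) : MeasurableSet (strip t) :=
  (measurableSet_le (UpperHalfPlane.continuous_re.abs.measurable) measurable_const).inter
    (measurableSet_lt measurable_const UpperHalfPlane.continuous_im.measurable)

/-- The area of the strip is the integral of `y⁻²`, which is finite away from `y = 0`. -/
theorem volume_strip_lt_top {t : ℝ} (ht : 0 < t) : (volume : Measure ℍ) (strip t) < ⊤ := by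
  rw [UpperHalfPlane.volume_eq_lintegral]
  have himg : UpperHalfPlane.coe '' strip t =
      Complex.measurableEquivRealProd ⁻¹' (Set.Icc (-(1 / 2)) (1 / 2) ×ˢ Set.Ioi t) := by
    ext z
    constructor
    · rintro ⟨p, ⟨h1, h2⟩, rfl⟩
      exact ⟨abs_le.1 h1, h2⟩
    · rintro ⟨h1, h2⟩
      exact ⟨⟨z, ht.trans h2⟩, ⟨abs_le.2 h1, h2⟩, rfl⟩
  have h := Complex.volume_preserving_equiv_real_prod.setLIntegral_comp_preimage_emb
    Complex.measurableEquivRealProd.measurableEmbedding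
    (fun q : ℝ × ℝ => (((1 / ‖q.2‖₊) ^ 2 : NNReal) : ℝ≥0∞))
    (Set.Icc (-(1 / 2)) (1 / 2) ×ˢ Set.Ioi t)
  rw [himg]
  refine lt_of_eq_of_lt h ?_
  rw [Measure.volume_eq_prod, ← Measure.prod_restrict]
  have h2 := lintegral_prod_mul (μ := (volume : Measure ℝ).restrict (Set.Icc (-(1 / 2)) (1 / 2)))
    (ν := (volume : Measure ℝ).restrict (Set.Ioi t)) (f := fun _ => 1)
    (g := fun y => (((1 / ‖y‖₊) ^ 2 : NNReal) : ℝ≥0∞)) aemeasurable_const (by fun_prop)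
  simp only [one_mul] at h2
  rw [h2]
  refine ENNReal.mul_lt_top (by simp) ?_
  have hint := (integrableOn_Ioi_rpow_of_lt (a := -2) (by norm_num) ht).2
  refine lt_of_le_of_lt (le_of_eq ?_) hint
  refine setLIntegral_congr_fun measurableSet_Ioi fun y hy => ?_
  have hy0 : 0 < y := ht.trans hy
  change (((1 / ‖y‖₊) ^ 2 : NNReal) : ℝ≥0∞) = ((‖y ^ (-2 : ℝ)‖₊ : NNReal) : ℝ≥0∞)
  congr 1
  ext
  simp [Real.rpow_neg hy0.le]

/-- The volume of the superlevel sets of the height is controlled by that of the strip. -/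
theorem exists_vol_superlevel_le : ∃ N : ℕ, ∀ t : ℝ, 0 < t →
    hyperbolic.vol {x | Real.log t < height x} ≤ N * (volume : Measure ℍ) (strip t) := by
  obtain ⟨s, hs⟩ := exists_representatives
  refine ⟨s.card, fun t ht => ?_⟩
  have hsub : {x : hyperbolic.M | Real.log t < height x} ⊆
      ⋃ h ∈ s, covering '' ((fun q => h⁻¹ • q) ⁻¹' strip t) := by
    intro x hx
    obtain ⟨p, rfl⟩ := surjective_proj x
    obtain ⟨h, hh, q, hq1, hq2, hq3⟩ := hs p
    refine Set.mem_biUnion hh ⟨h • q, ?_, hq3⟩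
    change h⁻¹ • h • q ∈ strip t
    rw [inv_smul_smul]
    refine ⟨hq1, ?_⟩
    have hx' : Real.log t < logHeight p := hx
    rw [← hq2] at hx'
    exact (Real.log_lt_log_iff ht q.im_pos).1 hx'
  refine (measure_mono hsub).trans ((measure_biUnion_finset_le _ _).trans ?_)
  refine (Finset.sum_le_sum fun h _ => ?_).trans_eq
    ((Finset.sum_const ((volume : Measure ℍ) (strip t))).trans (nsmul_eq_mul _ _))
  refine (vol_covering_le ((continuous_const_smul h⁻¹).measurable (measurableSet_strip t))).trans ?_
  exact (SMulInvariantMeasure.measure_preimage_smul h⁻¹ (measurableSet_strip t)).le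

theorem vol_hyperbolic_lt_top : hyperbolic.vol Set.univ < ⊤ := by
  obtain ⟨N, hN⟩ := exists_vol_superlevel_le
  have h : (Set.univ : Set hyperbolic.M) ⊆ {x | Real.log (1 / 4) < height x} := by
    intro x _
    obtain ⟨p, rfl⟩ := surjective_proj x
    exact (Real.log_lt_log (by norm_num) (by norm_num)).trans_le (log_half_le_logHeight p)
  refine ((measure_mono h).trans (hN _ (by norm_num))).trans_lt ?_
  exact ENNReal.mul_lt_top (ENNReal.natCast_lt_top N) (volume_strip_lt_top (by norm_num))

/-- The surface contains balls of any fixed radius and arbitrarily small area: a ball around a point of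
large height `h` lies above the height `h - r`. -/
theorem exists_vol_ball_hyperbolic_le (r : ℝ) {ε : ℝ≥0∞} (hε : 0 < ε) :
    ∃ x, hyperbolic.vol (hyperbolic.ball x r) ≤ ε := by
  obtain ⟨N, hN⟩ := exists_vol_superlevel_le
  have hlim : Tendsto (fun n : ℕ => (N : ℝ≥0∞) * (volume : Measure ℍ) (strip (n + 1))) atTop
      (𝓝 (N * 0)) := by
    refine ENNReal.Tendsto.const_mul ?_ (Or.inr (ENNReal.natCast_ne_top N))
    have h := tendsto_measure_iInter_atTop (μ := (volume : Measure ℍ))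
      (s := fun n : ℕ => strip (n + 1)) (fun n => (measurableSet_strip _).nullMeasurableSet)
      (fun m n hmn p hp => ⟨hp.1, lt_of_le_of_lt (by gcongr) hp.2⟩)
      ⟨0, (volume_strip_lt_top (by positivity)).ne⟩
    have hempty : ⋂ n : ℕ, strip (n + 1) = ∅ := by
      refine Set.eq_empty_of_forall_notMem fun p hp => ?_
      obtain ⟨n, hn⟩ := exists_nat_gt p.im
      have := (Set.mem_iInter.1 hp n).2
      linarith
    rwa [hempty, measure_empty] at h
  rw [mul_zero] at hlim
  obtain ⟨n, hn⟩ := (hlim.eventually_lt_const hε).exists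
  obtain ⟨x, hx⟩ := exists_lt_height (Real.log (n + 1) + r)
  refine ⟨x, ((measure_mono ?_).trans (hN (n + 1) (by positivity))).trans hn.le⟩
  intro y hy
  have h1 : ENNReal.ofReal (height x - height y) < ENNReal.ofReal r := by
    exact ((height_lipschitz y x).trans_eq (hyperbolic.edist_comm y x)).trans_lt hy
  have h2 : height x - height y < r := lt_of_not_ge fun hle => h1.not_ge (ENNReal.ofReal_le_ofReal hle)
  change Real.log (n + 1) < height y
  linarith

end RiemMfd

/-! ### Parallel endomorphism fields -/

namespace LocalMetric

variable {E F : Type} [NormedAddCommGroup E] [NormedSpace ℝ E] [FiniteDimensional ℝ E]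
  [NormedAddCommGroup F] [NormedSpace ℝ F] [FiniteDimensional ℝ F]

/-- The covariant derivative of the endomorphism field `T` vanishes at `z`. -/
def IsParallelAt (G : E → E →L[ℝ] E →L[ℝ] ℝ) (T : E → E →L[ℝ] E) (z : E) : Prop :=
  ∀ u v : E, fderiv ℝ T z u v + christoffel G z u (T z v) - T z (christoffel G z u v) = 0

variable {G : E → E →L[ℝ] E →L[ℝ] ℝ} {T : E → E →L[ℝ] E} {z : E}

theorem IsParallelAt.const_smul (h : IsParallelAt G T z) (hG : IsMetricAt G z) {c : ℝ}
    (hc : 0 < c) : IsParallelAt (fun y => c • G y) T z := by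
  intro u v
  rw [christoffel_const_smul hG hc, christoffel_const_smul hG hc]
  exact h u v

theorem IsParallelAt.congr (h : IsParallelAt G T z) {G' : E → E →L[ℝ] E →L[ℝ] ℝ}
    {T' : E → E →L[ℝ] E} (hG : G' =ᶠ[𝓝 z] G) (hT : T' =ᶠ[𝓝 z] T) : IsParallelAt G' T' z := by
  intro u v
  rw [christoffel_congr hG, christoffel_congr hG, hT.fderiv_eq, hT.eq_of_nhds]
  exact h u v

theorem IsParallelAt.prod {K : F → F →L[ℝ] F →L[ℝ] ℝ} {S : F → F →L[ℝ] F} {p : E × F}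
    (hG : IsMetricAt G p.1) (hK : IsMetricAt K p.2) (hT : DifferentiableAt ℝ T p.1)
    (hS : DifferentiableAt ℝ S p.2) (h : IsParallelAt G T p.1) (h' : IsParallelAt K S p.2) :
    IsParallelAt (prodMetric G K) (fun q => (T q.1).prodMap (S q.2)) p := by
  intro u v
  have hd : HasFDerivAt (fun q : E × F => (T q.1).prodMap (S q.2))
      ((ContinuousLinearMap.prodMapL ℝ E E F F).comp
        ((fderiv ℝ T p.1).prodMap (fderiv ℝ S p.2))) p :=
    (ContinuousLinearMap.prodMapL ℝ E E F F).hasFDerivAt.comp p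
      (hT.hasFDerivAt.prodMap p hS.hasFDerivAt)
  rw [hd.fderiv, christoffel_prod hG hK, christoffel_prod hG hK]
  exact Prod.ext (h u.1 v.1) (h' u.2 v.2)

/-- A constant endomorphism is parallel for a conformal metric `l • ⟨·, ·⟩` as soon as it satisfies an
algebraic identity, which for the rotation by a right angle of the plane always holds. -/
theorem IsParallelAt.conformal {E : Type} [NormedAddCommGroup E] [InnerProductSpace ℝ E]
    [FiniteDimensional ℝ E] {G : E → E →L[ℝ] E →L[ℝ] ℝ} {l : E → ℝ} {A z : E} {T : E →L[ℝ] E}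
    (hG : G =ᶠ[𝓝 z] fun y => l y • stdForm E) (hl : 0 < l z)
    (hd : HasFDerivAt l ((2 * l z) • stdForm E A) z)
    (hT : ∀ u v : E, inner ℝ A (T v) • u - inner ℝ u (T v) • A =
      inner ℝ A v • T u - inner ℝ u v • T A) : IsParallelAt G (fun _ => T) z := by
  intro u v
  rw [christoffel_conformal (A := fun _ => A) hG hl hd, christoffel_conformal (A := fun _ => A) hG hl hd]
  have := hT u v
  simp only [fderiv_fun_const, Pi.zero_apply, zero_apply, zero_add, map_sub, map_add, map_smul]
  rw [← sub_eq_zero] at this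
  refine Eq.trans ?_ this
  module

end LocalMetric

namespace RiemMfd

/-! ### Products of surfaces of opposite curvature -/

/-- In all preferred charts the curvature is `κ` near the base point of the chart. -/
def HasCurvatureNear (X : RiemMfd) (κ : ℝ) : Prop :=
  ∀ x : X.M, ∀ᶠ z in 𝓝 (extChartAt X.I x x), LocalMetric.HasCurvatureAt (X.coordMetric x) z κ

variable {X Y : RiemMfd} {κ : ℝ}

theorem HasCurvatureNear.self (h : X.HasCurvatureNear κ) (x : X.M) :
    LocalMetric.HasCurvatureAt (X.coordMetric x) (extChartAt X.I x x) κ :=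
  (h x).self_of_nhds

theorem HasCurvatureNear.rescale (h : X.HasCurvatureNear κ) (a : ℝ) (ha : 0 < a) :
    (X.rescale a ha).HasCurvatureNear (κ / a ^ 2) := by
  intro x
  filter_upwards [h x, (X.isMetricAt_coordMetric_self x).eventually] with z hz hm
  exact hz.const_smul hm (pow_pos ha 2)

/-- The scalar curvatures of the factors cancel. -/
theorem isScalarFlat_prod (hX : X.HasCurvatureNear (-κ)) (hY : Y.HasCurvatureNear κ)
    (hd : X.dim = Y.dim) : (X.prod Y).IsScalarFlat := by
  rintro ⟨x, y⟩
  have h := (LocalMetric.scalar_congr (X.coordMetric_prod_eventuallyEq Y x y)).trans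
    (LocalMetric.scalar_prod (p := (extChartAt X.I x x, extChartAt Y.I y y))
      (X.isMetricAt_coordMetric_self x) (Y.isMetricAt_coordMetric_self y))
  rw [(hX.self x).scalar_eq (X.isMetricAt_coordMetric_self x),
    (hY.self y).scalar_eq (Y.isMetricAt_coordMetric_self y)] at h
  rw [extChartAt_prod_self]
  refine h.trans ?_
  change Module.finrank ℝ X.E = Module.finrank ℝ Y.E at hd
  rw [hd]
  ring

/-- A product of manifolds of constant curvature satisfies `Δ Ric = 2 Ric² - 2 Rm(Ric)`: the left hand
side vanishes because `Ric` is parallel, and the two terms on the right hand side agree on each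
factor. -/
theorem isCriticalWith_prod {κ' : ℝ} (hX : X.HasCurvatureNear κ) (hY : Y.HasCurvatureNear κ') :
    (X.prod Y).IsCriticalWith ![2, -2, 0, 0, 0] := by
  rintro ⟨x, y⟩ u v
  have mX := X.isMetricAt_coordMetric_self x
  have mY := Y.isMetricAt_coordMetric_self y
  have h1 := (LocalMetric.laplaceRic_congr (X.coordMetric_prod_eventuallyEq Y x y) u v).trans
    (LocalMetric.laplaceRic_prod_eq_zero (p := (extChartAt X.I x x, extChartAt Y.I y y))
      mX mY (hX x) (hY y) u v)
  have h2 := (LocalMetric.ricSq_prod (p := (extChartAt X.I x x, extChartAt Y.I y y)) mX mY u v).trans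
    (congrArg₂ (· + ·) (((hX.self x).ricSq_eq mX u.1 v.1).trans ((hX.self x).rmRic_eq mX u.1 v.1).symm)
      (((hY.self y).ricSq_eq mY u.2 v.2).trans ((hY.self y).rmRic_eq mY u.2 v.2).symm))
  have h3 := h2.trans
    (LocalMetric.rmRic_prod (p := (extChartAt X.I x x, extChartAt Y.I y y)) mX mY u v).symm
  have h4 : LocalMetric.rmStarRic ![2, -2, 0, 0, 0]
      (LocalMetric.prodMetric (X.coordMetric x) (Y.coordMetric y))
      (extChartAt X.I x x, extChartAt Y.I y y) u v = 0 := by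
    unfold LocalMetric.rmStarRic
    rw [h3]
    simp
  rw [extChartAt_prod_self]
  exact h1.trans (h4.symm.trans (LocalMetric.rmStarRic_congr
    (X.coordMetric_prod_eventuallyEq Y x y) _ u v).symm)

theorem rmSq_of_hasCurvatureNear (h : X.HasCurvatureNear κ) (hd : X.dim = 2) (x : X.M) :
    X.rmSq x = 4 * κ ^ 2 := by
  rw [rmSq_of_hasCurvatureAt (h.self x), hd]
  norm_num
  ring

theorem hasCurvatureNear_hyperbolic : hyperbolic.HasCurvatureNear (-1) := by
  intro (x : LevelThree.Surface)
  have h : ∀ᶠ z : ℂ in 𝓝 (LevelThree.lift x : ℂ),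
      LocalMetric.HasCurvatureAt (E := ℂ) (hyperbolic.coordMetric x) z (-1) := by
    rw [← UpperHalfPlane.isOpenEmbedding_coe.map_nhds_eq]
    refine eventually_map.2 ?_
    filter_upwards [(LevelThree.isOpen_sheet x).mem_nhds (LevelThree.lift_mem_sheet x)] with q hq
    exact hasCurvatureAt_hyperbolic x hq
  rw [← LevelThree.extChartAt_self] at h
  exact h

theorem hasCurvatureNear_sphere (n : ℕ) : (roundSphere n).HasCurvatureNear 1 :=
  fun x => Eventually.of_forall fun z => hasCurvatureAt_sphere n x z

/-! ### Kähler structures -/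

/-- `J` is a smooth orthogonal almost complex structure that is parallel for the Levi-Civita
connection. -/
def IsKaehlerWith (X : RiemMfd) (J : ∀ x : X.M, TangentSpace X.I x →L[ℝ] TangentSpace X.I x) :
    Prop :=
  ContMDiff X.I (X.I.prod 𝓘(ℝ, X.E →L[ℝ] X.E)) ∞
      (fun x ↦ TotalSpace.mk' (X.E →L[ℝ] X.E)
        (E := fun x : X.M ↦ TangentSpace X.I x →L[ℝ] TangentSpace X.I x) x (J x)) ∧
    (∀ x v, J x (J x v) = -v) ∧
    (∀ x v w, X.g.inner x (J x v) (J x w) = X.g.inner x v w) ∧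
    ∀ x : X.M, LocalMetric.IsParallelAt (X.coordMetric x) (X.coordEndo J x) (extChartAt X.I x x)

variable {J : ∀ x : X.M, TangentSpace X.I x →L[ℝ] TangentSpace X.I x}

theorem IsKaehlerWith.isKaehler (h : X.IsKaehlerWith J) : X.IsKaehler := ⟨J, h⟩

theorem IsKaehlerWith.rescale (h : X.IsKaehlerWith J) (a : ℝ) (ha : 0 < a) :
    (X.rescale a ha).IsKaehlerWith J := by
  refine ⟨h.1, h.2.1, fun x v w => ?_, fun x => ?_⟩
  · exact congrArg (a ^ 2 * ·) (h.2.2.1 x v w)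
  · exact (h.2.2.2 x).const_smul (X.isMetricAt_coordMetric_self x) (pow_pos ha 2)

/-- The endomorphism field `J ⊕ J'` on a product. -/
def prodEndo (J : ∀ x : X.M, TangentSpace X.I x →L[ℝ] TangentSpace X.I x)
    (J' : ∀ y : Y.M, TangentSpace Y.I y →L[ℝ] TangentSpace Y.I y) (p : (X.prod Y).M) :
    TangentSpace (X.prod Y).I p →L[ℝ] TangentSpace (X.prod Y).I p :=
  ContinuousLinearMap.prodMap (M₁ := X.E) (M₂ := X.E) (M₃ := Y.E) (M₄ := Y.E) (J p.1) (J' p.2)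

/-- An endomorphism field has the coordinate expression `T` if the differential of the inverse of the
chart intertwines `T` with it. -/
theorem coordEndo_eq_of_comp_eq {x : X.M} {z : X.E} (hz : z ∈ (extChartAt X.I x).target)
    {T : X.E →L[ℝ] X.E}
    (h : ∀ v : X.E, J ((extChartAt X.I x).symm z) (mfderiv 𝓘(ℝ, X.E) X.I (extChartAt X.I x).symm z v) =
      mfderiv 𝓘(ℝ, X.E) X.I (extChartAt X.I x).symm z (T v)) : X.coordEndo J x z = T := by
  obtain ⟨e, he⟩ := isInvertible_mfderiv_extChartAt_symm hz
  refine ContinuousLinearMap.ext fun v => ?_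
  change (mfderiv 𝓘(ℝ, X.E) X.I (extChartAt X.I x).symm z).inverse
    (J ((extChartAt X.I x).symm z) (mfderiv 𝓘(ℝ, X.E) X.I (extChartAt X.I x).symm z v)) = T v
  rw [h, ← he, ContinuousLinearMap.inverse_equiv]
  exact e.symm_apply_apply _

theorem mfderiv_coordEndo {x : X.M} {z : X.E} (hz : z ∈ (extChartAt X.I x).target) (v : X.E) :
    mfderiv 𝓘(ℝ, X.E) X.I (extChartAt X.I x).symm z (X.coordEndo J x z v) =
      J ((extChartAt X.I x).symm z) (mfderiv 𝓘(ℝ, X.E) X.I (extChartAt X.I x).symm z v) := by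
  obtain ⟨e, he⟩ := isInvertible_mfderiv_extChartAt_symm hz
  change mfderiv 𝓘(ℝ, X.E) X.I (extChartAt X.I x).symm z
    ((mfderiv 𝓘(ℝ, X.E) X.I (extChartAt X.I x).symm z).inverse
    (J ((extChartAt X.I x).symm z) (mfderiv 𝓘(ℝ, X.E) X.I (extChartAt X.I x).symm z v))) = _
  rw [← he, ContinuousLinearMap.inverse_equiv]
  exact e.apply_symm_apply _

theorem coordEndo_prodEndo {J' : ∀ y : Y.M, TangentSpace Y.I y →L[ℝ] TangentSpace Y.I y}
    (x : X.M) (y : Y.M) {z : X.E × Y.E}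
    (h1 : z.1 ∈ (extChartAt X.I x).target) (h2 : z.2 ∈ (extChartAt Y.I y).target) :
    (X.prod Y).coordEndo (prodEndo J J') (show (X.prod Y).M from (x, y)) z =
      (X.coordEndo J x z.1).prodMap (Y.coordEndo J' y z.2) := by
  have e : (extChartAt (X.I.prod Y.I) (x, y)).symm =
      (fun z : X.E × Y.E => ((extChartAt X.I x).symm z.1, (extChartAt Y.I y).symm z.2)) := by
    rw [extChartAt_prod]
    rfl
  have hz : z ∈ (extChartAt (X.I.prod Y.I) (x, y)).target := by
    rw [extChartAt_prod]
    exact ⟨h1, h2⟩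
  have h3 : MDifferentiableAt 𝓘(ℝ, X.E) X.I (extChartAt X.I x).symm z.1 :=
    (contMDiffAt_extChartAt_symm h1).mdifferentiableAt (by simp)
  have h4 : MDifferentiableAt 𝓘(ℝ, Y.E) Y.I (extChartAt Y.I y).symm z.2 :=
    (contMDiffAt_extChartAt_symm h2).mdifferentiableAt (by simp)
  have hd : mfderiv 𝓘(ℝ, X.E × Y.E) (X.I.prod Y.I) (extChartAt (X.I.prod Y.I) (x, y)).symm z =
      (mfderiv 𝓘(ℝ, X.E) X.I (extChartAt X.I x).symm z.1).prodMap
        (mfderiv 𝓘(ℝ, Y.E) Y.I (extChartAt Y.I y).symm z.2) := by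
    rw [e, modelWithCornersSelf_prod, ← chartedSpaceSelf_prod]
    exact mfderiv_prodMap (p := z) h3 h4
  have hd' : ∀ v : X.E × Y.E,
      mfderiv 𝓘(ℝ, X.E × Y.E) (X.I.prod Y.I) (extChartAt (X.I.prod Y.I) (x, y)).symm z v =
      ((mfderiv 𝓘(ℝ, X.E) X.I (extChartAt X.I x).symm z.1 v.1 : X.E),
        (mfderiv 𝓘(ℝ, Y.E) Y.I (extChartAt Y.I y).symm z.2 v.2 : Y.E)) := fun v => by
    rw [hd]
    rfl
  refine coordEndo_eq_of_comp_eq (X := X.prod Y) hz fun (v : X.E × Y.E) => ?_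
  refine Eq.trans ?_ (hd' _).symm
  refine (congrArg _ (hd' v)).trans ?_
  exact (Prod.ext (mfderiv_coordEndo h1 v.1) (mfderiv_coordEndo h2 v.2)).symm

theorem contDiffAt_coordEndo (h : X.IsKaehlerWith J) (x : X.M) :
    ContDiffAt ℝ ∞ (X.coordEndo J x) (extChartAt X.I x x) := by
  refine (contMDiffAt_endo_iff (mem_extChartAt_target (I := X.I) x)).1 ?_
  rw [extChartAt_to_inv]
  exact h.1 x

theorem IsKaehlerWith.prod {J' : ∀ y : Y.M, TangentSpace Y.I y →L[ℝ] TangentSpace Y.I y}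
    (h : X.IsKaehlerWith J) (h' : Y.IsKaehlerWith J') :
    (X.prod Y).IsKaehlerWith (prodEndo J J') := by
  have hev : ∀ (x : X.M) (y : Y.M), (X.prod Y).coordEndo (prodEndo J J')
      (show (X.prod Y).M from (x, y)) =ᶠ[𝓝 (extChartAt X.I x x, extChartAt Y.I y y)]
      fun q => (X.coordEndo J x q.1).prodMap (Y.coordEndo J' y q.2) := by
    intro x y
    filter_upwards [prod_mem_nhds (extChartAt_target_mem_nhds (I := X.I) x)
      (extChartAt_target_mem_nhds (I := Y.I) y)] with z hz
    exact coordEndo_prodEndo x y hz.1 hz.2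
  refine ⟨?_, ?_, ?_, ?_⟩
  · rintro ⟨x, y⟩
    have h1 := (contMDiffAt_endo_iff (J := prodEndo J J')
      (mem_extChartAt_target (I := (X.prod Y).I) (show (X.prod Y).M from (x, y)))).2 ?_
    · rw [extChartAt_to_inv] at h1
      exact h1
    · rw [extChartAt_prod_self]
      refine ContDiffAt.congr_of_eventuallyEq ?_ (hev x y)
      exact (ContinuousLinearMap.prodMapL ℝ X.E X.E Y.E Y.E).contDiff.contDiffAt.comp
        (extChartAt X.I x x, extChartAt Y.I y y)
        (((contDiffAt_coordEndo h x).comp (extChartAt X.I x x, extChartAt Y.I y y) contDiffAt_fst).prodMk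
          ((contDiffAt_coordEndo h' y).comp (extChartAt X.I x x, extChartAt Y.I y y) contDiffAt_snd))
  · rintro ⟨x, y⟩ ⟨v, w⟩
    exact Prod.ext (h.2.1 x v) (h'.2.1 y w)
  · rintro ⟨x, y⟩ v w
    refine (prodInner_apply X Y (x, y) _ _).trans
      (Eq.trans ?_ (prodInner_apply X Y (x, y) v w).symm)
    exact congrArg₂ (· + ·) (h.2.2.1 x _ _) (h'.2.2.1 y _ _)
  · rintro ⟨x, y⟩
    rw [extChartAt_prod_self]
    refine LocalMetric.IsParallelAt.congr ?_ (X.coordMetric_prod_eventuallyEq Y x y) (hev x y)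
    exact LocalMetric.IsParallelAt.prod (p := (extChartAt X.I x x, extChartAt Y.I y y))
      (X.isMetricAt_coordMetric_self x) (Y.isMetricAt_coordMetric_self y)
      ((contDiffAt_coordEndo h x).differentiableAt (by simp))
      ((contDiffAt_coordEndo h' y).differentiableAt (by simp)) (h.2.2.2 x) (h'.2.2.2 y)

end RiemMfd

/-! ### The complex structure of the hyperbolic surface -/

namespace RiemMfd

/-- An endomorphism field that is a fixed endomorphism `T` near the base points of all preferred
charts is a Kähler structure of a conformally flat metric under algebraic conditions on `T`. -/
theorem isKaehlerWith_of_coordEndo_eventuallyEq {X : RiemMfd}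
    {J : ∀ x : X.M, TangentSpace X.I x →L[ℝ] TangentSpace X.I x} (T : X.M → X.E →L[ℝ] X.E)
    (hT : ∀ x, X.coordEndo J x =ᶠ[𝓝 (extChartAt X.I x x)] fun _ => T x)
    (h1 : ∀ x v, J x (J x v) = -v)
    (h2 : ∀ x v w, X.g.inner x (J x v) (J x w) = X.g.inner x v w)
    (h3 : ∀ x, LocalMetric.IsParallelAt (X.coordMetric x) (fun _ => T x) (extChartAt X.I x x)) :
    X.IsKaehlerWith J := by
  refine ⟨fun x => ?_, h1, h2, fun x => (h3 x).congr EventuallyEq.rfl (hT x)⟩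
  have h := (contMDiffAt_endo_iff (J := J) (mem_extChartAt_target (I := X.I) x)).2
    (contDiffAt_const.congr_of_eventuallyEq (hT x))
  rwa [extChartAt_to_inv] at h

/-- Multiplication by `i` as a real linear map. -/
def mulI : ℂ →L[ℝ] ℂ := ContinuousLinearMap.mul ℝ ℂ Complex.I

theorem mulI_apply (v : ℂ) : mulI v = Complex.I * v := rfl

/-- The complex structure of the hyperbolic surface. -/
def hyperbolicEndo (x : hyperbolic.M) :
    TangentSpace hyperbolic.I x →L[ℝ] TangentSpace hyperbolic.I x := mulI

/-- In all preferred charts the complex structure is multiplication by `i`, since the changes of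
coordinates are holomorphic. -/
theorem isKaehlerWith_hyperbolic : hyperbolic.IsKaehlerWith hyperbolicEndo := by
  have hp : ∀ (x : LevelThree.Surface) {p : UpperHalfPlane}, p ∈ LevelThree.sheet x →
      hyperbolic.coordEndo hyperbolicEndo x (p : ℂ) = mulI := by
    intro x p hp
    have ht : (p : ℂ) ∈ (extChartAt 𝓘(ℝ, ℂ) x).target := by
      rw [LevelThree.target_eq]
      exact ⟨p, hp, rfl⟩
    obtain ⟨g, -, -, h⟩ := LevelThree.mfderiv_symm hp
    refine coordEndo_eq_of_comp_eq (X := hyperbolic) ht fun (v : ℂ) => ?_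
    have e : mulI (mfderiv 𝓘(ℝ, ℂ) 𝓘(ℝ, ℂ) (extChartAt 𝓘(ℝ, ℂ) x).symm (p : ℂ) v) =
        LevelThree.moebiusDeriv g p * mulI v := by
      refine (congrArg mulI (h v)).trans ?_
      rw [mulI_apply, mulI_apply]
      ring
    exact e.trans (h (mulI v)).symm
  have hinner : ∀ v w : ℂ, inner ℝ (mulI v) (mulI w) = inner ℝ v w := by
    intro v w
    rw [mulI_apply, mulI_apply, LevelThree.inner_mul_mul, Complex.norm_I, one_pow, one_mul]
  refine isKaehlerWith_of_coordEndo_eventuallyEq (X := hyperbolic) (fun _ => mulI)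
    (fun (x : LevelThree.Surface) => ?_) (fun x (v : ℂ) => ?_) (fun x (v w : ℂ) => ?_)
    (fun (x : LevelThree.Surface) => ?_)
  · have h : ∀ᶠ z : ℂ in 𝓝 (LevelThree.lift x : ℂ),
        (hyperbolic.coordEndo hyperbolicEndo x z : ℂ →L[ℝ] ℂ) = mulI := by
      rw [← UpperHalfPlane.isOpenEmbedding_coe.map_nhds_eq]
      refine eventually_map.2 ?_
      filter_upwards [(LevelThree.isOpen_sheet x).mem_nhds (LevelThree.lift_mem_sheet x)] with q hq
      exact hp x hq
    rw [← LevelThree.extChartAt_self] at h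
    exact h
  · change mulI (mulI v) = -v
    rw [mulI_apply, mulI_apply, ← mul_assoc, Complex.I_mul_I, neg_one_mul]
  · exact congrArg _ (hinner v w)
  · have hx := (LevelThree.lift x).im_pos
    have h := LocalMetric.IsParallelAt.conformal (T := mulI)
      (coordMetric_hyperbolic_eventuallyEq x (LevelThree.lift_mem_sheet x))
      (inv_pos.2 (pow_pos hx 2)) (hasFDerivAt_inv_im_sq hx.ne') ?_
    · rw [← LevelThree.extChartAt_self] at h
      exact h
    · intro u v
      apply Complex.ext <;>
        simp [mulI_apply, Complex.inner] <;> ring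

/-! ### The cross product -/

local notation "E₂" => EuclideanSpace ℝ (Fin 2)
local notation "E₃" => EuclideanSpace ℝ (Fin 3)

theorem inner_fin_two (a b : E₂) : inner ℝ a b = a 0 * b 0 + a 1 * b 1 := by
  simp [EuclideanSpace.inner_eq_star_dotProduct, Fin.sum_univ_two, dotProduct, mul_comm]

theorem inner_fin_three (a b : E₃) : inner ℝ a b = a 0 * b 0 + a 1 * b 1 + a 2 * b 2 := by
  simp [EuclideanSpace.inner_eq_star_dotProduct, Fin.sum_univ_three, dotProduct, mul_comm]

/-- The cross product on Euclidean three-space. -/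
def cross (a b : EuclideanSpace ℝ (Fin 3)) : EuclideanSpace ℝ (Fin 3) :=
  !₂[a 1 * b 2 - a 2 * b 1, a 2 * b 0 - a 0 * b 2, a 0 * b 1 - a 1 * b 0]

theorem cross_add_left (a b c : E₃) : cross (a + b) c = cross a c + cross b c := by
  ext i; fin_cases i <;> simp [cross] <;> ring

theorem cross_add_right (a b c : E₃) : cross a (b + c) = cross a b + cross a c := by
  ext i; fin_cases i <;> simp [cross] <;> ring

theorem cross_smul_left (t : ℝ) (a b : E₃) : cross (t • a) b = t • cross a b := by
  ext i; fin_cases i <;> simp [cross] <;> ring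

theorem cross_smul_right (t : ℝ) (a b : E₃) : cross a (t • b) = t • cross a b := by
  ext i; fin_cases i <;> simp [cross] <;> ring

theorem cross_self (a : E₃) : cross a a = 0 := by
  ext i; fin_cases i <;> simp [cross] <;> ring

theorem cross_anticomm (a b : E₃) : cross a b = -cross b a := by
  ext i; fin_cases i <;> simp [cross] <;> ring

theorem cross_cross (a b c : E₃) :
    cross a (cross b c) = inner ℝ a c • b - inner ℝ a b • c := by
  simp only [inner_fin_three]
  ext i; fin_cases i <;> simp [cross] <;> ring

theorem inner_cross_self (a b : E₃) :
    inner ℝ (cross a b) (cross a b) = inner ℝ a a * inner ℝ b b - inner ℝ a b ^ 2 := by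
  simp only [inner_fin_three]
  simp [cross]; ring

/-- Rotation of the plane by a right angle. -/
def rot : E₂ →L[ℝ] E₂ := LinearMap.toContinuousLinearMap
  { toFun := fun v => !₂[-v 1, v 0]
    map_add' := fun v w => by ext i; fin_cases i <;> simp; ring
    map_smul' := fun t v => by ext i; fin_cases i <;> simp }

theorem rot_apply (v : E₂) : rot v = !₂[-v 1, v 0] := rfl

theorem rot_rot (v : E₂) : rot (rot v) = -v := by
  ext i; fin_cases i <;> simp [rot_apply]

theorem inner_rot_rot (v w : E₂) : inner ℝ (rot v) (rot w) = inner ℝ v w := by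
  simp only [inner_fin_two]
  simp [rot_apply]; ring

theorem inner_smul_rot (w v : E₂) :
    inner ℝ w v • rot w + inner ℝ w (rot v) • w = inner ℝ w w • rot v := by
  simp only [inner_fin_two]
  ext i
  fin_cases i <;> simp [rot_apply] <;> ring

/-- The algebraic identity behind the fact that the complex structure of the plane is parallel for all
conformal metrics. -/
theorem rot_conformal (A u v : E₂) : inner ℝ A (rot v) • u - inner ℝ u (rot v) • A =
    inner ℝ A v • rot u - inner ℝ u v • rot A := by
  simp only [inner_fin_two]
  ext i
  fin_cases i <;> simp [rot_apply] <;> ring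

/-- For an isometry `L` onto the orthogonal complement of the unit vector `x`, the cross product with
`x` corresponds to the rotation by a right angle in positive or negative direction. -/
theorem exists_sign_cross {x : E₃} (hx : inner ℝ x x = (1 : ℝ)) (L : E₂ →ₗᵢ[ℝ] E₃)
    (hL : ∀ w, inner ℝ (L w) x = (0 : ℝ)) :
    ∃ s : ℝ, s ^ 2 = 1 ∧ ∀ v, cross x (L v) = s • L (rot v) := by
  set p := L !₂[1, 0] with hp
  set q := L !₂[0, 1] with hq
  have hpp : inner ℝ p p = (1 : ℝ) := by
    rw [hp, L.inner_map_map, inner_fin_two]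
    simp
  have hqq : inner ℝ q q = (1 : ℝ) := by
    rw [hq, L.inner_map_map, inner_fin_two]
    simp
  have hqp : inner ℝ q p = (0 : ℝ) := by
    rw [hp, hq, L.inner_map_map, inner_fin_two]
    simp
  have hxp : inner ℝ x p = (0 : ℝ) := by rw [real_inner_comm]; exact hL _
  have h1 : cross q (cross x p) = 0 := by
    rw [cross_cross, hqp, hL, zero_smul, zero_smul, sub_zero]
  have h2 : cross x p = inner ℝ q (cross x p) • q := by
    have h := cross_cross q q (cross x p)
    rw [h1, hqq, one_smul] at h
    have h0 : cross q (0 : E₃) = 0 := by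
      have := cross_smul_right 0 q q
      rwa [zero_smul, zero_smul] at this
    rw [h0] at h
    exact (sub_eq_zero.1 h.symm).symm
  set s := (inner ℝ q (cross x p) : ℝ) with hs
  have hs2 : s ^ 2 = 1 := by
    have h := inner_cross_self x p
    rw [h2, hx, hpp, hxp, inner_smul_left, inner_smul_right, hqq] at h
    simp only [conj_trivial] at h
    linarith
  have h3 : cross x q = (-s) • p := by
    have h4 : q = s • cross x p := by rw [h2, smul_smul, ← sq, hs2, one_smul]
    rw [h4, cross_smul_right, cross_cross, hxp, hx]
    module
  refine ⟨s, hs2, fun v => ?_⟩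
  have hv : L v = v 0 • p + v 1 • q := by
    rw [hp, hq, ← map_smul, ← map_smul, ← map_add]
    congr 1
    ext i
    fin_cases i <;> simp
  have hv' : L (rot v) = (-v 1) • p + v 0 • q := by
    rw [hp, hq, ← map_smul, ← map_smul, ← map_add]
    congr 1
    ext i
    fin_cases i <;> simp [rot_apply]
  rw [hv, hv', cross_add_right, cross_smul_right, cross_smul_right, h2, h3]
  module

/-- The inverse of the stereographic projection intertwines, up to the sign `s`, the rotation of the
plane and the complex structure `v ↦ F × v` of the sphere. -/
theorem cross_stereographic {x : E₃} (L : E₂ →ₗᵢ[ℝ] E₃)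
    (hL : ∀ w, inner ℝ (L w) x = (0 : ℝ)) {s : ℝ} (hs : s ^ 2 = 1)
    (hc : ∀ v, cross x (L v) = s • L (rot v)) {D : E₂ → E₃} {w : E₂}
    (hD : ∀ u, D u = (4 / (‖w‖ ^ 2 + 4)) • L u +
      (-(8 * inner ℝ w u / (‖w‖ ^ 2 + 4) ^ 2)) • L w +
      (16 * inner ℝ w u / (‖w‖ ^ 2 + 4) ^ 2) • (-x)) (v : E₂) :
    cross ((‖w‖ ^ 2 + 4)⁻¹ • ((4 : ℝ) • L w - (‖w‖ ^ 2 - 4) • x)) (D v) = s • D (rot v) := by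
  set ρ := ‖w‖ ^ 2 + 4 with hρ
  have hρ0 : ρ ≠ 0 := by positivity
  have hc' : ∀ v, cross (L v) x = (-s) • L (rot v) := fun v => by
    rw [cross_anticomm, hc, neg_smul]
  -- the cross product of two tangent vectors is normal
  have hLL : cross (L w) (L v) = (-(s * inner ℝ w (rot v))) • x := by
    have h1 : L v = (-s) • cross x (L (rot v)) := by
      rw [hc, rot_rot, map_neg, smul_smul, smul_neg, ← neg_smul]
      rw [show -(-s * s) = s ^ 2 by ring, hs, one_smul]
    rw [h1, cross_smul_right, cross_cross, hL, L.inner_map_map]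
    module
  have e1 : (‖w‖ ^ 2 + 4)⁻¹ • ((4 : ℝ) • L w - (‖w‖ ^ 2 - 4) • x) =
      (4 / ρ) • L w + (-(‖w‖ ^ 2 - 4) / ρ) • x := by
    rw [← hρ]
    module
  have hw2 : ‖w‖ ^ 2 = ρ - 4 := by rw [hρ]; ring
  have key := congrArg L (inner_smul_rot w v)
  rw [map_add, map_smul, map_smul, map_smul, real_inner_self_eq_norm_sq, hw2] at key
  rw [e1, hD, hD]
  simp only [cross_add_left, cross_add_right, cross_smul_left, cross_smul_right, cross_self, hLL, hc,
    hc', smul_neg, ← neg_smul, smul_zero, add_zero, hw2]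
  have hk : (inner ℝ w v : ℝ) • L (rot w) + (inner ℝ w (rot v) : ℝ) • L w - (ρ - 4) • L (rot v) = 0 :=
    sub_eq_zero.2 key
  have hz : (8 * s / ρ ^ 2) • ((inner ℝ w v : ℝ) • L (rot w) + (inner ℝ w (rot v) : ℝ) • L w -
      (ρ - 4) • L (rot v)) = 0 := by rw [hk, smul_zero]
  rw [← sub_eq_zero]
  refine Eq.trans ?_ hz
  match_scalars <;> field_simp <;> ring

/-! ### The complex structure of the two-sphere -/

/-- The isometry onto the tangent space at `x` that underlies the preferred chart at `x`. -/
def tangentIso (x : Metric.sphere (0 : E₃) 1) : E₂ →ₗᵢ[ℝ] E₃ := (exists_sphere_chart_eq 2 x).choose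

theorem inner_self_sphere (x : Metric.sphere (0 : E₃) 1) :
    inner ℝ (x : E₃) (x : E₃) = (1 : ℝ) := by
  rw [real_inner_self_eq_norm_sq, norm_eq_of_mem_sphere]
  norm_num

/-- The orientation of the preferred chart at `x` relative to the outer normal. -/
def sphereSign (x : Metric.sphere (0 : E₃) 1) : ℝ :=
  (exists_sign_cross (inner_self_sphere x) (tangentIso x)
    (exists_sphere_chart_eq 2 x).choose_spec.1).choose

theorem sphereSign_sq (x : Metric.sphere (0 : E₃) 1) : sphereSign x ^ 2 = 1 :=
  (exists_sign_cross (inner_self_sphere x) (tangentIso x)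
    (exists_sphere_chart_eq 2 x).choose_spec.1).choose_spec.1

/-- The complex structure of the two-sphere, with respect to the preferred charts. At `x` it is
`v ↦ x × v`; the sign makes up for the choice of the chart, which may reverse the orientation. -/
def sphereEndo (x : (roundSphere 2).M) :
    TangentSpace (roundSphere 2).I x →L[ℝ] TangentSpace (roundSphere 2).I x :=
  sphereSign x • rot

/-- The derivative of the inclusion of the sphere into Euclidean space. -/
def dIncl (x : Metric.sphere (0 : E₃) 1) : E₂ →L[ℝ] E₃ :=
  mfderiv (𝓡 2) 𝓘(ℝ, E₃) (Subtype.val : Metric.sphere (0 : E₃) 1 → E₃) x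

theorem dIncl_injective (x : Metric.sphere (0 : E₃) 1) : Function.Injective (dIncl x) := by
  have := Fact.mk (@finrank_euclideanSpace_fin ℝ _ (2 + 1))
  have h : Function.Injective
      (mfderiv (𝓡 2) 𝓘(ℝ, E₃) (Subtype.val : Metric.sphere (0 : E₃) 1 → E₃) x) := by
    convert! injective_mvfderiv_subtypeVal_sphere x
  exact h

theorem dIncl_comp (x : Metric.sphere (0 : E₃) 1) (w v : E₂) :
    dIncl ((extChartAt (𝓡 2) x).symm w) (mfderiv 𝓘(ℝ, E₂) (𝓡 2) (extChartAt (𝓡 2) x).symm w v) =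
      (4 / (‖w‖ ^ 2 + 4)) • tangentIso x v +
      (-(8 * inner ℝ w v / (‖w‖ ^ 2 + 4) ^ 2)) • tangentIso x w +
      (16 * inner ℝ w v / (‖w‖ ^ 2 + 4) ^ 2) • (-(x : E₃)) :=
  mfderiv_coe_mfderiv_sphere_symm 2 x (exists_sphere_chart_eq 2 x).choose_spec.2 w v

theorem dIncl_self (x : Metric.sphere (0 : E₃) 1) (v : E₂) : dIncl x v = tangentIso x v := by
  have h := dIncl_comp x 0 v
  have e : (extChartAt (𝓡 2) x).symm 0 = x := by
    rw [← sphere_extChartAt_self 2 x, extChartAt_to_inv]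
  have hd : ∀ y : E₂, y = extChartAt (𝓡 2) x x →
      mfderiv 𝓘(ℝ, E₂) (𝓡 2) (extChartAt (𝓡 2) x).symm y v = v := by
    rintro y rfl
    have := DFunLike.congr_fun (mfderivWithin_range_extChartAt_symm (I := 𝓡 2) (x := x)) v
    rw [modelWithCornersSelf_coe, Set.range_id, mfderivWithin_univ] at this
    exact this
  rw [hd 0 (sphere_extChartAt_self 2 x).symm, e] at h
  rw [h]
  simp

/-- In stereographic coordinates the complex structure of the sphere is constant: it is the rotation by a
right angle, in the same direction for all points. The differential of the chart is injective into
Euclidean space, where the complex structure is the cross product with the position vector. -/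
theorem coordEndo_sphereEndo (x : Metric.sphere (0 : E₃) 1) (w : E₂) :
    (roundSphere 2).coordEndo sphereEndo x w = sphereSign x • rot := by
  have hw : w ∈ (extChartAt (𝓡 2) x).target := by rw [sphere_target]; trivial
  refine coordEndo_eq_of_comp_eq (X := roundSphere 2) hw fun (v : E₂) => ?_
  set y : Metric.sphere (0 : E₃) 1 := (extChartAt (𝓡 2) x).symm w with hy
  let D : E₂ → E₂ := fun v => mfderiv 𝓘(ℝ, E₂) (𝓡 2) (extChartAt (𝓡 2) x).symm w v
  have hcross : ∀ (z : Metric.sphere (0 : E₃) 1) (u : E₂),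
      cross z (tangentIso z u) = sphereSign z • tangentIso z (rot u) := fun z =>
    (exists_sign_cross (inner_self_sphere z) (tangentIso z)
      (exists_sphere_chart_eq 2 z).choose_spec.1).choose_spec.2
  have hyw : (y : E₃) = (‖w‖ ^ 2 + 4)⁻¹ • ((4 : ℝ) • tangentIso x w - (‖w‖ ^ 2 - 4) • (x : E₃)) :=
    (exists_sphere_chart_eq 2 x).choose_spec.2 w
  have h := cross_stereographic (tangentIso x) (exists_sphere_chart_eq 2 x).choose_spec.1
    (sphereSign_sq x) (hcross x) (D := fun u => dIncl y (D u)) (dIncl_comp x w) v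
  rw [← hyw] at h
  have key : sphereSign y • rot (D v) = D (sphereSign x • rot v) := by
    refine dIncl_injective y ?_
    have e : D (sphereSign x • rot v) = sphereSign x • D (rot v) := map_smul _ _ _
    rw [e, map_smul, map_smul, ← h, dIncl_self, dIncl_self, hcross]
  exact key

theorem isKaehlerWith_sphere : (roundSphere 2).IsKaehlerWith sphereEndo := by
  refine isKaehlerWith_of_coordEndo_eventuallyEq (X := roundSphere 2)
    (fun x => (sphereSign x • rot : E₂ →L[ℝ] E₂))
    (fun (x : Metric.sphere (0 : E₃) 1) => Eventually.of_forall fun (w : E₂) =>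
      coordEndo_sphereEndo x w)
    (fun (x : Metric.sphere (0 : E₃) 1) (v : E₂) => ?_)
    (fun (x : Metric.sphere (0 : E₃) 1) (v w : E₂) => ?_)
    (fun (x : Metric.sphere (0 : E₃) 1) => ?_)
  · change sphereSign x • rot (sphereSign x • rot v) = -v
    rw [map_smul, rot_rot, smul_smul, ← sq, sphereSign_sq, one_smul]
  · change inner ℝ (dIncl x (sphereSign x • rot v)) (dIncl x (sphereSign x • rot w)) =
      inner ℝ (dIncl x v) (dIncl x w)
    simp only [dIncl_self, LinearIsometry.inner_map_map, inner_smul_left, inner_smul_right,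
      inner_rot_rot, conj_trivial]
    rw [← mul_assoc, ← sq, sphereSign_sq, one_mul]
  · refine LocalMetric.IsParallelAt.conformal (E := E₂) (l := stereoFactor 2)
      (A := -(2 / (‖(extChartAt (𝓡 2) x x : E₂)‖ ^ 2 + 4)) • (extChartAt (𝓡 2) x x : E₂))
      (Eventually.of_forall (coordMetric_sphere 2 x)) (stereoFactor_pos 2 _)
      (hasFDerivAt_stereoFactor 2 _) fun u v => ?_
    generalize -(2 / (‖(extChartAt (𝓡 2) x x : E₂)‖ ^ 2 + 4)) • (extChartAt (𝓡 2) x x : E₂) = A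
    have h := congrArg (sphereSign x • ·) (rot_conformal A u v)
    simp only [smul_sub, smul_smul] at h
    simp only [smul_apply, inner_smul_right, smul_smul]
    rw [h, mul_comm, mul_comm (sphereSign x)]

end RiemMfd

/-! ### Products of the hyperbolic surface and the two-sphere -/

namespace RiemMfd

/-- The product of the hyperbolic surface of curvature `-a⁻²` and the sphere of curvature `a⁻²`. -/
abbrev hyperbolicProdSphere (a : ℝ) (ha : 0 < a) : RiemMfd :=
  (hyperbolic.rescale a ha).prod ((roundSphere 2).rescale a ha)

section

variable (a : ℝ) (ha : 0 < a)

theorem dim_hyperbolicProdSphere : (hyperbolicProdSphere a ha).dim = 4 := by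
  rw [dim_prod, dim_rescale, dim_rescale, dim_hyperbolic, dim_roundSphere]

theorem connectedSpace_hyperbolicProdSphere : ConnectedSpace (hyperbolicProdSphere a ha).M := by
  have h1 := connectedSpace_hyperbolic
  have h2 := connectedSpace_roundSphere 2 one_le_two
  exact inferInstanceAs (ConnectedSpace (hyperbolic.M × (roundSphere 2).M))

theorem isComplete_hyperbolicProdSphere : (hyperbolicProdSphere a ha).IsComplete :=
  (isComplete_hyperbolic.rescale a ha).prod ((isComplete_roundSphere 2).rescale a ha)

theorem isKaehler_hyperbolicProdSphere : (hyperbolicProdSphere a ha).IsKaehler :=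
  ((isKaehlerWith_hyperbolic.rescale a ha).prod (isKaehlerWith_sphere.rescale a ha)).isKaehler

theorem isScalarFlat_hyperbolicProdSphere : (hyperbolicProdSphere a ha).IsScalarFlat := by
  refine isScalarFlat_prod (κ := 1 / a ^ 2) ?_ ((hasCurvatureNear_sphere 2).rescale a ha) ?_
  · rw [← neg_div]
    exact hasCurvatureNear_hyperbolic.rescale a ha
  · rw [dim_rescale, dim_rescale, dim_hyperbolic, dim_roundSphere]

theorem isCriticalWith_hyperbolicProdSphere :
    (hyperbolicProdSphere a ha).IsCriticalWith ![2, -2, 0, 0, 0] :=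
  isCriticalWith_prod (hasCurvatureNear_hyperbolic.rescale a ha)
    ((hasCurvatureNear_sphere 2).rescale a ha)

theorem rmNorm_hyperbolicProdSphere (x : (hyperbolicProdSphere a ha).M) :
    (hyperbolicProdSphere a ha).rmNorm x = 2 * Real.sqrt 2 * a⁻¹ ^ 2 := by
  obtain ⟨x, y⟩ := x
  have hx := rmSq_of_hasCurvatureNear (hasCurvatureNear_hyperbolic.rescale a ha)
    ((hyperbolic.dim_rescale a ha).trans dim_hyperbolic) x
  have hy := rmSq_of_hasCurvatureNear ((hasCurvatureNear_sphere 2).rescale a ha)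
    (((roundSphere 2).dim_rescale a ha).trans (dim_roundSphere 2)) y
  have h := (hyperbolic.rescale a ha).rmSq_prod ((roundSphere 2).rescale a ha) x y
  rw [hx, hy] at h
  refine (congrArg Real.sqrt h).trans ?_
  have e : 4 * (-1 / a ^ 2) ^ 2 + 4 * (1 / a ^ 2) ^ 2 = (2 * a⁻¹ ^ 2) ^ 2 * 2 := by
    field_simp
    norm_num
  rw [e, Real.sqrt_mul (sq_nonneg _), Real.sqrt_sq (by positivity)]
  ring

theorem vol_ball_prod_rescale_le (X Y : RiemMfd) (x : X.M) (y : Y.M) (r : ℝ) :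
    ((X.rescale a ha).prod (Y.rescale a ha)).vol (((X.rescale a ha).prod (Y.rescale a ha)).ball
        (show ((X.rescale a ha).prod (Y.rescale a ha)).M from (x, y)) r) ≤
      X.vol (X.ball x (a⁻¹ * r)) *
        (ENNReal.ofReal (a ^ X.dim) * (ENNReal.ofReal (a ^ Y.dim) * Y.vol Set.univ)) := by
  have hX := (X.vol_rescale_le a ha ((X.rescale a ha).ball x r)).trans
    (mul_le_mul_right (measure_mono (X.ball_rescale_subset a ha x r)) _)
  have hY := Y.vol_rescale_le a ha Set.univ
  refine (vol_ball_prod_le (X.rescale a ha) (Y.rescale a ha) x y r).trans ((mul_le_mul' hX hY).trans (le_of_eq ?_))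
  rw [mul_comm (ENNReal.ofReal (a ^ X.dim)), mul_assoc]
  rfl

/-- Far out in the cusp the unit balls of the product have small volume, while the curvature is
constant. -/
theorem exists_energy_hyperbolicProdSphere_le {ε : ℝ} (hε : 0 < ε) :
    ∃ x, (hyperbolicProdSphere a ha).energy x 1 ≤ ENNReal.ofReal ε := by
  obtain ⟨b, hb, hE⟩ : ∃ b : ℝ≥0∞, b ≠ ⊤ ∧ ∀ x, (hyperbolicProdSphere a ha).energy x 1 ≤
      b * (hyperbolicProdSphere a ha).vol ((hyperbolicProdSphere a ha).ball x 1) :=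
    ⟨_, ENNReal.ofReal_ne_top,
      fun x => energy_le (fun x => (rmNorm_hyperbolicProdSphere a ha x).le) x 1⟩
  obtain ⟨c, hc, hV⟩ : ∃ c : ℝ≥0∞, c ≠ ⊤ ∧ ∀ (x : hyperbolic.M) (y : (roundSphere 2).M),
      (hyperbolicProdSphere a ha).vol ((hyperbolicProdSphere a ha).ball
        (show (hyperbolicProdSphere a ha).M from (x, y)) 1) ≤
      hyperbolic.vol (hyperbolic.ball x (a⁻¹ * 1)) * c :=
    ⟨_, ENNReal.mul_ne_top ENNReal.ofReal_ne_top (ENNReal.mul_ne_top ENNReal.ofReal_ne_top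
      (vol_roundSphere_lt_top 2 _).ne), fun x y => vol_ball_prod_rescale_le a ha _ _ x y 1⟩
  obtain ⟨x, hx⟩ := exists_vol_ball_hyperbolic_le (a⁻¹ * 1)
    (ENNReal.div_pos (ENNReal.ofReal_pos.2 hε).ne' (ENNReal.mul_ne_top hb hc))
  obtain ⟨y⟩ := (connectedSpace_roundSphere 2 one_le_two).toNonempty
  refine ⟨(show (hyperbolicProdSphere a ha).M from (x, y)), (hE _).trans ?_⟩
  refine (mul_le_mul_right ((hV x y).trans (mul_le_mul_left hx c)) b).trans ?_
  generalize ENNReal.ofReal ε = e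
  refine le_trans (le_of_eq ?_) (ENNReal.mul_div_le (a := b * c) (b := e))
  ring

end

/-- A product with large curvature and small energy violates every given `ε`-regularity estimate. -/
theorem not_epsilonRegularity {n : ℕ} {𝒞 : RiemMfd → Prop}
    (h : ∀ ε : ℝ, 0 < ε → ∀ C : ℝ, ∃ X : RiemMfd, X.dim = n ∧ ConnectedSpace X.M ∧ X.IsComplete ∧
      𝒞 X ∧ ∃ x, X.energy x 1 ≤ ENNReal.ofReal ε ∧ C < X.rmNorm x) : ¬ EpsilonRegularity n 𝒞 := by
  rintro ⟨ε, hε, C, hreg⟩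
  obtain ⟨X, hd, hc, hX, hX', x, hx, hlt⟩ := h ε hε C
  have := hreg X hd hc hX hX' x 1 one_pos le_rfl hx x (X.mem_ball_self x (by norm_num))
  rw [inv_one, one_pow, mul_one] at this
  exact hlt.not_ge this

/-- The curvature of the products exceeds any bound as `a` tends to zero; `a = (|C| + 1)⁻¹` suffices. -/
theorem exists_lt_rmNorm_hyperbolicProdSphere {ε : ℝ} (hε : 0 < ε) (C : ℝ) :
    ∃ (a : ℝ) (ha : 0 < a) (x : (hyperbolicProdSphere a ha).M),
      (hyperbolicProdSphere a ha).energy x 1 ≤ ENNReal.ofReal ε ∧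
        C < (hyperbolicProdSphere a ha).rmNorm x := by
  obtain ⟨x, hx⟩ := exists_energy_hyperbolicProdSphere_le (|C| + 1)⁻¹ (by positivity) hε
  refine ⟨_, _, x, hx, ?_⟩
  rw [rmNorm_hyperbolicProdSphere, inv_inv]
  have h1 : 1 ≤ Real.sqrt 2 := Real.one_le_sqrt.2 one_le_two
  nlinarith [le_abs_self C, abs_nonneg C, sq_nonneg |C|]

end RiemMfd

/-! ### Failure of the regularity estimates -/

theorem theorem1p6 :
    -- failure for critical metrics in dimension four
    ¬ RiemMfd.EpsilonRegularity 4 RiemMfd.IsCritical ∧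
    -- the same with fixed coefficients, for scalar-flat Kähler metrics
    ¬ RiemMfd.EpsilonRegularity 4 (fun X =>
        X.IsCriticalWith ![2, -2, 0, 0, 0] ∧ X.IsKaehler ∧ X.IsScalarFlat) ∧
    -- failure for Einstein metrics in dimensions at least five
    (∀ n : ℕ, 5 ≤ n → ¬ RiemMfd.EpsilonRegularity n RiemMfd.IsEinstein) ∧
    -- the four-dimensional counterexamples
    (∃ N : RiemMfd, N.dim = 2 ∧ ConnectedSpace N.M ∧ N.IsComplete ∧ NoncompactSpace N.M ∧
      N.vol Set.univ < ⊤ ∧ N.HasConstantCurvature (-1) ∧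
      ∀ (a : ℝ) (ha : 0 < a),
        let X := (N.rescale a ha).prod ((RiemMfd.roundSphere 2).rescale a ha)
        X.dim = 4 ∧ ConnectedSpace X.M ∧ X.IsComplete ∧ X.IsKaehler ∧ X.IsScalarFlat ∧
        X.IsCriticalWith ![2, -2, 0, 0, 0] ∧
        (∀ x, X.rmNorm x = 2 * Real.sqrt 2 * a⁻¹ ^ 2) ∧
        ∀ ε : ℝ, 0 < ε → ∃ x : X.M, X.energy x 1 ≤ ENNReal.ofReal ε) ∧
    -- the higher-dimensional counterexamples
    (∀ n : ℕ, 5 ≤ n → ∀ a : ℝ, 0 < a →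
      ∃ N : RiemMfd, N.dim + 1 = n ∧ ConnectedSpace N.M ∧ N.IsComplete ∧ N.IsRicciFlat ∧
      ∃ p : N.M, N.rmNorm p = a ∧ (∀ x, N.rmNorm x ≤ a) ∧
      ∀ ε : ℝ, 0 < ε → ∃ θ₀ : ℝ, 0 < θ₀ ∧ ∀ (θ : ℝ) (hθ : 0 < θ), θ ≤ θ₀ →
        let X := N.prod ((RiemMfd.roundSphere 1).rescale θ hθ)
        X.dim = n ∧ ConnectedSpace X.M ∧ X.IsComplete ∧ X.IsRicciFlat ∧
        ∀ q : Metric.sphere (0 : EuclideanSpace ℝ (Fin (1 + 1))) 1,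
          X.rmNorm (p, q) = a ∧ X.energy (p, q) 1 ≤ ENNReal.ofReal ε) := by
  refine ⟨RiemMfd.not_epsilonRegularity fun ε hε C => ?_,
    RiemMfd.not_epsilonRegularity fun ε hε C => ?_,
    fun n hn => RiemMfd.not_epsilonRegularity fun ε hε C => ?_,
    ⟨RiemMfd.hyperbolic, RiemMfd.dim_hyperbolic, RiemMfd.connectedSpace_hyperbolic,
      RiemMfd.isComplete_hyperbolic, RiemMfd.noncompactSpace_hyperbolic,
      RiemMfd.vol_hyperbolic_lt_top, RiemMfd.hasConstantCurvature_hyperbolic, fun a ha =>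
      ⟨RiemMfd.dim_hyperbolicProdSphere a ha, RiemMfd.connectedSpace_hyperbolicProdSphere a ha,
        RiemMfd.isComplete_hyperbolicProdSphere a ha, RiemMfd.isKaehler_hyperbolicProdSphere a ha,
        RiemMfd.isScalarFlat_hyperbolicProdSphere a ha,
        RiemMfd.isCriticalWith_hyperbolicProdSphere a ha,
        RiemMfd.rmNorm_hyperbolicProdSphere a ha,
        fun ε hε => RiemMfd.exists_energy_hyperbolicProdSphere_le a ha hε⟩⟩,
    RiemMfd.exists_ricciFlat_collapsing⟩
  · obtain ⟨a, ha, x, hx, hC⟩ := RiemMfd.exists_lt_rmNorm_hyperbolicProdSphere hε C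
    exact ⟨_, RiemMfd.dim_hyperbolicProdSphere a ha, RiemMfd.connectedSpace_hyperbolicProdSphere a ha,
      RiemMfd.isComplete_hyperbolicProdSphere a ha,
      ⟨_, RiemMfd.isCriticalWith_hyperbolicProdSphere a ha⟩, x, hx, hC⟩
  · obtain ⟨a, ha, x, hx, hC⟩ := RiemMfd.exists_lt_rmNorm_hyperbolicProdSphere hε C
    exact ⟨_, RiemMfd.dim_hyperbolicProdSphere a ha, RiemMfd.connectedSpace_hyperbolicProdSphere a ha,
      RiemMfd.isComplete_hyperbolicProdSphere a ha,
      ⟨RiemMfd.isCriticalWith_hyperbolicProdSphere a ha, RiemMfd.isKaehler_hyperbolicProdSphere a ha,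
        RiemMfd.isScalarFlat_hyperbolicProdSphere a ha⟩, x, hx, hC⟩
  · obtain ⟨N, -, -, -, -, p, -, -, h⟩ :=
      RiemMfd.exists_ricciFlat_collapsing n hn (|C| + 1) (by positivity)
    obtain ⟨θ, hθ, h⟩ := h ε hε
    obtain ⟨hd, hc, hX, hR, h⟩ := h θ hθ le_rfl
    obtain ⟨q⟩ := (RiemMfd.connectedSpace_roundSphere 1 le_rfl).toNonempty
    obtain ⟨hq, hE⟩ := h q
    refine ⟨_, hd, hc, hX, ⟨0, ?_, fun x u v => (hR x u v).trans (zero_mul _).symm⟩, _, hE, ?_⟩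
    · have h5 : (5 : ℝ) ≤ n := by exact_mod_cast hn
      rw [abs_zero, hd]
      linarith
    · rw [hq]
      linarith [le_abs_self C]
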